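/- Let $\mathfrak g=\mathfrak g_{\bar 0}\oplus\mathfrak g_{\bar 1}$ be one of the exceptional simple complex Lie superalgebras $$G(3)=(\mathfrak{sl}(2)\oplus G_2)\oplus(\mathbb C^2\otimes\mathbb C^7),\qquad F(4)=(\mathfrak{sl}(2)\oplus\mathfrak{so}(7))\oplus(\mathbb C^2\otimes\mathbb S),\quad \mathbb S=\mathbb C^8 \text{ the spinor module},$$ with Cartan subalgebra $\mathfrak h$. For $G(3)$ let $\delta,\varepsilon_1,\varepsilon_2,\varepsilon_3\in\mathfrak h^*$, $\varepsilon_1+\varepsilon_2+\varepsilon_3=0$, be such that the weights of $\mathbb C^2$ are $\pm\delta$ and those of $\mathbb C^7$ are $\pm\varepsilon_i,0$. For $F(4)$ let $\delta,\varepsilon_1,\varepsilon_2,\varepsilon_3\in\mathfrak h^*$ be a basis such that the weights of $\mathbb C^2$ are $\pm\frac12\delta$ and those of $\mathbb S$ are $\frac12(\pm\varepsilon_1\pm\varepsilon_2\pm\varepsilon_3)$. Up to conjugation the simple root systems $\Xi=(\alpha_1,\alpha_2,\dots)$ of $\mathfrak g$ are, for $G(3)$: - I: $\delta-\varepsilon_1-\varepsilon_2,\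 \varepsilon_1,\ \varepsilon_2-\varepsilon_1$; - II: $\varepsilon_1+\varepsilon_2-\delta,\ \delta-\varepsilon_2,\ \varepsilon_2-\varepsilon_1$; - III: $\varepsilon_2-\delta,\ \delta-\varepsilon_1,\ \varepsilon_1$; - IV: $\varepsilon_2-\varepsilon_1,\ \varepsilon_1-\delta,\ \delta$; and for $F(4)$: - I: $\frac12(\delta-\varepsilon_1-\varepsilon_2-\varepsilon_3),\ \varepsilon_3,\ \varepsilon_2-\varepsilon_3,\ \varepsilon_1-\varepsilon_2$; - II: $\frac12(-\delta+\varepsilon_1+\varepsilon_2+\varepsilon_3),\ \frac12(\delta-\varepsilon_1-\varepsilon_2+\varepsilon_3),\ \varepsilon_2-\varepsilon_3,\ \varepsilon_1-\varepsilon_2$; - III: $\varepsilon_1-\varepsilon_2,\ \frac12(\delta-\varepsilon_1+\varepsilon_2-\varepsilon_3),\ \frac12(-\delta+\varepsilon_1+\varepsilon_2-\varepsilon_3),\ \varepsilon_3$; - IV: $\frac12(\delta+\varepsilon_1-\varepsilon_2-\varepsilon_3),\ \frac12(\delta-\varepsilon_1+\varepsilon_2+\varepsilon_3),\ \frac12(-\delta+\varepsilon_1-\varepsilon_2+\varepsilon_3),\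 \varepsilon_2-\varepsilon_3$; - V: $\delta,\ \frac12(-\delta+\varepsilon_1-\varepsilon_2-\varepsilon_3),\ \varepsilon_3,\ \varepsilon_2-\varepsilon_3$; - VI: $\delta,\ \frac12(-\delta-\varepsilon_1+\varepsilon_2+\varepsilon_3),\ \varepsilon_1-\varepsilon_2,\ \varepsilon_2-\varepsilon_3$. For a simple root system $\Xi$ and a node $i$ let $Z\in\mathfrak h$ be the element with $\alpha_i(Z)=1$ and $\alpha_j(Z)=0$ for $j\ne i$, let $\mathfrak g=\bigoplus_k\mathfrak g_k$ be the $\mathbb Z$-grading by the eigenvalues of $\operatorname{ad}Z$, and put $\mathfrak g^k=\bigoplus_{j\ge k}\mathfrak g_j$. The maximal parabolic subalgebra $\mathfrak p^\Xi_i$ is $\mathfrak g^0$. Let $G$ be the connected adjoint supergroup of $\mathfrak g$, $P=P^\Xi_i\subset G$ the parabolic subgroup of $\mathfrak p^\Xi_i$, and $\mathcal D=G\times_P(\mathfrak g^{-1}/\mathfrak p)$ the invariant distribution on the flag supermanifold $G/P$; its rank is $\dim\mathfrak g_{-1}$. A nondegenerate integral submanifold of $\mathcal D$ of dimension $(p|q)$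 is a morphism $\varphi:L\to G/P$ from a nonempty superdomain $L$ of dimension $(p|q)$ such that $\varphi^*$ annihilates $\operatorname{Ann}\mathcal D$ (integrality) and such that $\varphi$ is an immersion, i.e. the differential $T_zL\to T_{\varphi(z)}(G/P)$ is injective at every point $z$ of the body of $L$; equivalently $\varphi^*$ is surjective on germs of superfunctions (nondegeneracy). Dimensions are partially ordered by $(p|q)\le(p'|q')\iff p\le p',\ q\le q'$. The maximal elements of the set of dimensions of nondegenerate integral submanifolds of $\mathcal D$ are as follows. For $G(3)$: | $G/P$ | $\dim\mathfrak g_{-1}$ | maximal dimensions | |---|---|---| | $P^{I}_1$ | $(0\vert 7)$ | $(0\vert 3)$ | | $P^{I}_2,\ P^{II}_2$ | $(2\vert 2)$ | $(1\vert 1),\ (0\vert 2)$ | | $P^{I}_3,\ P^{II}_3,\ P^{III}_2$ | $(4\vert 3)$ | $(2\vert 1)$ | | $P^{II}_1,\ P^{III}_3,\ P^{IV}_3$ | $(2\vert 2)$ | $(1\vert 1)$ | | $P^{III}_1,\ P^{IV}_1$ | $(4\vert 4)$ | $(2\vert 2)$ | | $P^{IV}_2$ | $(2\vert 4)$ | $(1\vert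 2)$ | For $F(4)$: | $G/P$ | $\dim\mathfrak g_{-1}$ | maximal dimensions | |---|---|---| | $P^{I}_1$ | $(0\vert 8)$ | $(0\vert 4)$ | | $P^{V}_2$ | $(0\vert 8)$ | $(0\vert 4)$ | | $P^{I}_2,\ P^{II}_2$ | $(3\vert 3)$ | $(1\vert 1),\ (0\vert 3)$ | | $P^{I}_3,\ P^{II}_3,\ P^{III}_2$ | $(6\vert 4)$ | $(3\vert 2)$ | | $P^{I}_4,\ P^{II}_4,\ P^{III}_1,\ P^{IV}_1,\ P^{V}_1$ | $(6\vert 4)$ | $(6\vert 4)$ | | $P^{II}_1,\ P^{III}_4,\ P^{IV}_2,\ P^{VI}_1$ | $(4\vert 4)$ | $(1\vert 3),\ (2\vert 2)$ | | $P^{IV}_3,\ P^{V}_3,\ P^{VI}_3$ | $(4\vert 4)$ | $(2\vert 2)$ | | $P^{III}_3,\ P^{IV}_4,\ P^{V}_4,\ P^{VI}_4$ | $(6\vert 4)$ | $(3\vert 2)$ | | $P^{VI}_2$ | $(0\vert 6)$ | $(0\vert 3)$ | -/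

import Mathlib

open scoped TensorProduct Matrix

noncomputable section

set_option linter.unusedSimpArgs false

attribute [local instance 100] LieRing.ofAssociativeRing

/-! ## Lie superalgebras over `ℂ` -/

/-- A complex Lie superalgebra with even part `E` and odd part `O`: a Lie algebra `E`, a
representation of `E` on `O`, and a symmetric `E`-equivariant bracket `O × O → E` such that
`[[p, p], p] = 0` for odd `p` (over `ℂ` this is the super Jacobi identity on three odd elements). -/
structure LieSuperalgebra (E O : Type) [LieRing E] [LieAlgebra ℂ E]
    [AddCommGroup O] [Module ℂ O] where
  act : E →ₗ⁅ℂ⁆ Module.End ℂ O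
  odd : O →ₗ[ℂ] O →ₗ[ℂ] E
  odd_symm : ∀ p q, odd p q = odd q p
  odd_equivariant : ∀ x p q, ⁅x, odd p q⁆ = odd (act x p) q + odd p (act x q)
  odd_cubic : ∀ p, act (odd p p) p = 0

namespace LieSuperalgebra

section Gradings

variable {E O : Type} [LieRing E] [LieAlgebra ℂ E] [AddCommGroup O] [Module ℂ O]

/-- The super bracket on `𝔤 = E ⊕ O`. -/
def bracket (S : LieSuperalgebra E O) : E × O →ₗ[ℂ] E × O →ₗ[ℂ] E × O :=
  LinearMap.mk₂ ℂ
    (fun v w => (⁅v.1, w.1⁆ + S.odd v.2 w.2, S.act v.1 w.2 - S.act w.1 v.2))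
    (fun v v' w => by ext <;> simp <;> abel)
    (fun c v w => by ext <;> simp [smul_sub])
    (fun v w w' => by ext <;> simp <;> abel)
    (fun c v w => by ext <;> simp [smul_sub])

variable (E O) in
/-- The projection of `𝔤 = E ⊕ O` onto its even part. -/
def evenProj : E × O →ₗ[ℂ] E × O := LinearMap.inl ℂ E O ∘ₗ LinearMap.fst ℂ E O

variable (E O) in
/-- The projection of `𝔤 = E ⊕ O` onto its odd part. -/
def oddProj : E × O →ₗ[ℂ] E × O := LinearMap.inr ℂ E O ∘ₗ LinearMap.snd ℂ E O

/-- The superdimension `(dim W₀ | dim W₁)` of a graded subspace `W` of `𝔤`. -/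
def superDim (W : Submodule ℂ (E × O)) : ℕ × ℕ :=
  (Module.finrank ℂ ↥(W ⊓ LinearMap.range (evenProj E O)),
    Module.finrank ℂ ↥(W ⊓ LinearMap.range (oddProj E O)))

/-- The component `𝔤_k` of the `ℤ`-grading with grading element `Z`. -/
def gr (S : LieSuperalgebra E O) (Z : E) (k : ℤ) : Submodule ℂ (E × O) :=
  Module.End.eigenspace (S.bracket (Z, 0)) (k : ℂ)

/-- The filtration `𝔤^k = ⨁_{j ≥ k} 𝔤_j`. -/
def fil (S : LieSuperalgebra E O) (Z : E) (k : ℤ) : Submodule ℂ (E × O) :=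
  ⨆ j : ℤ, ⨆ _ : k ≤ j, S.gr Z j

/-- The parabolic subalgebra `𝔭 = 𝔤^0`. -/
def parabolic (S : LieSuperalgebra E O) (Z : E) : Submodule ℂ (E × O) := S.fil Z 0

end Gradings

/-! ## The supergroup `G`, the flag supermanifold `G/P` and its invariant distribution -/

/-- The Grassmann algebra `Λ_q` on `θ_1, …, θ_q`. Superfunctions on an open set `V ⊆ ℂ^{p|q}` are
the holomorphic maps from the underlying open subset of `ℂ^p` to `Λ_q`. -/
abbrev Grassmann (q : ℕ) : Type := ExteriorAlgebra ℂ (Fin q → ℂ)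

/-- The derivation `∂/∂θ_j` of `Λ_q`. -/
def thetaDeriv (q : ℕ) (j : Fin q) : Grassmann q →ₗ[ℂ] Grassmann q :=
  CliffordAlgebra.contractLeft (Q := (0 : QuadraticForm ℂ (Fin q → ℂ))) (LinearMap.proj j)

/-- The parity automorphism of `Λ_q`, `a ↦ (-1)^{|a|} a`. -/
def grassmannParity (q : ℕ) : Grassmann q →ₗ[ℂ] Grassmann q :=
  (CliffordAlgebra.involute (Q := (0 : QuadraticForm ℂ (Fin q → ℂ)))).toLinearMap

section Flag

variable {E O : Type} [LieRing E] [LieAlgebra ℂ E] [AddCommGroup O] [Module ℂ O]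

/-- The bracket of `Λ_q ⊗ 𝔤`: `[a ⊗ x, b ⊗ y] = (-1)^{|x||b|} ab ⊗ [x, y]`. -/
def grassmannBracket (S : LieSuperalgebra E O) (q : ℕ) :
    Grassmann q ⊗[ℂ] (E × O) →ₗ[ℂ] Grassmann q ⊗[ℂ] (E × O) →ₗ[ℂ] Grassmann q ⊗[ℂ] (E × O) :=
  TensorProduct.map₂ (LinearMap.mul ℂ (Grassmann q)) (S.bracket ∘ₗ evenProj E O) +
    TensorProduct.map₂ ((LinearMap.mul ℂ (Grassmann q)).compl₂ (grassmannParity q))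
      (S.bracket ∘ₗ oddProj E O)

variable (E O) in
/-- The parity operator of `Λ_q ⊗ 𝔤`. -/
def totalParity (q : ℕ) : Grassmann q ⊗[ℂ] (E × O) →ₗ[ℂ] Grassmann q ⊗[ℂ] (E × O) :=
  TensorProduct.map (grassmannParity q) (evenProj E O - oddProj E O)

/-- The group `G(Λ_q)` of `Λ_q`-points of the supergroup `G = Aut(𝔤)`: the parity preserving
`Λ_q`-linear automorphisms of the Lie superalgebra `Λ_q ⊗ 𝔤`. For `𝔤 = G(3)` and `𝔤 = F(4)` this
is the connected adjoint supergroup with Lie superalgebra `𝔤`. -/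
def points (S : LieSuperalgebra E O) (q : ℕ) :
    Subgroup ((Grassmann q ⊗[ℂ] (E × O)) ≃ₗ[Grassmann q] (Grassmann q ⊗[ℂ] (E × O))) where
  carrier := {T | (∀ v, T (totalParity E O q v) = totalParity E O q (T v)) ∧
    ∀ v w, T (S.grassmannBracket q v w) = S.grassmannBracket q (T v) (T w)}
  one_mem' := by simp
  mul_mem' {T U} hT hU := by
    refine ⟨fun v => ?_, fun v w => ?_⟩
    · simp only [LinearEquiv.mul_apply, hU.1, hT.1]
    · simp only [LinearEquiv.mul_apply, hU.2, hT.2]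
  inv_mem' {T} hT := by
    have h : ∀ v, T (T⁻¹ v) = v := fun v => T.apply_symm_apply v
    refine ⟨fun v => T.injective ?_, fun v w => T.injective ?_⟩
    · rw [hT.1, h, h]
    · rw [hT.2, h, h, h]

/-- The `Λ_q`-points of the parabolic subgroup `P ⊆ G`, the stabilizer of `𝔭`. -/
def IsParabolicPoint (S : LieSuperalgebra E O) (Z : E) {q : ℕ} (T : S.points q) : Prop :=
  ((S.parabolic Z).baseChange (Grassmann q)).map T.1.toLinearMap =
    (S.parabolic Z).baseChange (Grassmann q)

/-- A morphism from a nonempty superdomain `U^{p|q}` (an open subset of `ℂ^{p|q}`) to the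
homogeneous superspace `G/P`: a family of morphisms to `G` defined near the points of the domain
(a morphism from `V^{p|q}` to `G` is a holomorphic map `V → G(Λ_q)`), which agree modulo right
multiplication by `P` on overlaps. -/
structure FlagMap (S : LieSuperalgebra E O) (Z : E) (p q : ℕ) where
  domain : Set (Fin p → ℂ)
  isOpen_domain : IsOpen domain
  nonempty_domain : domain.Nonempty
  nhd : (Fin p → ℂ) → Set (Fin p → ℂ)
  isOpen_nhd : ∀ x ∈ domain, IsOpen (nhd x)
  mem_nhd : ∀ x ∈ domain, x ∈ nhd x
  nhd_subset : ∀ x ∈ domain, nhd x ⊆ domain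
  lift : (Fin p → ℂ) → (Fin p → ℂ) → S.points q
  holomorphic : ∀ x ∈ domain, ∀ (v : E × O) (l : Module.Dual ℂ (Grassmann q ⊗[ℂ] (E × O))),
    DifferentiableOn ℂ (fun z => l ((lift x z).1 (1 ⊗ₜ v))) (nhd x)
  compatible : ∀ x ∈ domain, ∀ x' ∈ domain, ∀ z ∈ nhd x ∩ nhd x',
    S.IsParabolicPoint Z ((lift x z)⁻¹ * lift x' z)

/-- `IsLogDeriv S g z a y`: the element `y` of `Λ_q ⊗ 𝔤` is the value at `z` of the left logarithmic
derivative `g⁻¹ ∂_a g` (the pullback of the left Maurer-Cartan form, evaluated on `∂_a`), where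
`∂_a` is the coordinate field `∂/∂x_i` for `a = inl i` and `∂/∂θ_j` for `a = inr j`. It is
expressed by `∂_a (g (1 ⊗ v)) = g [y, 1 ⊗ v]` for all `v ∈ 𝔤`. -/
def IsLogDeriv (S : LieSuperalgebra E O) {p q : ℕ} (g : (Fin p → ℂ) → S.points q)
    (z : Fin p → ℂ) (a : Fin p ⊕ Fin q) (y : Grassmann q ⊗[ℂ] (E × O)) : Prop :=
  match a with
  | Sum.inl i => ∀ (v : E × O) (l : Module.Dual ℂ (Grassmann q ⊗[ℂ] (E × O))),
      HasDerivAt (fun t : ℂ => l ((g (z + t • Pi.single i 1)).1 (1 ⊗ₜ v)))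
        (l ((g z).1 (S.grassmannBracket q y (1 ⊗ₜ v)))) 0
  | Sum.inr j => ∀ v : E × O,
      (thetaDeriv q j).rTensor (E × O) ((g z).1 (1 ⊗ₜ v)) =
        (g z).1 (S.grassmannBracket q y (1 ⊗ₜ v))

variable (E O) in
/-- The value of an element of `Λ_q ⊗ 𝔤` at `θ = 0`. -/
def bodyMap (q : ℕ) : Grassmann q ⊗[ℂ] (E × O) →ₗ[ℂ] E × O :=
  (TensorProduct.lid ℂ (E × O)).toLinearMap ∘ₗ
    (ExteriorAlgebra.algebraMapInv (R := ℂ) (M := Fin q → ℂ)).toLinearMap.rTensor (E × O)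

/-- `φ : U^{p|q} → G/P` is an integral manifold of the left invariant distribution
`𝒟 = G ×_P (𝔤^{-1}/𝔭)` on `G/P`, `T(G/P) = G ×_P (𝔤/𝔭)`: the pullback of the annihilator of `𝒟`
vanishes, that is, `g⁻¹ dg` takes values in `𝔤^{-1} = 𝔤_{-1} ⊕ 𝔭` for the local lifts `g`. -/
def FlagMap.IsIntegral {S : LieSuperalgebra E O} {Z : E} {p q : ℕ} (φ : S.FlagMap Z p q) : Prop :=
  ∀ x ∈ φ.domain, ∀ z ∈ φ.nhd x, ∀ a,
    ∃ y ∈ (S.fil Z (-1)).baseChange (Grassmann q), S.IsLogDeriv (φ.lift x) z a y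

/-- `φ : U^{p|q} → G/P` is nondegenerate: its differential `T_z U = ℂ^{p|q} → 𝔤/𝔭` is injective at
every point `z` of the underlying domain (equivalently, by the inverse function theorem, `φ^*` is
surjective on germs of superfunctions). -/
def FlagMap.IsNondegenerate {S : LieSuperalgebra E O} {Z : E} {p q : ℕ} (φ : S.FlagMap Z p q) :
    Prop :=
  ∀ x ∈ φ.domain, ∀ z ∈ φ.nhd x, ∃ y : Fin p ⊕ Fin q → Grassmann q ⊗[ℂ] (E × O),
    (∀ a, S.IsLogDeriv (φ.lift x) z a (y a)) ∧
      LinearIndependent ℂ fun a => (S.parabolic Z).mkQ (bodyMap E O q (y a))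

/-- The pairs `(p, q)` such that there is a nondegenerate integral submanifold of dimension
`(p|q)` of the left invariant distribution on `G/P`. -/
def integralDims (S : LieSuperalgebra E O) (Z : E) : Set (ℕ × ℕ) :=
  {d | ∃ φ : S.FlagMap Z d.1 d.2, φ.IsIntegral ∧ φ.IsNondegenerate}

/-- The maximal dimensions of nondegenerate integral submanifolds, for the partial order
`(p|q) ≤ (p'|q') ↔ p ≤ p' ∧ q ≤ q'`. -/
def maxIntegralDims (S : LieSuperalgebra E O) (Z : E) : Set (ℕ × ℕ) :=
  {d | Maximal (· ∈ S.integralDims Z) d}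

end Flag

/-! ## Lie superalgebras with odd part `ℂ² ⊗ V` -/

section Doublet

variable {V : Type} [AddCommGroup V] [Module ℂ V]

/-- The Lie algebra `𝔰𝔩(2)`. -/
abbrev SL2 := LieAlgebra.SpecialLinear.sl (Fin 2) ℂ

/-- The diagonal matrix `diag(d, -d)` in `𝔰𝔩(2)`. -/
def sl2Diag (d : ℂ) : SL2 :=
  ⟨!![d, 0; 0, -d], (LieAlgebra.SpecialLinear.sl _ _).mem_toSubmodule.mp (by
    simp [LieAlgebra.SpecialLinear.sl])⟩

/-- The action of `𝔰𝔩(2) ⊕ 𝔨` on `ℂ² ⊗ V = (Fin 2 → V)`, for a Lie algebra `𝔨` of endomorphisms of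
`V`. -/
def doubletAct (k : LieSubalgebra ℂ (Module.End ℂ V)) :
    SL2 × k →ₗ⁅ℂ⁆ Module.End ℂ (Fin 2 → V) where
  toFun x :=
    { toFun := fun Q a => ∑ b, (x.1 : Matrix (Fin 2) (Fin 2) ℂ) a b • Q b + (x.2 : Module.End ℂ V) (Q a)
      map_add' := fun Q R => by ext a; simp; abel
      map_smul' := fun c Q => by ext a; simp [smul_smul, mul_comm] }
  map_add' x y := by ext Q a; simp [add_smul]; abel
  map_smul' c x := by ext Q a; simp [smul_smul]
  map_lie' {x y} := by
    refine LinearMap.ext fun Q => funext fun a => ?_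
    simp [LieRing.of_associative_ring_bracket, Matrix.mul_apply, add_smul, sub_smul, smul_smul, LieAlgebra.Prod.bracket_apply]
    module


/-- The `𝔰𝔩(2)`-component of the bracket of two elements of `ℂ² ⊗ V`: with
`ω(u, v) = u₀ v₁ - u₁ v₀`, the bracket `[u ⊗ s, v ⊗ t]` has the component
`β(s, t) (ω(v, ·) u + ω(u, ·) v)`. -/
def doubletSL2 (β : V →ₗ[ℂ] V →ₗ[ℂ] ℂ) : (Fin 2 → V) →ₗ[ℂ] (Fin 2 → V) →ₗ[ℂ] SL2 :=
  LinearMap.mk₂ ℂ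
    (fun P Q => ⟨!![-(β (P 0) (Q 1) + β (Q 0) (P 1)), β (P 0) (Q 0) + β (Q 0) (P 0);
        -(β (P 1) (Q 1) + β (Q 1) (P 1)), β (P 0) (Q 1) + β (Q 0) (P 1)],
      (LieAlgebra.SpecialLinear.sl _ _).mem_toSubmodule.mp (by
        simp [LieAlgebra.SpecialLinear.sl])⟩)
    (fun P P' Q => Subtype.ext (by
      ext a b; fin_cases a <;> fin_cases b <;> simp <;> ring))
    (fun c P Q => Subtype.ext (by
      ext a b; fin_cases a <;> fin_cases b <;> simp <;> ring))
    (fun P Q Q' => Subtype.ext (by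
      ext a b; fin_cases a <;> fin_cases b <;> simp <;> ring))
    (fun c P Q => Subtype.ext (by
      ext a b; fin_cases a <;> fin_cases b <;> simp <;> ring))

/-- The `𝔨`-component of the bracket of two elements of `ℂ² ⊗ V`: `[u ⊗ s, v ⊗ t]` has the
component `ω(u, v) K(s, t)`. -/
def doubletK {k : LieSubalgebra ℂ (Module.End ℂ V)} (K : V →ₗ[ℂ] V →ₗ[ℂ] k) :
    (Fin 2 → V) →ₗ[ℂ] (Fin 2 → V) →ₗ[ℂ] k :=
  LinearMap.mk₂ ℂ (fun P Q => K (P 0) (Q 1) + K (Q 0) (P 1))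
    (fun P P' Q => by simp; abel) (fun c P Q => by simp)
    (fun P Q Q' => by simp; abel) (fun c P Q => by simp)

set_option maxHeartbeats 1000000 in
/-- The Lie superalgebra `(𝔰𝔩(2) ⊕ 𝔨) ⊕ (ℂ² ⊗ V)` of an orthogonal representation `V` of `𝔨` with an
equivariant skew map `K : V × V → 𝔨` such that `K(s, t) s = β(t, s) s - β(s, s) t`. -/
def ofOrthogonal (β : V →ₗ[ℂ] V →ₗ[ℂ] ℂ) (k : LieSubalgebra ℂ (Module.End ℂ V))
    (K : V →ₗ[ℂ] V →ₗ[ℂ] k)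
    (β_symm : ∀ s t, β s t = β t s)
    (β_inv : ∀ X ∈ k, ∀ s t, β (X s) t + β s (X t) = 0)
    (K_skew : ∀ s t, K s t = -K t s)
    (K_inv : ∀ (X : k) (s t : V), ⁅X, K s t⁆ = K (X.1 s) t + K s (X.1 t))
    (K_self : ∀ s t, (K s t).1 s = β t s • s - β s s • t) :
    LieSuperalgebra (SL2 × k) (Fin 2 → V) where
  act := doubletAct k
  odd := (doubletSL2 β).compr₂ (LinearMap.inl ℂ SL2 k) + (doubletK K).compr₂ (LinearMap.inr ℂ SL2 k)
  odd_symm P Q := by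
    refine Prod.ext (Subtype.ext ?_) ?_
    · ext a b
      fin_cases a <;> fin_cases b <;> simp [doubletSL2] <;> ring
    · simp [doubletK, add_comm]
  odd_equivariant x P Q := by
    obtain ⟨A, X⟩ := x
    have tr : (A : Matrix (Fin 2) (Fin 2) ℂ) 1 1 = - (A : Matrix (Fin 2) (Fin 2) ℂ) 0 0 := by
      have := A.2
      have h : Matrix.trace (A : Matrix (Fin 2) (Fin 2) ℂ) = 0 := this
      rw [Matrix.trace_fin_two] at h
      linear_combination h
    have h : ∀ s t, β ((X : Module.End ℂ V) s) t = - β s ((X : Module.End ℂ V) t) :=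
      fun s t => eq_neg_of_add_eq_zero_left (β_inv _ X.2 s t)
    have hs : ∀ i j, β (Q i) (P j) = β (P j) (Q i) := fun i j => β_symm _ _
    refine Prod.ext (Subtype.ext ?_) ?_
    · ext a b
      fin_cases a <;> fin_cases b <;> simp [hs, doubletSL2, doubletAct, Matrix.mul_apply, Matrix.vecMul, dotProduct, LieRing.of_associative_ring_bracket, tr, h] <;> ring
    · simp [doubletK, doubletAct, K_inv, tr, lie_add, LieAlgebra.Prod.bracket_apply]
      rw [K_skew (Q 0) (P 0), K_skew (Q 1) (P 1)]
      module
  odd_cubic P := by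
    have h1 : (K (P 0) (P 1)).1 (P 1) = β (P 1) (P 1) • P 0 - β (P 0) (P 1) • P 1 := by
      rw [K_skew]; simp [K_self]
    have h0 := K_self (P 0) (P 1)
    ext a
    fin_cases a <;> simp [doubletAct, doubletK, doubletSL2, h0, h1, β_symm (P 1) (P 0)] <;> module
end Doublet

end LieSuperalgebra

/-! ## The Lie superalgebra `G(3)` -/

namespace G3

/-- The imaginary split octonions `ℂ³ ⊕ ℂ³ ⊕ ℂ`, in the basis of weight vectors. -/
abbrev ImOct := (Fin 3 → ℂ) × (Fin 3 → ℂ) × ℂ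

/-- The invariant quadratic form of the imaginary octonions. -/
def form : ImOct →ₗ[ℂ] ImOct →ₗ[ℂ] ℂ :=
  LinearMap.mk₂ ℂ (fun s t => (1 / 2) * (s.1 ⬝ᵥ t.2.1 + s.2.1 ⬝ᵥ t.1) - s.2.2 * t.2.2)
    (fun s s' t => by simp; ring) (fun c s t => by simp; ring)
    (fun s t t' => by simp; ring) (fun c s t => by simp; ring)

/-- The cross product of the imaginary octonions; it satisfies
`s × (s × t) = β(s, t) s - β(s, s) t`. -/
def cross : ImOct →ₗ[ℂ] ImOct →ₗ[ℂ] ImOct :=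
  LinearMap.mk₂ ℂ
    (fun s t => (s.2.2 • t.1 - t.2.2 • s.1 + s.2.1 ⨯₃ t.2.1,
      t.2.2 • s.2.1 - s.2.2 • t.2.1 + s.1 ⨯₃ t.1,
      (1 / 2) * (s.2.1 ⬝ᵥ t.1 - s.1 ⬝ᵥ t.2.1)))
    (fun s s' t => by
      refine Prod.ext ?_ (Prod.ext ?_ ?_) <;> simp <;> first | module | ring)
    (fun c s t => by
      refine Prod.ext ?_ (Prod.ext ?_ ?_) <;> simp <;> first | module | ring)
    (fun s t t' => by
      refine Prod.ext ?_ (Prod.ext ?_ ?_) <;> simp <;> first | module | ring)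
    (fun c s t => by
      refine Prod.ext ?_ (Prod.ext ?_ ?_) <;> simp <;> first | module | ring)

theorem cross_cross (s t : ImOct) : cross s (cross s t) = form s t • s - form s s • t := by
  refine Prod.ext (funext fun i => ?_) (Prod.ext (funext fun i => ?_) ?_)
  · fin_cases i <;>
    · simp only [cross, form, LinearMap.mk₂_apply, cross_apply, dotProduct, Fin.sum_univ_three,
        Prod.fst_add, Prod.snd_add, Prod.fst_sub, Prod.snd_sub, Prod.smul_fst, Prod.smul_snd,
        Pi.add_apply, Pi.sub_apply, Pi.smul_apply, smul_eq_mul, Matrix.cons_val, Fin.zero_eta,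
        Fin.mk_one, Fin.reduceFinMk]
      ring
  · fin_cases i <;>
    · simp only [cross, form, LinearMap.mk₂_apply, cross_apply, dotProduct, Fin.sum_univ_three,
        Prod.fst_add, Prod.snd_add, Prod.fst_sub, Prod.snd_sub, Prod.smul_fst, Prod.smul_snd,
        Pi.add_apply, Pi.sub_apply, Pi.smul_apply, smul_eq_mul, Matrix.cons_val, Fin.zero_eta,
        Fin.mk_one, Fin.reduceFinMk]
      ring
  · simp only [cross, form, LinearMap.mk₂_apply, cross_apply, dotProduct, Fin.sum_univ_three,
      Prod.fst_add, Prod.snd_add, Prod.fst_sub, Prod.snd_sub, Prod.smul_fst, Prod.smul_snd,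
      Pi.add_apply, Pi.sub_apply, Pi.smul_apply, smul_eq_mul, Matrix.cons_val]
    ring

/-- The Lie algebra `G₂` of (skew) derivations of the cross product. -/
def g2 : LieSubalgebra ℂ (Module.End ℂ ImOct) where
  carrier := {X | (∀ s t, form (X s) t + form s (X t) = 0) ∧
    ∀ s t, X (cross s t) = cross (X s) t + cross s (X t)}
  zero_mem' := by simp
  add_mem' {X Y} hX hY := by
    refine ⟨fun s t => ?_, fun s t => ?_⟩
    · simp only [LinearMap.add_apply, map_add]
      linear_combination hX.1 s t + hY.1 s t
    · simp only [LinearMap.add_apply, map_add, hX.2, hY.2]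
      abel
  smul_mem' c X hX := by
    refine ⟨fun s t => ?_, fun s t => ?_⟩
    · simp only [LinearMap.smul_apply, map_smul, smul_eq_mul]
      linear_combination c * hX.1 s t
    · simp only [LinearMap.smul_apply, map_smul, hX.2, smul_add]
  lie_mem' {X Y} hX hY := by
    refine ⟨fun s t => ?_, fun s t => ?_⟩
    · simp only [LieRing.of_associative_ring_bracket, LinearMap.sub_apply, Module.End.mul_apply,
        map_sub]
      linear_combination hX.1 (Y s) t - hY.1 (X s) t + hX.1 s (Y t) - hY.1 s (X t)
    · simp only [LieRing.of_associative_ring_bracket, LinearMap.sub_apply, Module.End.mul_apply,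
        map_sub, hX.2, hY.2, map_add]
      abel

/-- The endomorphism `u ↦ (3 (β(t, u) s - β(s, u) t) - s × (t × u) + t × (s × u)) / 4`. -/
def derEnd : ImOct →ₗ[ℂ] ImOct →ₗ[ℂ] Module.End ℂ ImOct :=
  LinearMap.mk₂ ℂ
    (fun s t => (3 / 4 : ℂ) • ((form t).smulRight s - (form s).smulRight t) -
      (1 / 4 : ℂ) • (cross s ∘ₗ cross t - cross t ∘ₗ cross s))
    (fun s s' t => by refine LinearMap.ext fun u => ?_; simp; module)
    (fun c s t => by refine LinearMap.ext fun u => ?_; simp; module)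
    (fun s t t' => by refine LinearMap.ext fun u => ?_; simp; module)
    (fun c s t => by refine LinearMap.ext fun u => ?_; simp; module)

theorem derEnd_apply (s t u : ImOct) : derEnd s t u =
    (3 / 4 : ℂ) • (form t u • s - form s u • t) -
      (1 / 4 : ℂ) • (cross s (cross t u) - cross t (cross s u)) := by
  simp [derEnd]

theorem derEnd_form (s t u v : ImOct) :
    form (derEnd s t u) v + form u (derEnd s t v) = 0 := by
  simp only [derEnd_apply, cross, form, LinearMap.mk₂_apply, cross_apply, dotProduct,
    Fin.sum_univ_three, Prod.fst_add, Prod.snd_add, Prod.fst_sub, Prod.snd_sub, Prod.smul_fst,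
    Prod.smul_snd, Pi.add_apply, Pi.sub_apply, Pi.smul_apply, smul_eq_mul, Matrix.cons_val]
  ring

set_option maxHeartbeats 4000000 in
theorem derEnd_cross (s t u v : ImOct) :
    derEnd s t (cross u v) = cross (derEnd s t u) v + cross u (derEnd s t v) := by
  refine Prod.ext (funext fun i => ?_) (Prod.ext (funext fun i => ?_) ?_)
  · fin_cases i <;>
    · simp only [derEnd_apply, cross, form, LinearMap.mk₂_apply, cross_apply, dotProduct,
        Fin.sum_univ_three, Prod.fst_add, Prod.snd_add, Prod.fst_sub, Prod.snd_sub, Prod.smul_fst,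
        Prod.smul_snd, Pi.add_apply, Pi.sub_apply, Pi.smul_apply, smul_eq_mul, Matrix.cons_val,
        Fin.zero_eta, Fin.mk_one, Fin.reduceFinMk]
      ring
  · fin_cases i <;>
    · simp only [derEnd_apply, cross, form, LinearMap.mk₂_apply, cross_apply, dotProduct,
        Fin.sum_univ_three, Prod.fst_add, Prod.snd_add, Prod.fst_sub, Prod.snd_sub, Prod.smul_fst,
        Prod.smul_snd, Pi.add_apply, Pi.sub_apply, Pi.smul_apply, smul_eq_mul, Matrix.cons_val,
        Fin.zero_eta, Fin.mk_one, Fin.reduceFinMk]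
      ring
  · simp only [derEnd_apply, cross, form, LinearMap.mk₂_apply, cross_apply, dotProduct,
      Fin.sum_univ_three, Prod.fst_add, Prod.snd_add, Prod.fst_sub, Prod.snd_sub, Prod.smul_fst,
      Prod.smul_snd, Pi.add_apply, Pi.sub_apply, Pi.smul_apply, smul_eq_mul, Matrix.cons_val]
    ring

/-- The map `derEnd` with values in `G₂`. -/
def der : ImOct →ₗ[ℂ] ImOct →ₗ[ℂ] g2 :=
  LinearMap.mk₂ ℂ (fun s t => ⟨derEnd s t, derEnd_form s t, derEnd_cross s t⟩)
    (fun s s' t => Subtype.ext (by simp)) (fun c s t => Subtype.ext (by simp))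
    (fun s t t' => Subtype.ext (by simp)) (fun c s t => Subtype.ext (by simp))

/-- The Lie superalgebra `G(3) = (𝔰𝔩(2) ⊕ G₂) ⊕ (ℂ² ⊗ ℂ⁷)`. -/
def superalgebra : LieSuperalgebra (LieSuperalgebra.SL2 × g2) (Fin 2 → ImOct) :=
  LieSuperalgebra.ofOrthogonal form g2 der
    (fun s t => by simp [form, dotProduct, Fin.sum_univ_three]; ring)
    (fun X hX => hX.1)
    (fun s t => Subtype.ext (by refine LinearMap.ext fun u => ?_; simp [der, derEnd_apply]; module))
    (fun X s t => Subtype.ext (by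
      have h1 : ∀ s t, form (X.1 s) t = - form s (X.1 t) := fun s t =>
        eq_neg_of_add_eq_zero_left (X.2.1 s t)
      have h2 := X.2.2
      refine LinearMap.ext fun u => ?_
      simp only [der, LieSubalgebra.coe_bracket, LieRing.of_associative_ring_bracket,
        LinearMap.sub_apply, Module.End.mul_apply, LinearMap.mk₂_apply, derEnd_apply,
        AddMemClass.coe_add, LinearMap.add_apply, map_sub, map_smul, map_add, h1, h2]
      module))
    (fun s t => by
      have h : form t s = form s t := by simp [form, dotProduct, Fin.sum_univ_three]; ring
      have h2 : cross t s = - cross s t := by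
        refine Prod.ext (funext fun i => ?_) (Prod.ext (funext fun i => ?_) ?_)
        · fin_cases i <;> simp [cross, cross_apply, dotProduct, Fin.sum_univ_three] <;> ring
        · fin_cases i <;> simp [cross, cross_apply, dotProduct, Fin.sum_univ_three] <;> ring
        · simp [cross, cross_apply, dotProduct, Fin.sum_univ_three]; ring
      have h3 : cross s s = 0 := by
        refine Prod.ext (funext fun i => ?_) (Prod.ext (funext fun i => ?_) ?_)
        · fin_cases i <;> simp [cross, cross_apply, dotProduct, Fin.sum_univ_three] <;> ring
        · fin_cases i <;> simp [cross, cross_apply, dotProduct, Fin.sum_univ_three] <;> ring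
        · simp [cross, cross_apply, dotProduct, Fin.sum_univ_three]; ring
      simp only [der, LinearMap.mk₂_apply, derEnd_apply, h2, h3, map_neg, map_zero, cross_cross, h]
      module)

/-- The element of the Cartan subalgebra `𝔥` on which `δ, ε₁, ε₂, ε₃` take the values `x 0`, `x 1`,
`x 2` and `-(x 1 + x 2)`. The weights of `ℂ²` are `±δ`; those of `ℂ⁷` are `ε_i`, `-ε_i`, `0`. -/
def cartan (x : Fin 3 → ℂ) : LieSuperalgebra.SL2 × g2 :=
  (LieSuperalgebra.sl2Diag (x 0),
    ⟨{ toFun := fun s => (![x 1, x 2, -(x 1 + x 2)] * s.1, -(![x 1, x 2, -(x 1 + x 2)] * s.2.1), 0)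
       map_add' := fun s t => by ext <;> simp <;> ring
       map_smul' := fun c s => by ext <;> simp <;> ring }, by
      refine ⟨fun s t => ?_, fun s t => ?_⟩
      · simp [form, dotProduct, Fin.sum_univ_three]; ring
      · refine Prod.ext (funext fun i => ?_) (Prod.ext (funext fun i => ?_) ?_)
        · fin_cases i <;>
          · simp only [LinearMap.coe_mk, AddHom.coe_mk, cross, LinearMap.mk₂_apply, cross_apply,
              Prod.fst_add, Prod.snd_add, Prod.fst_sub, Prod.snd_sub, Prod.smul_fst, Prod.smul_snd,
              Pi.add_apply, Pi.sub_apply, Pi.smul_apply, Pi.neg_apply, Pi.mul_apply, smul_eq_mul,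
              Matrix.cons_val, Fin.zero_eta, Fin.mk_one, Fin.reduceFinMk]
            ring
        · fin_cases i <;>
          · simp only [LinearMap.coe_mk, AddHom.coe_mk, cross, LinearMap.mk₂_apply, cross_apply,
              Prod.fst_add, Prod.snd_add, Prod.fst_sub, Prod.snd_sub, Prod.smul_fst, Prod.smul_snd,
              Pi.add_apply, Pi.sub_apply, Pi.smul_apply, Pi.neg_apply, Pi.mul_apply, smul_eq_mul,
              Matrix.cons_val, Fin.zero_eta, Fin.mk_one, Fin.reduceFinMk]
            ring
        · simp [cross, dotProduct, Fin.sum_univ_three]; ring⟩)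

/-- The four Dynkin diagrams of `G(3)`. -/
inductive Diagram
  | I | II | III | IV

/-- The values of the simple roots `α₁, α₂, α₃` of each Dynkin diagram at the Cartan element where
`δ, ε₁, ε₂` take the values `x 0`, `x 1`, `x 2`. -/
def simpleRoot (Ξ : Diagram) (x : Fin 3 → ℂ) : Fin 3 → ℂ :=
  let δ := x 0
  let ε₁ := x 1
  let ε₂ := x 2
  match Ξ with
  | .I => ![δ - ε₁ - ε₂, ε₁, ε₂ - ε₁]
  | .II => ![ε₁ + ε₂ - δ, δ - ε₂, ε₂ - ε₁]
  | .III => ![ε₂ - δ, δ - ε₁, ε₁]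
  | .IV => ![ε₂ - ε₁, ε₁ - δ, δ]

/-- `x` are the coordinates of the grading element of the maximal parabolic subalgebra with the
node `i` crossed: the simple root of that node has degree `1`, the other ones have degree `0`.
The nodes `1, 2, 3` correspond to `i = 0, 1, 2`. -/
def IsGrading (Ξ : Diagram) (i : Fin 3) (x : Fin 3 → ℂ) : Prop :=
  simpleRoot Ξ x = Pi.single i 1

/-- The grading elements exist and are unique. -/
theorem existsUnique_isGrading (Ξ : Diagram) (i : Fin 3) : ∃! x, IsGrading Ξ i x := by
  have key : ∀ (x y : Fin 3 → ℂ), simpleRoot Ξ x = y ↔ x = match Ξ with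
      | .I => ![y 0 + 2 * y 1 + y 2, y 1, y 1 + y 2]
      | .II => ![y 0 + 2 * y 1 + y 2, y 0 + y 1, y 0 + y 1 + y 2]
      | .III => ![y 1 + y 2, y 2, y 0 + y 1 + y 2]
      | .IV => ![y 2, y 1 + y 2, y 0 + y 1 + y 2] := by
    intro x y
    cases Ξ <;> simp only [simpleRoot, funext_iff, Fin.forall_fin_succ, Fin.isEmpty.forall_iff,
      Matrix.cons_val, Fin.succ_zero_eq_one, Fin.succ_one_eq_two, and_true] <;>
    · refine ⟨?_, ?_⟩ <;> rintro ⟨h0, h1, h2⟩ <;> refine ⟨?_, ?_, ?_⟩ <;> grind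
  exact ⟨_, (key _ _).2 rfl, fun x hx => (key _ _).1 hx⟩

/-- The dimension of `𝔤_{-1}` for the maximal parabolic with the node `i` crossed. -/
def dimTable : Diagram → Fin 3 → ℕ × ℕ
  | .I => ![(0, 7), (2, 2), (4, 3)]
  | .II => ![(2, 2), (2, 2), (4, 3)]
  | .III => ![(4, 4), (4, 3), (2, 2)]
  | .IV => ![(4, 4), (2, 4), (2, 2)]

/-- The maximal dimensions of nondegenerate integral submanifolds for the maximal parabolic with
the node `i` crossed. -/
def maxDimTable : Diagram → Fin 3 → Set (ℕ × ℕ)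
  | .I => ![{(0, 3)}, {(1, 1), (0, 2)}, {(2, 1)}]
  | .II => ![{(1, 1)}, {(1, 1), (0, 2)}, {(2, 1)}]
  | .III => ![{(2, 2)}, {(2, 1)}, {(1, 1)}]
  | .IV => ![{(2, 2)}, {(1, 2)}, {(1, 1)}]

end G3

/-! ## The Lie superalgebra `F(4)` -/

namespace F4

/-- The spinor representation `ℂ⁸ = ℂ⁴ ⊕ ℂ⁴` of `𝔰𝔬(7)`, in a basis of weight vectors. -/
abbrev Spinor := (Fin 4 → ℂ) × (Fin 4 → ℂ)

/-- The invariant quadratic form on spinors. -/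
def form : Spinor →ₗ[ℂ] Spinor →ₗ[ℂ] ℂ :=
  LinearMap.mk₂ ℂ (fun s t => s.1 ⬝ᵥ t.2 + s.2 ⬝ᵥ t.1)
    (fun s s' t => by simp; ring) (fun c s t => by simp; ring)
    (fun s t t' => by simp; ring) (fun c s t => by simp; ring)

/-- The standard symplectic form on `ℂ⁴ ⊕ ℂ⁴`. -/
def symp (s t : Spinor) : ℂ := s.1 ⬝ᵥ t.2 - s.2 ⬝ᵥ t.1

/-- The vector `a × b × c` of `ℂ⁴` with `(a × b × c) ⬝ d = det(a, b, c, d)`. -/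
def cross₃ (a b c : Fin 4 → ℂ) : Fin 4 → ℂ :=
  fun k => Matrix.det (Matrix.of ![a, b, c, Pi.single k 1])

theorem cross₃_eq (a b c : Fin 4 → ℂ) : cross₃ a b c =
    ![-(a 1 * (b 2 * c 3 - b 3 * c 2) - a 2 * (b 1 * c 3 - b 3 * c 1) +
        a 3 * (b 1 * c 2 - b 2 * c 1)),
      a 0 * (b 2 * c 3 - b 3 * c 2) - a 2 * (b 0 * c 3 - b 3 * c 0) + a 3 * (b 0 * c 2 - b 2 * c 0),
      -(a 0 * (b 1 * c 3 - b 3 * c 1) - a 1 * (b 0 * c 3 - b 3 * c 0) +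
        a 3 * (b 0 * c 1 - b 1 * c 0)),
      a 0 * (b 1 * c 2 - b 2 * c 1) - a 1 * (b 0 * c 2 - b 2 * c 0) +
        a 2 * (b 0 * c 1 - b 1 * c 0)] := by
  ext k
  fin_cases k <;>
    simp [cross₃, Matrix.det_succ_row_zero, Fin.sum_univ_succ, Fin.succAbove] <;> ring

/-- The triple cross product of `ℂ⁸`: the alternating trilinear map dual, by means of `form`, to the
Cayley `4`-form `½ ω ∧ ω + 2 (e¹²³⁴ + f¹²³⁴)`, where `ω = ∑ eⁱ ∧ fⁱ` is the form `symp` and `eⁱ`, `fⁱ`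
are the coordinates of `ℂ⁴ ⊕ ℂ⁴`. -/
def tripleFun (s t u : Spinor) : Spinor :=
  symp s t • (u.1, -u.2) - symp s u • (t.1, -t.2) + symp t u • (s.1, -s.2) +
    (2 : ℂ) • (cross₃ s.2 t.2 u.2, cross₃ s.1 t.1 u.1)

/-- Two spinors with the same coordinates are equal. -/
theorem spinor_ext {s t : Spinor} (h1 : s.1 0 = t.1 0) (h2 : s.1 1 = t.1 1) (h3 : s.1 2 = t.1 2)
    (h4 : s.1 3 = t.1 3) (h5 : s.2 0 = t.2 0) (h6 : s.2 1 = t.2 1) (h7 : s.2 2 = t.2 2)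
    (h8 : s.2 3 = t.2 3) : s = t := by
  refine Prod.ext (funext fun i => ?_) (funext fun i => ?_) <;> fin_cases i <;> assumption

theorem tripleFun_add_left (s s' t u : Spinor) :
    tripleFun (s + s') t u = tripleFun s t u + tripleFun s' t u := by
  apply spinor_ext <;>
  · simp only [tripleFun, symp, cross₃_eq, dotProduct, Fin.sum_univ_four,
      Prod.fst_add, Prod.snd_add, Prod.fst_sub, Prod.snd_sub, Prod.smul_fst, Prod.smul_snd,
      Pi.add_apply, Pi.sub_apply, Pi.smul_apply, Pi.neg_apply, smul_eq_mul, Matrix.cons_val]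
    ring

theorem tripleFun_smul_left (c : ℂ) (s t u : Spinor) :
    tripleFun (c • s) t u = c • tripleFun s t u := by
  apply spinor_ext <;>
  · simp only [tripleFun, symp, cross₃_eq, dotProduct, Fin.sum_univ_four,
      Prod.fst_add, Prod.snd_add, Prod.fst_sub, Prod.snd_sub, Prod.smul_fst, Prod.smul_snd,
      Pi.add_apply, Pi.sub_apply, Pi.smul_apply, Pi.neg_apply, smul_eq_mul, Matrix.cons_val]
    ring

theorem tripleFun_swap (s t u : Spinor) :
    tripleFun s t u = (-1 : ℂ) • tripleFun t s u := by
  apply spinor_ext <;>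
  · simp only [tripleFun, symp, cross₃_eq, dotProduct, Fin.sum_univ_four,
      Prod.fst_add, Prod.snd_add, Prod.fst_sub, Prod.snd_sub, Prod.smul_fst, Prod.smul_snd,
      Pi.add_apply, Pi.sub_apply, Pi.smul_apply, Pi.neg_apply, smul_eq_mul, Matrix.cons_val]
    ring

theorem tripleFun_rotate (s t u : Spinor) :
    tripleFun s t u = tripleFun u s t := by
  apply spinor_ext <;>
  · simp only [tripleFun, symp, cross₃_eq, dotProduct, Fin.sum_univ_four,
      Prod.fst_add, Prod.snd_add, Prod.fst_sub, Prod.snd_sub, Prod.smul_fst, Prod.smul_snd,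
      Pi.add_apply, Pi.sub_apply, Pi.smul_apply, Pi.neg_apply, smul_eq_mul, Matrix.cons_val]
    ring

/-- The triple cross product as a trilinear map. -/
def triple : Spinor →ₗ[ℂ] Spinor →ₗ[ℂ] Module.End ℂ Spinor :=
  LinearMap.mk₂ ℂ
    (fun s t =>
      { toFun := fun u => tripleFun s t u
        map_add' := fun u u' => by simp only [tripleFun_rotate s t, tripleFun_add_left]
        map_smul' := fun c u => by
          simp only [tripleFun_rotate s t, tripleFun_smul_left, RingHom.id_apply] })
    (fun s s' t => LinearMap.ext fun u => tripleFun_add_left s s' t u)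
    (fun c s t => LinearMap.ext fun u => tripleFun_smul_left c s t u)
    (fun s t t' => LinearMap.ext fun u => by
      change tripleFun s (t + t') u = tripleFun s t u + tripleFun s t' u
      simp only [tripleFun_swap s, tripleFun_add_left, smul_add])
    (fun c s t => LinearMap.ext fun u => by
      change tripleFun s (c • t) u = c • tripleFun s t u
      rw [tripleFun_swap s, tripleFun_smul_left, smul_comm, ← tripleFun_swap s])

theorem triple_apply (s t u : Spinor) : triple s t u = tripleFun s t u := rfl

/-- The Lie algebra `𝔰𝔭𝔦𝔫(7) ≅ 𝔰𝔬(7)` of skew derivations of the triple cross product (that is, the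
stabilizer of the Cayley form in `𝔰𝔬(8)`). -/
def spin7 : LieSubalgebra ℂ (Module.End ℂ Spinor) where
  carrier := {X | (∀ s t, form (X s) t + form s (X t) = 0) ∧
    ∀ s t u, X (triple s t u) = triple (X s) t u + triple s (X t) u + triple s t (X u)}
  zero_mem' := by simp
  add_mem' {X Y} hX hY := by
    refine ⟨fun s t => ?_, fun s t u => ?_⟩
    · simp only [LinearMap.add_apply, map_add]
      linear_combination hX.1 s t + hY.1 s t
    · simp only [LinearMap.add_apply, map_add, hX.2, hY.2]
      abel
  smul_mem' c X hX := by
    refine ⟨fun s t => ?_, fun s t u => ?_⟩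
    · simp only [LinearMap.smul_apply, map_smul, smul_eq_mul]
      linear_combination c * hX.1 s t
    · simp only [LinearMap.smul_apply, map_smul, hX.2, smul_add]
  lie_mem' {X Y} hX hY := by
    refine ⟨fun s t => ?_, fun s t u => ?_⟩
    · simp only [LieRing.of_associative_ring_bracket, LinearMap.sub_apply, Module.End.mul_apply,
        map_sub]
      linear_combination hX.1 (Y s) t - hY.1 (X s) t + hX.1 s (Y t) - hY.1 s (X t)
    · simp only [LieRing.of_associative_ring_bracket, LinearMap.sub_apply, Module.End.mul_apply,
        map_sub, hX.2, hY.2, map_add, LinearMap.add_apply]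
      abel

/-- The endomorphism `u ↦ β(t, u) s - β(s, u) t - ⅓ s × t × u`. -/
def derEnd : Spinor →ₗ[ℂ] Spinor →ₗ[ℂ] Module.End ℂ Spinor :=
  LinearMap.mk₂ ℂ
    (fun s t => (form t).smulRight s - (form s).smulRight t - (1 / 3 : ℂ) • triple s t)
    (fun s s' t => by refine LinearMap.ext fun u => ?_; simp; module)
    (fun c s t => by refine LinearMap.ext fun u => ?_; simp; module)
    (fun s t t' => by refine LinearMap.ext fun u => ?_; simp; module)
    (fun c s t => by refine LinearMap.ext fun u => ?_; simp; module)

theorem derEnd_apply (s t u : Spinor) :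
    derEnd s t u = form t u • s - form s u • t - (1 / 3 : ℂ) • triple s t u := by
  simp [derEnd]

/-- The action of `𝔰𝔬(7) = 𝔰𝔩(4) ⊕ Λ²ℂ⁴` on spinors, with coordinates `A`, `p`. -/
def spinAct (A : Fin 4 → Fin 4 → ℂ) (p : Fin 6 → ℂ) (u : Spinor) : Spinor :=
  (![A 0 0 * u.1 0 + A 0 1 * u.1 1 + A 0 2 * u.1 2 + A 0 3 * u.1 3 + p 0 * u.2 1 + p 1 *
        u.2 2 + p 2 * u.2 3,
      A 1 0 * u.1 0 + A 1 1 * u.1 1 + A 1 2 * u.1 2 + A 1 3 * u.1 3 - p 0 * u.2 0 + p 3 *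
        u.2 2 + p 4 * u.2 3,
      A 2 0 * u.1 0 + A 2 1 * u.1 1 + A 2 2 * u.1 2 + A 2 3 * u.1 3 - p 1 * u.2 0 - p 3 *
        u.2 1 + p 5 * u.2 3,
      A 3 0 * u.1 0 + A 3 1 * u.1 1 + A 3 2 * u.1 2 + (-(A 0 0 + A 1 1 + A 2 2)) * u.1 3 -
        p 2 * u.2 0 - p 4 * u.2 1 - p 5 * u.2 2],
    ![-A 0 0 * u.2 0 - A 1 0 * u.2 1 - A 2 0 * u.2 2 - A 3 0 * u.2 3 + p 5 * u.1 1 - p 4 *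
        u.1 2 + p 3 * u.1 3,
      -A 0 1 * u.2 0 - A 1 1 * u.2 1 - A 2 1 * u.2 2 - A 3 1 * u.2 3 - p 5 * u.1 0 + p 2 *
        u.1 2 - p 1 * u.1 3,
      -A 0 2 * u.2 0 - A 1 2 * u.2 1 - A 2 2 * u.2 2 - A 3 2 * u.2 3 + p 4 * u.1 0 - p 2 *
        u.1 1 + p 0 * u.1 3,
      -A 0 3 * u.2 0 - A 1 3 * u.2 1 - A 2 3 * u.2 2 - (-(A 0 0 + A 1 1 + A 2 2)) * u.2 3 -
        p 3 * u.1 0 + p 1 * u.1 1 - p 0 * u.1 2])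

theorem spinAct_form (A : Fin 4 → Fin 4 → ℂ) (p : Fin 6 → ℂ) (u v : Spinor) :
    form (spinAct A p u) v + form u (spinAct A p v) = 0 := by
  simp only [spinAct, form, cross₃_eq, LinearMap.mk₂_apply,
    dotProduct, Fin.sum_univ_four, Prod.fst_add, Prod.snd_add, Prod.fst_sub, Prod.snd_sub,
    Prod.smul_fst, Prod.smul_snd, Pi.add_apply, Pi.sub_apply, Pi.smul_apply, Pi.neg_apply,
    smul_eq_mul, Matrix.cons_val]
  ring

set_option maxHeartbeats 4000000 in
theorem spinAct_triple (A : Fin 4 → Fin 4 → ℂ) (p : Fin 6 → ℂ) (u v w : Spinor) :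
    spinAct A p (triple u v w) = triple (spinAct A p u) v w + triple u (spinAct A p v) w +
      triple u v (spinAct A p w) := by
  apply spinor_ext <;>
  · simp only [spinAct, triple_apply, tripleFun, symp, cross₃_eq, LinearMap.mk₂_apply,
      dotProduct, Fin.sum_univ_four, Prod.fst_add, Prod.snd_add, Prod.fst_sub, Prod.snd_sub,
      Prod.smul_fst, Prod.smul_snd, Pi.add_apply, Pi.sub_apply, Pi.smul_apply, Pi.neg_apply,
      smul_eq_mul, Matrix.cons_val]
    ring

theorem derEnd_eq (s t u : Spinor) : derEnd s t u =
    spinAct (fun i j => (4 / 3) * (s.1 i * t.2 j - t.1 i * s.2 j) -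
        if i = j then (1 / 3) * (s.1 ⬝ᵥ t.2 - s.2 ⬝ᵥ t.1) else 0)
      ![(2 / 3) * ((s.1 0 * t.1 1 - s.1 1 * t.1 0) + (s.2 2 * t.2 3 - s.2 3 * t.2 2)),
        (2 / 3) * ((s.1 0 * t.1 2 - s.1 2 * t.1 0) - (s.2 1 * t.2 3 - s.2 3 * t.2 1)),
        (2 / 3) * ((s.1 0 * t.1 3 - s.1 3 * t.1 0) + (s.2 1 * t.2 2 - s.2 2 * t.2 1)),
        (2 / 3) * ((s.1 1 * t.1 2 - s.1 2 * t.1 1) + (s.2 0 * t.2 3 - s.2 3 * t.2 0)),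
        (2 / 3) * ((s.1 1 * t.1 3 - s.1 3 * t.1 1) - (s.2 0 * t.2 2 - s.2 2 * t.2 0)),
        (2 / 3) * ((s.1 2 * t.1 3 - s.1 3 * t.1 2) + (s.2 0 * t.2 1 - s.2 1 * t.2 0))] u := by
  apply spinor_ext <;>
  · simp only [derEnd_apply, spinAct, triple_apply, tripleFun, symp, form, Fin.reduceEq, if_true,
      if_false, cross₃_eq, LinearMap.mk₂_apply,
      dotProduct, Fin.sum_univ_four, Prod.fst_add, Prod.snd_add, Prod.fst_sub, Prod.snd_sub,
      Prod.smul_fst, Prod.smul_snd, Pi.add_apply, Pi.sub_apply, Pi.smul_apply, Pi.neg_apply,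
      smul_eq_mul, Matrix.cons_val]
    ring

theorem derEnd_form (s t u v : Spinor) :
    form (derEnd s t u) v + form u (derEnd s t v) = 0 := by
  rw [derEnd_eq, derEnd_eq]
  exact spinAct_form _ _ u v

theorem derEnd_triple (s t u v w : Spinor) :
    derEnd s t (triple u v w) =
      triple (derEnd s t u) v w + triple u (derEnd s t v) w + triple u v (derEnd s t w) := by
  simp only [derEnd_eq s t]
  exact spinAct_triple _ _ u v w

/-- The map `derEnd` with values in `𝔰𝔭𝔦𝔫(7)`. -/
def der : Spinor →ₗ[ℂ] Spinor →ₗ[ℂ] spin7 :=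
  LinearMap.mk₂ ℂ (fun s t => ⟨derEnd s t, derEnd_form s t, derEnd_triple s t⟩)
    (fun s s' t => Subtype.ext (by simp)) (fun c s t => Subtype.ext (by simp))
    (fun s t t' => Subtype.ext (by simp)) (fun c s t => Subtype.ext (by simp))

theorem triple_swap (s t u : Spinor) : triple s t u = -triple t s u := by
  apply spinor_ext <;>
  · simp only [triple_apply, tripleFun, symp, cross₃_eq, dotProduct, Fin.sum_univ_four,
      Prod.fst_add, Prod.snd_add, Prod.fst_sub, Prod.snd_sub, Prod.smul_fst, Prod.smul_snd,
      Prod.fst_neg, Prod.snd_neg, Pi.add_apply, Pi.sub_apply, Pi.smul_apply, Pi.neg_apply,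
      smul_eq_mul, Matrix.cons_val]
    ring

theorem triple_self (s t : Spinor) : triple s t s = 0 := by
  apply spinor_ext <;>
  · simp only [triple_apply, tripleFun, symp, cross₃_eq, dotProduct, Fin.sum_univ_four,
      Prod.fst_add, Prod.snd_add, Prod.fst_sub, Prod.snd_sub, Prod.smul_fst, Prod.smul_snd,
      Prod.fst_zero, Prod.snd_zero, Pi.add_apply, Pi.sub_apply, Pi.smul_apply, Pi.neg_apply,
      Pi.zero_apply, smul_eq_mul, Matrix.cons_val]
    ring

/-- The Lie superalgebra `F(4) = (𝔰𝔩(2) ⊕ 𝔰𝔭𝔦𝔫(7)) ⊕ (ℂ² ⊗ ℂ⁸)`. -/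
def superalgebra : LieSuperalgebra (LieSuperalgebra.SL2 × spin7) (Fin 2 → Spinor) :=
  LieSuperalgebra.ofOrthogonal form spin7 der
    (fun s t => by simp [form, dotProduct, Fin.sum_univ_four]; ring)
    (fun X hX => hX.1)
    (fun s t => Subtype.ext (LinearMap.ext fun u => by
      simp only [der, LinearMap.mk₂_apply, derEnd_apply, triple_swap s t, NegMemClass.coe_neg,
        LinearMap.neg_apply]
      module))
    (fun X s t => Subtype.ext (by
      have h1 : ∀ s t, form (X.1 s) t = - form s (X.1 t) := fun s t =>
        eq_neg_of_add_eq_zero_left (X.2.1 s t)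
      have h2 := X.2.2
      refine LinearMap.ext fun u => ?_
      simp only [der, LieSubalgebra.coe_bracket, LieRing.of_associative_ring_bracket,
        LinearMap.sub_apply, Module.End.mul_apply, LinearMap.mk₂_apply, derEnd_apply,
        AddMemClass.coe_add, LinearMap.add_apply, map_sub, map_smul, map_add, h1, h2]
      module))
    (fun s t => by
      simp [der, derEnd_apply, triple_self])

/-- The element of the Cartan subalgebra `𝔥` on which `δ, ε₁, ε₂, ε₃` take the values `x 0`, `x 1`,
`x 2`, `x 3`. The weights of `ℂ²` are `±δ/2`; those of the spinor representation are
`(±ε₁ ± ε₂ ± ε₃)/2`. -/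
def cartan (x : Fin 4 → ℂ) : LieSuperalgebra.SL2 × spin7 :=
  let c : Fin 4 → ℂ := ![(x 1 + x 2 + x 3) / 2, (x 1 - x 2 - x 3) / 2,
    (-x 1 + x 2 - x 3) / 2, (-x 1 - x 2 + x 3) / 2]
  (LieSuperalgebra.sl2Diag (x 0 / 2),
    ⟨{ toFun := fun s => (c * s.1, -(c * s.2))
       map_add' := fun s t => by ext <;> simp <;> ring
       map_smul' := fun c s => by ext <;> simp <;> ring }, by
      refine ⟨fun s t => ?_, fun s t u => ?_⟩
      · simp [form, dotProduct, Fin.sum_univ_four]; ring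
      · apply spinor_ext <;>
        · simp only [c, LinearMap.coe_mk, AddHom.coe_mk, triple_apply, tripleFun, symp, cross₃_eq,
            dotProduct, Fin.sum_univ_four, Prod.fst_add, Prod.snd_add, Prod.fst_sub, Prod.snd_sub,
            Prod.smul_fst, Prod.smul_snd, Pi.add_apply, Pi.sub_apply, Pi.smul_apply, Pi.neg_apply,
            Pi.mul_apply, smul_eq_mul, Matrix.cons_val]
          ring⟩)

/-- The six Dynkin diagrams of `F(4)`. -/
inductive Diagram
  | I | II | III | IV | V | VI

/-- The values of the simple roots `α₁, α₂, α₃, α₄` of each Dynkin diagram at the Cartan element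
where `δ, ε₁, ε₂, ε₃` take the values `x 0`, `x 1`, `x 2`, `x 3`. -/
def simpleRoot (Ξ : Diagram) (x : Fin 4 → ℂ) : Fin 4 → ℂ :=
  let δ := x 0
  let ε₁ := x 1
  let ε₂ := x 2
  let ε₃ := x 3
  match Ξ with
  | .I => ![(δ - ε₁ - ε₂ - ε₃) / 2, ε₃, ε₂ - ε₃, ε₁ - ε₂]
  | .II => ![(-δ + ε₁ + ε₂ + ε₃) / 2, (δ - ε₁ - ε₂ + ε₃) / 2, ε₂ - ε₃, ε₁ - ε₂]
  | .III => ![ε₁ - ε₂, (δ - ε₁ + ε₂ - ε₃) / 2, (-δ + ε₁ + ε₂ - ε₃) / 2, ε₃]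
  | .IV => ![(δ + ε₁ - ε₂ - ε₃) / 2, (δ - ε₁ + ε₂ + ε₃) / 2, (-δ + ε₁ - ε₂ + ε₃) / 2, ε₂ - ε₃]
  | .V => ![δ, (-δ + ε₁ - ε₂ - ε₃) / 2, ε₃, ε₂ - ε₃]
  | .VI => ![δ, (-δ - ε₁ + ε₂ + ε₃) / 2, ε₁ - ε₂, ε₂ - ε₃]

/-- `x` are the coordinates of the grading element of the maximal parabolic subalgebra with the
node `i` crossed: the simple root of that node has degree `1`, the other ones have degree `0`.
The nodes `1, 2, 3, 4` correspond to `i = 0, 1, 2, 3`. -/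
def IsGrading (Ξ : Diagram) (i : Fin 4) (x : Fin 4 → ℂ) : Prop :=
  simpleRoot Ξ x = Pi.single i 1

/-- The grading elements exist and are unique. -/
theorem existsUnique_isGrading (Ξ : Diagram) (i : Fin 4) : ∃! x, IsGrading Ξ i x := by
  let inv : (Fin 4 → ℂ) → Fin 4 → ℂ := fun y => match Ξ with
    | .I => ![2 * y 0 + 3 * y 1 + 2 * y 2 + y 3, y 1 + y 2 + y 3, y 1 + y 2, y 1]
    | .II => ![y 0 + 3 * y 1 + 2 * y 2 + y 3, y 0 + y 1 + y 2 + y 3, y 0 + y 1 + y 2, y 0 + y 1]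
    | .III => ![y 0 + 2 * y 1 + y 3, y 0 + y 1 + y 2 + y 3, y 1 + y 2 + y 3, y 3]
    | .IV => ![y 0 + y 1, y 0 + y 1 + 2 * y 2 + y 3, y 1 + y 2 + y 3, y 1 + y 2]
    | .V => ![y 0, y 0 + 2 * y 1 + 2 * y 2 + y 3, y 2 + y 3, y 2]
    | .VI => ![y 0, y 0 + 2 * y 1 + 2 * y 2 + y 3, y 0 + 2 * y 1 + y 2 + y 3, y 0 + 2 * y 1 + y 2]
  have left : ∀ x, inv (simpleRoot Ξ x) = x := fun x => by
    refine funext fun k => ?_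
    cases Ξ <;> fin_cases k <;> simp only [inv, simpleRoot, Matrix.cons_val, Fin.zero_eta,
      Fin.mk_one, Fin.reduceFinMk] <;> ring
  have right : ∀ y, simpleRoot Ξ (inv y) = y := fun y => by
    refine funext fun k => ?_
    cases Ξ <;> fin_cases k <;> simp only [inv, simpleRoot, Matrix.cons_val, Fin.zero_eta,
      Fin.mk_one, Fin.reduceFinMk] <;> ring
  exact ⟨inv (Pi.single i 1), right _, fun x hx => by rw [← hx, left]⟩

/-- The dimension of `𝔤_{-1}` for the maximal parabolic with the node `i` crossed. -/
def dimTable : Diagram → Fin 4 → ℕ × ℕ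
  | .I => ![(0, 8), (3, 3), (6, 4), (6, 4)]
  | .II => ![(4, 4), (3, 3), (6, 4), (6, 4)]
  | .III => ![(6, 4), (6, 4), (6, 4), (4, 4)]
  | .IV => ![(6, 4), (4, 4), (4, 4), (6, 4)]
  | .V => ![(6, 4), (0, 8), (4, 4), (6, 4)]
  | .VI => ![(4, 4), (0, 6), (4, 4), (6, 4)]

/-- The maximal dimensions of nondegenerate integral submanifolds for the maximal parabolic with
the node `i` crossed. -/
def maxDimTable : Diagram → Fin 4 → Set (ℕ × ℕ)
  | .I => ![{(0, 4)}, {(1, 1), (0, 3)}, {(3, 2)}, {(6, 4)}]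
  | .II => ![{(1, 3), (2, 2)}, {(1, 1), (0, 3)}, {(3, 2)}, {(6, 4)}]
  | .III => ![{(6, 4)}, {(3, 2)}, {(3, 2)}, {(1, 3), (2, 2)}]
  | .IV => ![{(6, 4)}, {(1, 3), (2, 2)}, {(2, 2)}, {(3, 2)}]
  | .V => ![{(6, 4)}, {(0, 4)}, {(2, 2)}, {(3, 2)}]
  | .VI => ![{(1, 3), (2, 2)}, {(0, 3)}, {(2, 2)}, {(3, 2)}]

end F4

end

/-!
The maximal dimensions of integral submanifolds of `𝒟` are found by reducing the problem to the
bracket of the graded piece `𝔤_{-1}` and then solving a small problem of linear algebra for each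
of the grading elements: `(p|q)` is the dimension of a nondegenerate integral submanifold if and
only if `𝔤_{-1}` contains an abelian graded subspace of dimension `(p|q)`
(`mem_integralDims_iff`).

If `g` is a local lift of an integral submanifold, the values at `θ = 0` of its logarithmic
derivatives lie in `𝔤^{-1}`. The Maurer-Cartan equation, evaluated at `θ = 0`, expresses the
bracket of two of them through derivatives of logarithmic derivatives, which lie in `𝔤^{-1}` as
well. So these brackets lie in `𝔤^{-1}`, and as their parts of degree `-2` vanish, the degree `-1`
parts of the tangent vectors commute (`isAbelianDim_of_mem_integralDims`). The three components of
the Maurer-Cartan equation are `bracket_bodyMap_mem_of_odd`, `bracket_bodyMap_mem_of_even_odd` and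
`bracket_bodyMap_mem_of_even_even`. They are used in the adjoint representation, which is faithful
as `𝔤` is centerless. Only `g`, not its logarithmic derivatives, is known to be holomorphic;
`exists_mem_deriv_eq_of_eventually_mul` and the symmetry of mixed derivatives
`hasDerivAt_deriv_comm` replace the differentiation of the latter. Conversely, the elements of
degree `-1` are `ad`-nilpotent, and an abelian subspace `W` of `𝔤_{-1}` is tangent to the integral
submanifold parametrized by `exp W` (`mem_integralDims_of_isAbelianDim`).

Explicit coordinates on `G₂` and `𝔰𝔭𝔦𝔫(7)` (`G3.g2_apply`, `F4.spin7_apply`) give a basis of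
weight vectors of `𝔤` (`WeightCoords`), by which the dimension of `𝔤_{-1}` is a count of weights
(`WeightCoords.superDim_gr`), and weight vectors span an abelian subspace if no two of their weights
add up to a weight (`WeightCoords.isAbelianDim`). The bounds use a few components
of the bracket. Mostly such a component is a nondegenerate bilinear form on the even or the odd
part of `𝔤_{-1}`, for which an isotropic subspace has at most half the dimension
(`two_mul_le_of_isotropic`); a pairing of the even with the odd part is treated by
`add_le_of_dotProduct_eq_zero`, and where the bracket is a cross product of `ℂ³` the bounds come
from `exists_eq_smul_of_cross_eq_zero` and `le_three_of_cross_add_cross_eq_zero`. Conjugate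
parabolic subalgebras have the same grading element, so that six cases remain for `G(3)` and nine
for `F(4)`.
-/

noncomputable section

set_option linter.unusedSimpArgs false

attribute [local instance 100] LieRing.ofAssociativeRing

/-! ### Mixed derivatives of holomorphic functions -/

section Analysis

open Filter Topology Metric Set

/-- A quantitative first order Taylor estimate for bounded holomorphic functions on a disc. -/
theorem norm_sub_sub_mul_deriv_le {g : ℂ → ℂ} {R M : ℝ} (hR : 0 < R)
    (hg : DifferentiableOn ℂ g (ball 0 R)) (hM : ∀ s ∈ ball (0 : ℂ) R, ‖g s‖ ≤ M) {s : ℂ}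
    (hs : s ∈ ball (0 : ℂ) R) : ‖g s - g 0 - s * deriv g 0‖ ≤ 4 * M * (‖s‖ / R) ^ 2 := by
  have h0 : (0 : ℂ) ∈ ball (0 : ℂ) R := mem_ball_self hR
  have hM0 : 0 ≤ M := (norm_nonneg _).trans (hM 0 h0)
  have hd0 : HasDerivAt g (deriv g 0) 0 :=
    (hg.differentiableAt (isOpen_ball.mem_nhds h0)).hasDerivAt
  have hder : ‖deriv g 0‖ ≤ 2 * M / R := by
    refine Complex.norm_deriv_le_div_of_mapsTo_ball hg (fun w hw => ?_) hR
    rw [mem_closedBall, dist_eq_norm]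
    linarith [norm_sub_le (g w) (g 0), hM w hw, hM 0 h0]
  let h : ℂ → ℂ := fun w => g w - g 0 - w * deriv g 0
  have hh0 : h 0 = 0 := by simp [h]
  have hhd : DifferentiableOn ℂ h (ball 0 R) :=
    (hg.sub_const _).sub (differentiableOn_id.mul_const _)
  have hmaps : MapsTo h (ball 0 R) (closedBall (h 0) (4 * M)) := by
    intro w hw
    rw [hh0, mem_closedBall, dist_zero_right]
    have hw' : ‖w‖ ≤ R := by simpa using (mem_ball_zero_iff.1 hw).le
    have h1 : ‖w * deriv g 0‖ ≤ 2 * M := by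
      rw [norm_mul]
      calc ‖w‖ * ‖deriv g 0‖ ≤ R * (2 * M / R) := by gcongr
        _ = 2 * M := by field_simp
    calc ‖h w‖ ≤ ‖g w - g 0‖ + ‖w * deriv g 0‖ := norm_sub_le _ _
      _ ≤ (‖g w‖ + ‖g 0‖) + 2 * M := by gcongr; exact norm_sub_le _ _
      _ ≤ 4 * M := by linarith [hM w hw, hM 0 h0]
  have hlo : (fun w => h w - h 0) =o[𝓝 0] fun w => ‖w - 0‖ ^ 1 := by
    have := hd0.isLittleO
    simp only [sub_zero, smul_eq_mul] at this
    simpa [hh0, h] using this.norm_right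
  have := Complex.dist_le_mul_div_pow_of_mapsTo_ball_of_isLittleO (n := 1) hhd hmaps hlo hs
  rw [hh0, dist_zero_right, dist_zero_right] at this
  exact this

/-- Mixed partial derivatives of a holomorphic function of two variables exist and are symmetric:
the difference quotients in one variable converge locally uniformly in the other one. -/
theorem hasDerivAt_deriv_comm {f : ℂ → ℂ → ℂ}
    (hf : ∀ᶠ p in 𝓝 (0 : ℂ × ℂ), DifferentiableAt ℂ (fun p : ℂ × ℂ => f p.1 p.2) p) :
    HasDerivAt (fun s => deriv (f s) 0) (deriv (fun t => deriv (fun s => f s t) 0) 0) 0 := by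
  obtain ⟨R', hR', hfR'⟩ := Metric.eventually_nhds_iff_ball.1 hf
  let R := R' / 2
  have hR : 0 < R := by positivity
  have hsub : closedBall (0 : ℂ × ℂ) R ⊆ ball 0 R' :=
    closedBall_subset_ball (by simp only [R]; linarith)
  have hmem : ∀ s ∈ ball (0 : ℂ) R, ∀ t ∈ ball (0 : ℂ) R, (s, t) ∈ closedBall (0 : ℂ × ℂ) R := by
    intro s hs t ht
    rw [mem_closedBall, dist_zero_right, Prod.norm_def]
    exact max_le (mem_ball_zero_iff.1 hs).le (mem_ball_zero_iff.1 ht).le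
  have hdiff : ∀ s ∈ ball (0 : ℂ) R, ∀ t ∈ ball (0 : ℂ) R,
      DifferentiableAt ℂ (fun p : ℂ × ℂ => f p.1 p.2) (s, t) :=
    fun s hs t ht => hfR' _ (hsub (hmem s hs t ht))
  have hd1 : ∀ t ∈ ball (0 : ℂ) R, ∀ s ∈ ball (0 : ℂ) R, DifferentiableAt ℂ (fun s => f s t) s :=
    fun t ht s hs => (hdiff s hs t ht).comp s
      (f := fun s => (s, t)) (differentiableAt_id.prodMk (differentiableAt_const t))
  have hd2 : ∀ s ∈ ball (0 : ℂ) R, ∀ t ∈ ball (0 : ℂ) R, DifferentiableAt ℂ (f s) t :=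
    fun s hs t ht => (hdiff s hs t ht).comp t
      (f := fun t => (s, t)) ((differentiableAt_const s).prodMk differentiableAt_id)
  obtain ⟨M, hM⟩ : ∃ M, ∀ p ∈ closedBall (0 : ℂ × ℂ) R, ‖f p.1 p.2‖ ≤ M :=
    (isCompact_closedBall _ _).exists_bound_of_continuousOn
      fun p hp => (hfR' p (hsub hp)).continuousAt.continuousWithinAt
  have h0 : (0 : ℂ) ∈ ball (0 : ℂ) R := mem_ball_self hR
  let F : ℂ → ℂ → ℂ := fun s t => s⁻¹ * (f s t - f 0 t)
  let G : ℂ → ℂ := fun t => deriv (fun s => f s t) 0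
  have hnear : ∀ᶠ s in 𝓝[≠] (0 : ℂ), s ∈ ball (0 : ℂ) R :=
    nhdsWithin_le_nhds (isOpen_ball.mem_nhds h0)
  have hFd : ∀ᶠ s in 𝓝[≠] (0 : ℂ), DifferentiableOn ℂ (F s) (ball 0 R) := by
    filter_upwards [hnear] with s hs t ht
    exact (((hd2 s hs t ht).sub (hd2 0 h0 t ht)).const_mul _).differentiableWithinAt
  have hunif : TendstoLocallyUniformlyOn F G (𝓝[≠] 0) (ball 0 R) := by
    refine TendstoUniformlyOn.tendstoLocallyUniformlyOn ?_
    rw [Metric.tendstoUniformlyOn_iff]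
    intro ε hε
    have hlim : Tendsto (fun s : ℂ => 4 * M / R ^ 2 * ‖s‖) (𝓝[≠] 0) (𝓝 0) := by
      have : Tendsto (fun s : ℂ => 4 * M / R ^ 2 * ‖s‖) (𝓝 0) (𝓝 (4 * M / R ^ 2 * ‖(0 : ℂ)‖)) :=
        (continuous_const.mul continuous_norm).tendsto 0
      simpa using this.mono_left nhdsWithin_le_nhds
    filter_upwards [hnear, self_mem_nhdsWithin, hlim.eventually (gt_mem_nhds hε)]
      with s hs hs0 hsε t ht
    have hs0' : s ≠ 0 := hs0
    have key := norm_sub_sub_mul_deriv_le (g := fun s => f s t) hR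
      (fun w hw => (hd1 t ht w hw).differentiableWithinAt)
      (fun w hw => hM (w, t) (hmem w hw t ht)) hs
    refine lt_of_le_of_lt ?_ hsε
    rw [dist_comm, dist_eq_norm]
    have e : F s t - G t = s⁻¹ * (f s t - f 0 t - s * G t) := by
      simp only [F]; field_simp
    have hsn : 0 < ‖s‖ := norm_pos_iff.2 hs0'
    rw [e, norm_mul, norm_inv]
    calc ‖s‖⁻¹ * ‖f s t - f 0 t - s * G t‖ ≤ ‖s‖⁻¹ * (4 * M * (‖s‖ / R) ^ 2) := by gcongr
      _ = 4 * M / R ^ 2 * ‖s‖ := by field_simp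
  have hlim := (hunif.deriv hFd isOpen_ball).tendsto_at h0
  rw [hasDerivAt_iff_tendsto_slope]
  refine hlim.congr' ?_
  filter_upwards [hnear] with s hs
  have h1 : HasDerivAt (f s) (deriv (f s) 0) 0 := (hd2 s hs 0 h0).hasDerivAt
  have h2 : HasDerivAt (f 0) (deriv (f 0) 0) 0 := (hd2 0 h0 0 h0).hasDerivAt
  simpa [slope_def_field, F, div_eq_inv_mul] using ((h1.sub h2).const_mul s⁻¹).deriv

/-- If `S = T A` where `T` and `S` are differentiable at `0`, `T 0` is invertible and `A` takes
values in a closed subspace `W`, then `S' = T' A + T w` with `w ∈ W`. The function `A` is not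
assumed to be differentiable: `w` is obtained as the limit of its difference quotients. -/
theorem exists_mem_deriv_eq_of_eventually_mul {𝓐 : Type*} [NormedRing 𝓐] [NormedAlgebra ℂ 𝓐]
    [CompleteSpace 𝓐] {T S A : ℂ → 𝓐} {T' S' : 𝓐} (W : Submodule ℂ 𝓐) (hW : IsClosed (W : Set 𝓐))
    (hT : HasDerivAt T T' 0) (hS : HasDerivAt S S' 0) (hu : IsUnit (T 0))
    (hA : ∀ᶠ s in 𝓝 0, S s = T s * A s ∧ A s ∈ W) :
    ∃ w ∈ W, S' = T' * A 0 + T 0 * w := by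
  obtain ⟨u, hu⟩ := hu
  have hA0 := hA.self_of_nhds
  have h1 : HasDerivAt (fun s => S s - T s * A 0) (S' - T' * A 0) 0 := hS.sub (hT.mul_const _)
  rw [hasDerivAt_iff_tendsto_slope] at h1
  have hTc : Tendsto (fun s => Ring.inverse (T s)) (𝓝[≠] 0) (𝓝 (Ring.inverse (T 0))) := by
    have : ContinuousAt Ring.inverse (T 0) := by
      rw [← hu]; exact NormedRing.inverse_continuousAt u
    exact (this.tendsto.comp hT.continuousAt.tendsto).mono_left nhdsWithin_le_nhds
  have hunit : ∀ᶠ s in 𝓝 0, IsUnit (T s) := by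
    have : {x : 𝓐 | IsUnit x} ∈ 𝓝 (T 0) := by rw [← hu]; exact Units.nhds u
    exact hT.continuousAt.eventually this
  have h2 := hTc.mul h1
  have h3 : Ring.inverse (T 0) * (S' - T' * A 0) ∈ W := by
    refine hW.mem_of_tendsto h2 ?_
    filter_upwards [nhdsWithin_le_nhds hA, nhdsWithin_le_nhds hunit] with s hs hus
    have e : slope (fun s => S s - T s * A 0) 0 s = s⁻¹ • (T s * (A s - A 0)) := by
      simp only [slope, vsub_eq_sub, sub_zero, hs.1, hA0.1, sub_self, mul_sub]
    rw [e, mul_smul_comm, ← mul_assoc, Ring.inverse_mul_cancel _ hus, one_mul]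
    exact W.smul_mem _ (W.sub_mem hs.2 hA0.2)
  refine ⟨_, h3, ?_⟩
  rw [← mul_assoc, Ring.mul_inverse_cancel _ (hu ▸ u.isUnit), one_mul]
  abel

/-- In a finite dimensional space differentiability can be tested with linear functionals. -/
theorem hasDerivAt_of_forall_dual {V : Type*} [NormedAddCommGroup V] [NormedSpace ℂ V]
    [FiniteDimensional ℂ V] {f : ℂ → V} {f' : V} {z : ℂ}
    (h : ∀ l : Module.Dual ℂ V, HasDerivAt (fun s => l (f s)) (l f') z) : HasDerivAt f f' z := by
  let b := Module.finBasis ℂ V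
  have : HasDerivAt (fun s => ∑ k, b.coord k (f s) • b k) (∑ k, b.coord k f' • b k) z :=
    HasDerivAt.fun_sum fun k _ => (h (b.coord k)).smul_const (b k)
  simpa [b.sum_repr] using this

end Analysis

/-! ### The super bracket and its gradings -/

namespace LieSuperalgebra

section General

variable {E O : Type} [LieRing E] [LieAlgebra ℂ E] [AddCommGroup O] [Module ℂ O]
  (S : LieSuperalgebra E O)

theorem eq_zero_of_eq_neg {M : Type*} [AddCommGroup M] [Module ℂ M] {x : M} (h : x = -x) :
    x = 0 :=
  (smul_eq_zero.1 (show (2 : ℂ) • x = 0 by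
    rw [two_smul]; nth_rewrite 1 [h]; exact neg_add_cancel x)).resolve_left two_ne_zero

theorem bracket_apply (v w : E × O) :
    S.bracket v w = (⁅v.1, w.1⁆ + S.odd v.2 w.2, S.act v.1 w.2 - S.act w.1 v.2) := rfl

theorem evenProj_apply (v : E × O) : evenProj E O v = (v.1, 0) := rfl

theorem oddProj_apply (v : E × O) : oddProj E O v = (0, v.2) := rfl

/-- The polarization of the cubic identity. -/
theorem odd_cubic_polarized (p q r : O) :
    S.act (S.odd p q) r + S.act (S.odd q r) p + S.act (S.odd r p) q = 0 := by
  have h := S.odd_cubic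
  have h1 := h (p + q + r)
  have h2 := h (p + q)
  have h3 := h (q + r)
  have h4 := h (p + r)
  simp only [map_add, LinearMap.add_apply, S.odd_symm q p, S.odd_symm r q, S.odd_symm r p, h,
    zero_add, add_zero] at h1 h2 h3 h4 ⊢
  have h5 : (2 : ℂ) • (S.act (S.odd p q) r + S.act (S.odd q r) p + S.act (S.odd p r) q) = 0 := by
    linear_combination (norm := module) h1 - h2 - h3 - h4
  exact (smul_eq_zero.1 h5).resolve_left two_ne_zero

/-- The super Jacobi identity: `ad e` is a derivation for even `e`. -/
theorem bracket_even_leibniz (e : E) (v w : E × O) :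
    S.bracket (e, 0) (S.bracket v w) =
      S.bracket (S.bracket (e, 0) v) w + S.bracket v (S.bracket (e, 0) w) := by
  have h : ∀ x y : E, ∀ q, S.act ⁅x, y⁆ q = S.act x (S.act y q) - S.act y (S.act x q) := by
    intro x y q
    rw [LieHom.map_lie, LieRing.of_associative_ring_bracket]; rfl
  refine Prod.ext ?_ ?_
  · simp only [bracket_apply, map_zero, LinearMap.zero_apply, add_zero, sub_zero, lie_add,
      S.odd_equivariant, Prod.fst_add, leibniz_lie e v.1 w.1]
    abel
  · simp only [bracket_apply, map_zero, LinearMap.zero_apply, add_zero, sub_zero, map_sub,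
      Prod.snd_add, h]
    abel

/-- The super Jacobi identity for two odd elements. -/
theorem bracket_odd_odd (p q : O) (v : E × O) :
    S.bracket (0, p) (S.bracket (0, q) v) + S.bracket (0, q) (S.bracket (0, p) v) =
      S.bracket (S.bracket (0, p) (0, q)) v := by
  refine Prod.ext ?_ ?_
  · simp only [bracket_apply, map_zero, LinearMap.zero_apply, zero_lie, zero_add, zero_sub,
      sub_zero, map_neg, Prod.fst_add, add_zero]
    rw [← lie_skew, S.odd_equivariant, S.odd_symm q (S.act v.1 p)]
    abel
  · simp only [bracket_apply, map_zero, LinearMap.zero_apply, zero_lie, zero_add, zero_sub,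
      sub_zero, map_neg, Prod.snd_add, add_zero]
    have := S.odd_cubic_polarized p q v.2
    rw [S.odd_symm v.2 p] at this
    linear_combination (norm := module) -this

/-- The super Jacobi identity for an odd and an even element. -/
theorem bracket_odd_leibniz (p : O) (e : E) (w : E × O) :
    S.bracket (0, p) (S.bracket (e, 0) w) =
      S.bracket (S.bracket (0, p) (e, 0)) w + S.bracket (e, 0) (S.bracket (0, p) w) := by
  have h := S.bracket_even_leibniz e (0, p) w
  have h2 : S.bracket (0, p) (e, 0) = - S.bracket (e, 0) (0, p) := by
    simp [bracket_apply]
  rw [h, h2, map_neg, LinearMap.neg_apply]; abel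

theorem mem_gr {Z : E} {k : ℤ} {v : E × O} :
    v ∈ S.gr Z k ↔ S.bracket (Z, 0) v = (k : ℂ) • v := Module.End.mem_eigenspace_iff

theorem bracket_mem_gr {Z : E} {j k : ℤ} {v w : E × O} (hv : v ∈ S.gr Z j) (hw : w ∈ S.gr Z k) :
    S.bracket v w ∈ S.gr Z (j + k) := by
  rw [mem_gr] at *
  rw [bracket_even_leibniz, hv, hw]
  simp [add_smul]

theorem gr_le_fil {Z : E} {j k : ℤ} (h : k ≤ j) : S.gr Z j ≤ S.fil Z k :=
  le_iSup₂_of_le j h le_rfl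

theorem fil_anti {Z : E} {j k : ℤ} (h : k ≤ j) : S.fil Z j ≤ S.fil Z k :=
  iSup₂_le fun _ hi => S.gr_le_fil (h.trans hi)

theorem fil_eq_sup {Z : E} (k : ℤ) : S.fil Z k = S.gr Z k ⊔ S.fil Z (k + 1) := by
  refine le_antisymm (iSup₂_le fun j hj => ?_)
    (sup_le (S.gr_le_fil le_rfl) (S.fil_anti (by omega)))
  rcases hj.eq_or_lt with rfl | h
  · exact le_sup_left
  · exact (S.gr_le_fil h).trans le_sup_right

theorem bracket_mem_fil {Z : E} {j k : ℤ} {v w : E × O} (hv : v ∈ S.fil Z j)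
    (hw : w ∈ S.fil Z k) : S.bracket v w ∈ S.fil Z (j + k) := by
  have h1 : ∀ i, j ≤ i → ∀ v ∈ S.gr Z i, S.fil Z k ≤ (S.fil Z (j + k)).comap (S.bracket v) := by
    intro i hi v hv
    refine iSup₂_le fun l hl w hw => ?_
    exact S.gr_le_fil (add_le_add hi hl) (S.bracket_mem_gr hv hw)
  have h2 : S.fil Z j ≤ (S.fil Z (j + k)).comap (S.bracket.flip w) :=
    iSup₂_le fun i hi v hv => h1 i hi v hv hw
  exact h2 hv

theorem gr_inf_fil {Z : E} {j k : ℤ} (h : j < k) : S.gr Z j ⊓ S.fil Z k = ⊥ := by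
  have hind : iSupIndep fun i : ℤ => S.gr Z i :=
    (Module.End.eigenspaces_iSupIndep (S.bracket (Z, 0))).comp
      (f := fun i : ℤ => (i : ℂ)) Int.cast_injective
  refine ((hind j).mono_right ?_).eq_bot
  exact iSup₂_le fun i hi => le_iSup₂_of_le i (by omega) le_rfl

/-- The parity operator of `𝔤`. -/
def parity (E O : Type) [LieRing E] [LieAlgebra ℂ E] [AddCommGroup O] [Module ℂ O] :
    E × O →ₗ[ℂ] E × O := evenProj E O - oddProj E O

theorem parity_apply (v : E × O) : parity E O v = (v.1, -v.2) := by
  simp [parity, evenProj_apply, oddProj_apply]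

theorem parity_bracket (v w : E × O) :
    parity E O (S.bracket v w) = S.bracket (parity E O v) (parity E O w) := by
  refine Prod.ext ?_ ?_ <;> simp [bracket_apply, parity_apply]
  abel

theorem evenProj_mem_gr {Z : E} {k : ℤ} {v : E × O} (hv : v ∈ S.gr Z k) :
    ((v.1, 0) : E × O) ∈ S.gr Z k := by
  rw [mem_gr] at *
  have := congrArg Prod.fst hv
  simpa [bracket_apply] using this

theorem oddProj_mem_gr {Z : E} {k : ℤ} {v : E × O} (hv : v ∈ S.gr Z k) :
    ((0, v.2) : E × O) ∈ S.gr Z k := by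
  rw [mem_gr] at *
  have := congrArg Prod.snd hv
  simpa [bracket_apply] using this

theorem evenProj_mem_fil {Z : E} {k : ℤ} {v : E × O} (hv : v ∈ S.fil Z k) :
    ((v.1, 0) : E × O) ∈ S.fil Z k := by
  have : S.fil Z k ≤ (S.fil Z k).comap (evenProj E O) :=
    iSup₂_le fun j hj w hw => S.gr_le_fil hj (S.evenProj_mem_gr hw)
  exact this hv

theorem oddProj_mem_fil {Z : E} {k : ℤ} {v : E × O} (hv : v ∈ S.fil Z k) :
    ((0, v.2) : E × O) ∈ S.fil Z k := by
  have : S.fil Z k ≤ (S.fil Z k).comap (oddProj E O) :=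
    iSup₂_le fun j hj w hw => S.gr_le_fil hj (S.oddProj_mem_gr hw)
  exact this hv

/-- `S.IsAbelianDim Z p q`: the component `𝔤_{-1}` has a graded subspace of dimension `(p|q)` on
which the bracket vanishes; it is given by a basis `e` of its even and a basis `o` of its odd
part. -/
def IsAbelianDim (Z : E) (p q : ℕ) : Prop :=
  ∃ (e : Fin p → E) (o : Fin q → O), LinearIndependent ℂ e ∧ LinearIndependent ℂ o ∧
    (∀ i, ((e i, 0) : E × O) ∈ S.gr Z (-1)) ∧ (∀ j, ((0, o j) : E × O) ∈ S.gr Z (-1)) ∧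
    (∀ i i', ⁅e i, e i'⁆ = 0) ∧ (∀ i j, S.act (e i) (o j) = 0) ∧ ∀ j j', S.odd (o j) (o j') = 0

/-- The adjoint representation is faithful. -/
def IsCenterless : Prop := ∀ v, (∀ w, S.bracket v w = 0) → v = 0

variable {S} in
theorem IsCenterless.eq_of_bracket_eq (hS : S.IsCenterless) {v w : E × O}
    (h : ∀ u, S.bracket v u = S.bracket w u) : v = w :=
  sub_eq_zero.1 (hS _ fun u => by simp [h])

/-- Vectors of `𝔤^{-1}`, independent modulo `𝔭`, whose brackets lie in `𝔤^{-1}`, have degree `-1`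
components that span an abelian subspace. -/
theorem isAbelianDim_of_bracket_mem {Z : E} {p q : ℕ} (w : Fin p ⊕ Fin q → E × O)
    (hw : ∀ a, w a ∈ S.fil Z (-1)) (heven : ∀ i, parity E O (w (.inl i)) = w (.inl i))
    (hodd : ∀ j, parity E O (w (.inr j)) = - w (.inr j))
    (hbr : ∀ a b, S.bracket (w a) (w b) ∈ S.fil Z (-1))
    (hli : LinearIndependent ℂ fun a => (S.parabolic Z).mkQ (w a)) : S.IsAbelianDim Z p q := by
  have hdec : ∀ a, ∃ u ∈ S.gr Z (-1), ∃ r ∈ S.fil Z 0, u + r = w a := by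
    intro a
    have := hw a
    rw [S.fil_eq_sup (-1), Submodule.mem_sup] at this
    exact this
  choose u hu r hr hur using hdec
  have h0e : ∀ i, (w (.inl i)).2 = 0 := fun i => by
    have := congrArg Prod.snd (heven i)
    rw [parity_apply] at this
    exact eq_zero_of_eq_neg this.symm
  have h0o : ∀ j, (w (.inr j)).1 = 0 := fun j => by
    have := congrArg Prod.fst (hodd j)
    rw [parity_apply] at this
    exact eq_zero_of_eq_neg this
  let u' : Fin p ⊕ Fin q → E × O :=
    Sum.elim (fun i => ((u (.inl i)).1, 0)) fun j => (0, (u (.inr j)).2)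
  let r' : Fin p ⊕ Fin q → E × O :=
    Sum.elim (fun i => ((r (.inl i)).1, 0)) fun j => (0, (r (.inr j)).2)
  have hu' : ∀ a, u' a ∈ S.gr Z (-1) := by
    rintro (i | j)
    · exact S.evenProj_mem_gr (hu _)
    · exact S.oddProj_mem_gr (hu _)
  have hr' : ∀ a, r' a ∈ S.fil Z 0 := by
    rintro (i | j)
    · exact S.evenProj_mem_fil (hr _)
    · exact S.oddProj_mem_fil (hr _)
  have hur' : ∀ a, w a = u' a + r' a := by
    rintro (i | j)
    · refine Prod.ext ?_ ?_
      · simp [u', r', ← hur]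
      · simp [u', r', h0e]
    · refine Prod.ext ?_ ?_
      · simp [u', r', h0o]
      · simp [u', r', ← hur]
  have hbr' : ∀ a b, S.bracket (u' a) (u' b) = 0 := by
    intro a b
    have h1 := S.bracket_mem_gr (hu' a) (hu' b)
    have hu'' : ∀ a, u' a ∈ S.fil Z (-1) := fun a => S.gr_le_fil le_rfl (hu' a)
    have h2 : S.bracket (u' a) (u' b) ∈ S.fil Z (-1) := by
      have e : S.bracket (u' a) (u' b) = S.bracket (w a) (w b) - S.bracket (u' a) (r' b)
          - S.bracket (r' a) (u' b) - S.bracket (r' a) (r' b) := by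
        simp only [hur', map_add, LinearMap.add_apply]; abel
      have h3 := S.bracket_mem_fil (hu'' a) (hr' b)
      have h4 := S.bracket_mem_fil (hr' a) (hu'' b)
      have h5 : S.bracket (r' a) (r' b) ∈ S.fil Z (-1) :=
        S.fil_anti (by norm_num) (S.bracket_mem_fil (hr' a) (hr' b))
      rw [add_zero] at h3
      rw [zero_add] at h4
      rw [e]
      exact sub_mem (sub_mem (sub_mem (hbr a b) h3) h4) h5
    have := Submodule.mem_inf.2 ⟨h1, h2⟩
    rwa [S.gr_inf_fil (by omega), Submodule.mem_bot] at this
  have hli' : LinearIndependent ℂ u' := by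
    refine LinearIndependent.of_comp (S.parabolic Z).mkQ ?_
    convert hli using 2 with a
    rw [Function.comp_apply, hur', map_add]
    have : (S.parabolic Z).mkQ (r' a) = 0 := by
      rw [← LinearMap.mem_ker, Submodule.ker_mkQ]; exact hr' a
    rw [this, add_zero]
  refine ⟨fun i => (u (.inl i)).1, fun j => (u (.inr j)).2, ?_, ?_, fun i => hu' (.inl i),
    fun j => hu' (.inr j), fun i i' => ?_, fun i j => ?_, fun j j' => ?_⟩
  · exact LinearIndependent.of_comp (LinearMap.inl ℂ E O) (hli'.comp Sum.inl Sum.inl_injective)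
  · exact LinearIndependent.of_comp (LinearMap.inr ℂ E O) (hli'.comp Sum.inr Sum.inr_injective)
  · simpa [u', bracket_apply] using congrArg Prod.fst (hbr' (.inl i) (.inl i'))
  · simpa [u', bracket_apply] using congrArg Prod.snd (hbr' (.inl i) (.inr j))
  · simpa [u', bracket_apply] using congrArg Prod.fst (hbr' (.inr j) (.inr j'))

end General

end LieSuperalgebra

/-! ### The Grassmann algebra -/

namespace LieSuperalgebra

section Grassmann

variable (q : ℕ)

/-- The augmentation `Λ_q → ℂ`, the value of a superfunction at `θ = 0`. -/
def counit : Grassmann q →ₐ[ℂ] ℂ := ExteriorAlgebra.algebraMapInv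

/-- The coordinate `θ_j`. -/
def theta (j : Fin q) : Grassmann q := ExteriorAlgebra.ι ℂ (Pi.single j 1)

theorem grassmannParity_algebraMap (c : ℂ) :
    grassmannParity q (algebraMap ℂ _ c) = algebraMap ℂ _ c :=
  (CliffordAlgebra.involute (Q := (0 : QuadraticForm ℂ (Fin q → ℂ)))).commutes c

theorem grassmannParity_one : grassmannParity q 1 = 1 :=
  map_one (CliffordAlgebra.involute (Q := (0 : QuadraticForm ℂ (Fin q → ℂ))))

theorem grassmannParity_mul (a b : Grassmann q) :
    grassmannParity q (a * b) = grassmannParity q a * grassmannParity q b :=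
  map_mul (CliffordAlgebra.involute (Q := (0 : QuadraticForm ℂ (Fin q → ℂ)))) a b

theorem grassmannParity_ι (m : Fin q → ℂ) :
    grassmannParity q (ExteriorAlgebra.ι ℂ m) = - ExteriorAlgebra.ι ℂ m :=
  CliffordAlgebra.involute_ι m

theorem grassmannParity_theta (j : Fin q) : grassmannParity q (theta q j) = - theta q j :=
  grassmannParity_ι q _

theorem grassmannParity_grassmannParity (a : Grassmann q) :
    grassmannParity q (grassmannParity q a) = a :=
  CliffordAlgebra.involute_involute a

theorem counit_ι (m : Fin q → ℂ) : counit q (ExteriorAlgebra.ι ℂ m) = 0 := by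
  simp [counit, ExteriorAlgebra.algebraMapInv]

theorem counit_grassmannParity (a : Grassmann q) : counit q (grassmannParity q a) = counit q a := by
  induction a using ExteriorAlgebra.induction with
  | algebraMap r => rw [grassmannParity_algebraMap]
  | ι x => rw [grassmannParity_ι, map_neg, counit_ι, neg_zero]
  | mul a b ha hb => rw [grassmannParity_mul, map_mul, map_mul, ha, hb]
  | add a b ha hb => rw [map_add, map_add, map_add, ha, hb]

theorem thetaDeriv_algebraMap (j : Fin q) (c : ℂ) : thetaDeriv q j (algebraMap ℂ _ c) = 0 :=
  CliffordAlgebra.contractLeft_algebraMap (0 : QuadraticForm ℂ (Fin q → ℂ))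
    (LinearMap.proj j : Module.Dual ℂ (Fin q → ℂ)) c

theorem thetaDeriv_one (j : Fin q) : thetaDeriv q j 1 = 0 :=
  CliffordAlgebra.contractLeft_one (0 : QuadraticForm ℂ (Fin q → ℂ))
    (LinearMap.proj j : Module.Dual ℂ (Fin q → ℂ))

theorem thetaDeriv_ι_mul (j : Fin q) (m : Fin q → ℂ) (b : Grassmann q) :
    thetaDeriv q j (ExteriorAlgebra.ι ℂ m * b) =
      m j • b - ExteriorAlgebra.ι ℂ m * thetaDeriv q j b :=
  CliffordAlgebra.contractLeft_ι_mul (Q := (0 : QuadraticForm ℂ (Fin q → ℂ)))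
    (d := (LinearMap.proj j : Module.Dual ℂ (Fin q → ℂ))) m b

theorem thetaDeriv_ι (j : Fin q) (m : Fin q → ℂ) :
    thetaDeriv q j (ExteriorAlgebra.ι ℂ m) = algebraMap ℂ _ (m j) :=
  CliffordAlgebra.contractLeft_ι (0 : QuadraticForm ℂ (Fin q → ℂ))
    (LinearMap.proj j : Module.Dual ℂ (Fin q → ℂ)) m

theorem thetaDeriv_mul (j : Fin q) (a b : Grassmann q) :
    thetaDeriv q j (a * b) = thetaDeriv q j a * b + grassmannParity q a * thetaDeriv q j b := by
  induction a using ExteriorAlgebra.induction generalizing b with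
  | algebraMap r =>
    rw [thetaDeriv_algebraMap, grassmannParity_algebraMap, zero_mul, zero_add,
      ← Algebra.smul_def, ← Algebra.smul_def, map_smul]
  | ι x =>
    rw [thetaDeriv_ι_mul, thetaDeriv_ι, grassmannParity_ι, ← Algebra.smul_def, neg_mul,
      sub_eq_add_neg]
  | mul a c ha hc =>
    rw [mul_assoc, ha, hc, ha, grassmannParity_mul]
    noncomm_ring
  | add a c ha hc => rw [add_mul, map_add, map_add, map_add, ha, hc]; noncomm_ring

theorem thetaDeriv_comm (j k : Fin q) (a : Grassmann q) :
    thetaDeriv q j (thetaDeriv q k a) = - thetaDeriv q k (thetaDeriv q j a) :=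
  CliffordAlgebra.contractLeft_comm (Q := (0 : QuadraticForm ℂ (Fin q → ℂ)))
    (d := (LinearMap.proj j : Module.Dual ℂ (Fin q → ℂ)))
    (d' := (LinearMap.proj k : Module.Dual ℂ (Fin q → ℂ))) a

theorem thetaDeriv_grassmannParity (j : Fin q) (a : Grassmann q) :
    thetaDeriv q j (grassmannParity q a) = - grassmannParity q (thetaDeriv q j a) := by
  induction a using ExteriorAlgebra.induction with
  | algebraMap r => rw [grassmannParity_algebraMap, thetaDeriv_algebraMap, map_zero, neg_zero]
  | ι x =>
    rw [grassmannParity_ι, map_neg, thetaDeriv_ι, grassmannParity_algebraMap]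
  | mul a c ha hc =>
    rw [grassmannParity_mul, thetaDeriv_mul, thetaDeriv_mul, ha, hc, map_add, grassmannParity_mul,
      grassmannParity_mul]
    noncomm_ring
  | add a c ha hc => rw [map_add, map_add, map_add, map_add, ha, hc]; abel

/-- Odd elements of degree one supercommute with all elements. -/
theorem theta_mul (j : Fin q) (a : Grassmann q) :
    theta q j * a = grassmannParity q a * theta q j := by
  induction a using ExteriorAlgebra.induction with
  | algebraMap r => rw [grassmannParity_algebraMap]; exact (Algebra.commutes r _).symm
  | ι x =>
    rw [grassmannParity_ι, neg_mul]
    exact eq_neg_of_add_eq_zero_left (ExteriorAlgebra.ι_add_mul_swap _ _)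
  | mul a c ha hc =>
    rw [grassmannParity_mul, ← mul_assoc, ha, mul_assoc, hc, mul_assoc]
  | add a c ha hc => rw [mul_add, map_add, add_mul, ha, hc]

end Grassmann

/-! ### The Maurer-Cartan equations at `θ = 0` -/

section Body

variable {E O : Type} [LieRing E] [LieAlgebra ℂ E] [AddCommGroup O] [Module ℂ O]
  (S : LieSuperalgebra E O) {q : ℕ}

theorem bodyMap_tmul (a : Grassmann q) (v : E × O) : bodyMap E O q (a ⊗ₜ v) = counit q a • v := by
  simp [bodyMap, counit]

theorem bodyMap_smul (a : Grassmann q) (w : Grassmann q ⊗[ℂ] (E × O)) :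
    bodyMap E O q (a • w) = counit q a • bodyMap E O q w := by
  induction w using TensorProduct.induction_on with
  | zero => simp
  | tmul b v => simp [TensorProduct.smul_tmul', bodyMap_tmul, mul_smul]
  | add x y hx hy => simp [hx, hy]

theorem bodyMap_lTensor (f : E × O →ₗ[ℂ] E × O) (w : Grassmann q ⊗[ℂ] (E × O)) :
    bodyMap E O q (f.lTensor _ w) = f (bodyMap E O q w) := by
  induction w using TensorProduct.induction_on with
  | zero => simp
  | tmul b v => simp [bodyMap_tmul]
  | add x y hx hy => simp [hx, hy]

theorem bodyMap_totalParity (w : Grassmann q ⊗[ℂ] (E × O)) :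
    bodyMap E O q (totalParity E O q w) = parity E O (bodyMap E O q w) := by
  induction w using TensorProduct.induction_on with
  | zero => simp
  | tmul b v => simp [totalParity, bodyMap_tmul, counit_grassmannParity, parity]
  | add x y hx hy => simp [hx, hy]

/-- The operator `∂/∂θ_j` on `Λ_q ⊗ 𝔤`. -/
def thetaDerivT (E O : Type) [LieRing E] [LieAlgebra ℂ E] [AddCommGroup O] [Module ℂ O]
    (q : ℕ) (j : Fin q) : Grassmann q ⊗[ℂ] (E × O) →ₗ[ℂ] Grassmann q ⊗[ℂ] (E × O) :=
  (thetaDeriv q j).rTensor (E × O)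

theorem thetaDerivT_tmul (j : Fin q) (a : Grassmann q) (v : E × O) :
    thetaDerivT E O q j (a ⊗ₜ v) = thetaDeriv q j a ⊗ₜ v := rfl

theorem thetaDerivT_comm (j k : Fin q) (w : Grassmann q ⊗[ℂ] (E × O)) :
    thetaDerivT E O q j (thetaDerivT E O q k w) =
      - thetaDerivT E O q k (thetaDerivT E O q j w) := by
  induction w using TensorProduct.induction_on with
  | zero => simp
  | tmul b v => rw [thetaDerivT_tmul, thetaDerivT_tmul, thetaDeriv_comm, thetaDerivT_tmul,
      thetaDerivT_tmul, TensorProduct.neg_tmul]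
  | add x y hx hy => simp only [map_add, hx, hy]; abel

theorem thetaDerivT_totalParity (j : Fin q) (w : Grassmann q ⊗[ℂ] (E × O)) :
    thetaDerivT E O q j (totalParity E O q w) = - totalParity E O q (thetaDerivT E O q j w) := by
  induction w using TensorProduct.induction_on with
  | zero => simp
  | tmul b v =>
    simp only [totalParity, TensorProduct.map_tmul, thetaDerivT_tmul, thetaDeriv_grassmannParity,
      TensorProduct.neg_tmul]
  | add x y hx hy => simp only [map_add, hx, hy]; abel

theorem bodyMap_thetaDerivT_smul (j : Fin q) (a : Grassmann q) (w : Grassmann q ⊗[ℂ] (E × O)) :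
    bodyMap E O q (thetaDerivT E O q j (a • w)) =
      counit q (thetaDeriv q j a) • bodyMap E O q w +
        counit q a • bodyMap E O q (thetaDerivT E O q j w) := by
  induction w using TensorProduct.induction_on with
  | zero => simp
  | tmul b v =>
    rw [TensorProduct.smul_tmul', smul_eq_mul, thetaDerivT_tmul, thetaDerivT_tmul, thetaDeriv_mul,
      TensorProduct.add_tmul, map_add, bodyMap_tmul, bodyMap_tmul, bodyMap_tmul, bodyMap_tmul,
      map_mul, map_mul, counit_grassmannParity, smul_smul, smul_smul]
  | add x y hx hy => simp only [smul_add, map_add, hx, hy]; abel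

/-- Against `1 ⊗ v` the sign of the bracket of `Λ_q ⊗ 𝔤` disappears. -/
theorem grassmannBracket_one_tmul (y : Grassmann q ⊗[ℂ] (E × O)) (v : E × O) :
    S.grassmannBracket q y (1 ⊗ₜ v) = (S.bracket.flip v).lTensor _ y := by
  induction y using TensorProduct.induction_on with
  | zero => simp
  | tmul b x =>
    have : x = evenProj E O x + oddProj E O x := by simp [evenProj_apply, oddProj_apply]
    conv_rhs => rw [this]
    simp only [grassmannBracket, LinearMap.add_apply, TensorProduct.map₂_apply_tmul,
      TensorProduct.map_tmul,
      LinearMap.mul_apply', mul_one, LinearMap.compl₂_apply, grassmannParity_one,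
      LinearMap.comp_apply, LinearMap.lTensor_tmul, LinearMap.flip_apply, map_add,
      TensorProduct.tmul_add]
  | add x y hx hy => simp only [map_add, LinearMap.add_apply, hx, hy]

theorem bodyMap_grassmannBracket (y : Grassmann q ⊗[ℂ] (E × O)) (v : E × O) :
    bodyMap E O q (S.grassmannBracket q y (1 ⊗ₜ v)) = S.bracket (bodyMap E O q y) v := by
  rw [grassmannBracket_one_tmul, bodyMap_lTensor, LinearMap.flip_apply]

theorem thetaDerivT_grassmannBracket (j : Fin q) (y : Grassmann q ⊗[ℂ] (E × O)) (v : E × O) :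
    thetaDerivT E O q j (S.grassmannBracket q y (1 ⊗ₜ v)) =
      S.grassmannBracket q (thetaDerivT E O q j y) (1 ⊗ₜ v) := by
  rw [grassmannBracket_one_tmul, grassmannBracket_one_tmul]
  exact (LinearMap.congr_fun (LinearMap.rTensor_comp_lTensor ..) y).trans
    (LinearMap.congr_fun (LinearMap.lTensor_comp_rTensor ..) y).symm

theorem bodyMap_mem_of_mem_baseChange {N : Submodule ℂ (E × O)} {y : Grassmann q ⊗[ℂ] (E × O)}
    (hy : y ∈ N.baseChange (Grassmann q)) : bodyMap E O q y ∈ N := by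
  rw [Submodule.baseChange_eq_span] at hy
  induction hy using Submodule.span_induction with
  | mem x hx =>
    obtain ⟨v, hv, rfl⟩ := hx
    simpa [bodyMap_tmul] using hv
  | zero => simp
  | add x y _ _ hx hy => rw [map_add]; exact add_mem hx hy
  | smul a x _ hx => rw [bodyMap_smul]; exact N.smul_mem _ hx

theorem bodyMap_thetaDerivT_mem_of_mem_baseChange {N : Submodule ℂ (E × O)}
    {y : Grassmann q ⊗[ℂ] (E × O)} (hy : y ∈ N.baseChange (Grassmann q)) (j : Fin q) :
    bodyMap E O q (thetaDerivT E O q j y) ∈ N := by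
  rw [Submodule.baseChange_eq_span] at hy
  induction hy using Submodule.span_induction with
  | mem x hx =>
    obtain ⟨v, hv, rfl⟩ := hx
    simp [thetaDerivT_tmul, thetaDeriv_one]
  | zero => simp
  | add x y _ _ hx hy => rw [map_add, map_add]; exact add_mem hx hy
  | smul a x hx' hx =>
    rw [← Submodule.baseChange_eq_span] at hx'
    rw [bodyMap_thetaDerivT_smul]
    exact add_mem (N.smul_mem _ (bodyMap_mem_of_mem_baseChange hx')) (N.smul_mem _ hx)

/-- The automorphism of `𝔤` underlying an automorphism of `Λ_q ⊗ 𝔤`. -/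
def bodyAut (T : S.points q) : Module.End ℂ (E × O) :=
  bodyMap E O q ∘ₗ T.1.toLinearMap.restrictScalars ℂ ∘ₗ TensorProduct.mk ℂ (Grassmann q) (E × O) 1

theorem bodyAut_apply (T : S.points q) (v : E × O) :
    S.bodyAut T v = bodyMap E O q (T.1 (1 ⊗ₜ v)) := rfl

theorem points_tmul (T : S.points q) (a : Grassmann q) (v : E × O) :
    T.1 (a ⊗ₜ v) = a • T.1 (1 ⊗ₜ v) := by
  rw [← map_smul, TensorProduct.smul_tmul', smul_eq_mul, mul_one]

theorem bodyMap_points (T : S.points q) (w : Grassmann q ⊗[ℂ] (E × O)) :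
    bodyMap E O q (T.1 w) = S.bodyAut T (bodyMap E O q w) := by
  induction w using TensorProduct.induction_on with
  | zero => simp
  | tmul b v => rw [points_tmul, bodyMap_smul, bodyMap_tmul, map_smul, bodyAut_apply]
  | add x y hx hy => simp only [map_add, hx, hy]

theorem isUnit_bodyAut (T : S.points q) : IsUnit (S.bodyAut T) := by
  have h : ∀ T U : S.points q, S.bodyAut (T * U) = S.bodyAut T * S.bodyAut U := by
    intro T U
    refine LinearMap.ext fun v => ?_
    rw [Module.End.mul_apply, S.bodyAut_apply U, ← S.bodyMap_points]; rfl
  have h1 : S.bodyAut (1 : S.points q) = 1 := by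
    refine LinearMap.ext fun v => ?_
    rw [bodyAut_apply]
    change bodyMap E O q (1 ⊗ₜ v) = v
    rw [bodyMap_tmul, map_one, one_smul]
  exact ⟨⟨S.bodyAut T, S.bodyAut T⁻¹, by rw [← h, mul_inv_cancel, h1],
    by rw [← h, inv_mul_cancel, h1]⟩, rfl⟩

theorem bodyAut_injective (T : S.points q) : Function.Injective (S.bodyAut T) :=
  ((Module.End.isUnit_iff _).1 (S.isUnit_bodyAut T)).injective

theorem bodyAut_parity (T : S.points q) (v : E × O) :
    S.bodyAut T (parity E O v) = parity E O (S.bodyAut T v) := by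
  have := T.2.1 (1 ⊗ₜ v)
  rw [bodyAut_apply, bodyAut_apply, ← bodyMap_totalParity]
  refine Eq.trans ?_ (congrArg _ this)
  simp [totalParity, grassmannParity_one, parity]

/-- The `∂/∂θ_j` derivative at `θ = 0` of a point `T` whose logarithmic `∂/∂θ_j` derivative is `y`.
-/
theorem bodyMap_thetaDerivT_points (T : S.points q) (j : Fin q) {y : Grassmann q ⊗[ℂ] (E × O)}
    (hy : ∀ v : E × O, thetaDerivT E O q j (T.1 (1 ⊗ₜ v)) = T.1 (S.grassmannBracket q y (1 ⊗ₜ v)))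
    (w : Grassmann q ⊗[ℂ] (E × O)) :
    bodyMap E O q (thetaDerivT E O q j (T.1 w)) =
      S.bodyAut T (bodyMap E O q (thetaDerivT E O q j w) +
        S.bracket (bodyMap E O q y) (bodyMap E O q w)) := by
  induction w using TensorProduct.induction_on with
  | zero => simp
  | tmul b v =>
    rw [points_tmul, bodyMap_thetaDerivT_smul, hy, bodyMap_points, bodyMap_points,
      bodyMap_grassmannBracket, thetaDerivT_tmul, bodyMap_tmul, bodyMap_tmul, bodyMap_tmul,
      map_one, one_smul]
    simp
  | add x y hx hy => simp only [map_add, hx, hy]; abel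

/-- The odd-odd component of the Maurer-Cartan equation at `θ = 0`. -/
theorem bracket_bodyMap_mem_of_odd (hS : S.IsCenterless) {N : Submodule ℂ (E × O)} (T : S.points q)
    {j k : Fin q} {y y' : Grassmann q ⊗[ℂ] (E × O)}
    (hy : ∀ v : E × O, thetaDerivT E O q j (T.1 (1 ⊗ₜ v)) = T.1 (S.grassmannBracket q y (1 ⊗ₜ v)))
    (hy' : ∀ v : E × O,
      thetaDerivT E O q k (T.1 (1 ⊗ₜ v)) = T.1 (S.grassmannBracket q y' (1 ⊗ₜ v)))
    (hyN : y ∈ N.baseChange (Grassmann q)) (hyN' : y' ∈ N.baseChange (Grassmann q))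
    (ho : (bodyMap E O q y).1 = 0) (ho' : (bodyMap E O q y').1 = 0) :
    S.bracket (bodyMap E O q y) (bodyMap E O q y') ∈ N := by
  have key : ∀ v, S.bracket (bodyMap E O q (thetaDerivT E O q j y') +
      bodyMap E O q (thetaDerivT E O q k y) + S.bracket (bodyMap E O q y) (bodyMap E O q y')) v
      = 0 := by
    intro v
    have h1 := congrArg (bodyMap E O q) (thetaDerivT_comm j k (T.1 (1 ⊗ₜ v)))
    rw [hy, hy', map_neg, S.bodyMap_thetaDerivT_points T j hy, S.bodyMap_thetaDerivT_points T k hy',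
      thetaDerivT_grassmannBracket, thetaDerivT_grassmannBracket, bodyMap_grassmannBracket,
      bodyMap_grassmannBracket, bodyMap_grassmannBracket, bodyMap_grassmannBracket, ← map_neg] at h1
    have h2 := S.bodyAut_injective T h1
    have h3 := S.bracket_odd_odd (bodyMap E O q y).2 (bodyMap E O q y').2 v
    have e : ∀ z : E × O, z.1 = 0 → (0, z.2) = z := fun z hz => Prod.ext hz.symm rfl
    rw [e _ ho, e _ ho'] at h3
    rw [map_add, map_add, LinearMap.add_apply, LinearMap.add_apply, ← h3]
    linear_combination (norm := module) h2
  have h := hS _ key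
  rw [add_eq_zero_iff_neg_eq] at h
  rw [← h]
  exact neg_mem (add_mem (bodyMap_thetaDerivT_mem_of_mem_baseChange hyN' j)
    (bodyMap_thetaDerivT_mem_of_mem_baseChange hyN k))

/-- The logarithmic derivative in the direction of an odd coordinate has odd value at `θ = 0`, since
`∂/∂θ_j` anticommutes with parity and `𝔤` is centerless. -/
theorem parity_bodyMap_of_odd (hS : S.IsCenterless) (T : S.points q)
    {j : Fin q} {y : Grassmann q ⊗[ℂ] (E × O)}
    (hy : ∀ v : E × O, thetaDerivT E O q j (T.1 (1 ⊗ₜ v)) = T.1 (S.grassmannBracket q y (1 ⊗ₜ v))) :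
    parity E O (bodyMap E O q y) = - bodyMap E O q y := by
  have hpp : ∀ v, parity E O (parity E O v) = v := fun v => by simp [parity_apply]
  have key : ∀ v, S.bodyAut T (S.bracket (bodyMap E O q y) (parity E O v)) =
      S.bodyAut T (- parity E O (S.bracket (bodyMap E O q y) v)) := by
    intro v
    have h1 : totalParity E O q ((1 : Grassmann q) ⊗ₜ v) = 1 ⊗ₜ parity E O v := by
      simp [totalParity, grassmannParity_one, parity]
    rw [← bodyMap_grassmannBracket, ← bodyMap_points, ← hy, ← h1, T.2.1, thetaDerivT_totalParity,
      hy, map_neg, bodyMap_totalParity, bodyMap_points, bodyMap_grassmannBracket, map_neg,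
      bodyAut_parity]
  refine hS.eq_of_bracket_eq fun u => ?_
  have h2 := S.bodyAut_injective T (key (parity E O (parity E O u)))
  rw [hpp, parity_bracket, hpp] at h2
  have h3 := S.bodyAut_injective T (key (parity E O u))
  rw [parity_bracket, hpp] at h3
  rw [map_neg, LinearMap.neg_apply, h3, neg_neg]

end Body

section EndDeriv

variable {V : Type*} [AddCommGroup V] [Module ℂ V]

open Filter Topology

/-- The expansion of an endomorphism in elementary matrices. -/
theorem end_eq_sum {n : Type*} [Fintype n] [DecidableEq n] (b : Module.Basis n ℂ V)
    (X : Module.End ℂ V) :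
    X = ∑ p : n × n, b.coord p.1 (X (b p.2)) • (b.coord p.2).smulRight (b p.1) := by
  refine b.ext fun k => ?_
  simp only [LinearMap.sum_apply, LinearMap.smul_apply, LinearMap.smulRight_apply,
    Module.Basis.coord_apply, Module.Basis.repr_self, Fintype.sum_prod_type, Finsupp.single_apply,
    ite_smul, one_smul, zero_smul, smul_ite, smul_zero, Finset.sum_ite_eq, Finset.mem_univ, if_true]
  rw [b.sum_repr]

variable [FiniteDimensional ℂ V]

/-- Differentiability of matrix coefficients implies differentiability of all linear functionals. -/
theorem hasDerivAt_dual_end {T : ℂ → Module.End ℂ V} {T' : Module.End ℂ V} {z : ℂ}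
    (hT : ∀ (l : Module.Dual ℂ V) (v : V), HasDerivAt (fun s => l (T s v)) (l (T' v)) z)
    (L : Module.Dual ℂ (Module.End ℂ V)) : HasDerivAt (fun s => L (T s)) (L T') z := by
  let b := Module.finBasis ℂ V
  have h : ∀ X : Module.End ℂ V, L X = ∑ p : _ × _, b.coord p.1 (X (b p.2)) *
      L ((b.coord p.2).smulRight (b p.1)) := by
    intro X
    conv_lhs => rw [end_eq_sum b X, map_sum]
    simp only [map_smul, smul_eq_mul]
  rw [funext fun s => h (T s), h T']
  exact HasDerivAt.fun_sum fun p _ => (hT _ _).mul_const _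

/-- A family of endomorphisms whose matrix coefficients are differentiable has a derivative. -/
theorem exists_hasDerivAt_end {S : ℂ → Module.End ℂ V} {z : ℂ}
    (hS : ∀ (l : Module.Dual ℂ V) (v : V), DifferentiableAt ℂ (fun s => l (S s v)) z) :
    ∃ S' : Module.End ℂ V, ∀ (l : Module.Dual ℂ V) (v : V),
      HasDerivAt (fun s => l (S s v)) (l (S' v)) z := by
  let b := Module.finBasis ℂ V
  refine ⟨∑ p : _ × _, deriv (fun s => b.coord p.1 (S s (b p.2))) z •
    (b.coord p.2).smulRight (b p.1), fun l v => ?_⟩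
  have h : ∀ X : Module.End ℂ V, l (X v) = ∑ p : _ × _, b.coord p.1 (X (b p.2)) *
      l ((b.coord p.2).smulRight (b p.1) v) := by
    intro X
    conv_lhs => rw [end_eq_sum b X, LinearMap.sum_apply, map_sum]
    simp only [LinearMap.smul_apply, map_smul, smul_eq_mul]
  rw [funext fun s => h (S s), LinearMap.sum_apply, map_sum]
  simp only [LinearMap.smul_apply, map_smul, smul_eq_mul]
  exact HasDerivAt.fun_sum fun p _ => ((hS _ _).hasDerivAt).mul_const _

/-- `exists_mem_deriv_eq_of_eventually_mul` for endomorphisms of a finite dimensional space. -/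
theorem exists_mem_end_deriv_eq {T S A : ℂ → Module.End ℂ V} {T' S' : Module.End ℂ V}
    (W : Submodule ℂ (Module.End ℂ V))
    (hT : ∀ (l : Module.Dual ℂ V) (v : V), HasDerivAt (fun s => l (T s v)) (l (T' v)) 0)
    (hS : ∀ (l : Module.Dual ℂ V) (v : V), HasDerivAt (fun s => l (S s v)) (l (S' v)) 0)
    (hu : IsUnit (T 0)) (hA : ∀ᶠ s in 𝓝 0, S s = T s * A s ∧ A s ∈ W) :
    ∃ w ∈ W, S' = T' * A 0 + T 0 * w := by
  let n := Module.finrank ℂ V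
  let Ψ : Module.End ℂ V ≃ₐ[ℂ] ((Fin n → ℂ) →L[ℂ] (Fin n → ℂ)) :=
    ((Module.finBasis ℂ V).equivFun.conjAlgEquiv ℂ).trans
      (Module.End.toContinuousLinearMap (Fin n → ℂ))
  have hd : ∀ {T : ℂ → Module.End ℂ V} {T' : Module.End ℂ V},
      (∀ (l : Module.Dual ℂ V) (v : V), HasDerivAt (fun s => l (T s v)) (l (T' v)) 0) →
      HasDerivAt (fun s => Ψ (T s)) (Ψ T') 0 := fun h =>
    hasDerivAt_of_forall_dual fun l => hasDerivAt_dual_end h (l ∘ₗ Ψ.toLinearMap)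
  obtain ⟨w, hw, h⟩ := exists_mem_deriv_eq_of_eventually_mul (A := fun s => Ψ (A s))
    (W.map Ψ.toLinearMap) (Submodule.closed_of_finiteDimensional _) (hd hT) (hd hS) (hu.map Ψ)
    (hA.mono fun s hs => ⟨by rw [hs.1, map_mul], Submodule.mem_map_of_mem hs.2⟩)
  obtain ⟨w, hw, rfl⟩ := hw
  refine ⟨w, hw, Ψ.injective ?_⟩
  rw [h, map_add, map_mul, map_mul]; rfl

end EndDeriv

section Upper

variable {E O : Type} [LieRing E] [LieAlgebra ℂ E] [AddCommGroup O] [Module ℂ O]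
  {S : LieSuperalgebra E O}

open Filter Topology

/-- The degree `0` part in `θ` of `IsLogDeriv` for an even coordinate field. -/
theorem IsLogDeriv.hasDerivAt_bodyAut {p q : ℕ} {g : (Fin p → ℂ) → S.points q} {z : Fin p → ℂ}
    {i : Fin p} {y : Grassmann q ⊗[ℂ] (E × O)} (h : S.IsLogDeriv g z (.inl i) y)
    (l : Module.Dual ℂ (E × O)) (v : E × O) :
    HasDerivAt (fun t : ℂ => l (S.bodyAut (g (z + t • Pi.single i 1)) v))
      (l (S.bodyAut (g z) (S.bracket (bodyMap E O q y) v))) 0 := by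
  have := h v (l ∘ₗ bodyMap E O q)
  rw [LinearMap.comp_apply, bodyMap_points, bodyMap_grassmannBracket] at this
  exact this

/-- As `𝔤` is centerless, the value at `θ = 0` of a logarithmic derivative is unique. -/
theorem IsLogDeriv.bodyMap_unique (hS : S.IsCenterless) {p q : ℕ} {g : (Fin p → ℂ) → S.points q}
    {z : Fin p → ℂ} {a : Fin p ⊕ Fin q} {y y' : Grassmann q ⊗[ℂ] (E × O)}
    (h : S.IsLogDeriv g z a y) (h' : S.IsLogDeriv g z a y') :
    bodyMap E O q y = bodyMap E O q y' := by
  refine hS.eq_of_bracket_eq fun v => S.bodyAut_injective (g z) ?_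
  rcases a with i | j
  · have h0 : ∀ l : Module.Dual ℂ (E × O),
        l (S.bodyAut (g z) (S.bracket (bodyMap E O q y) v)) =
          l (S.bodyAut (g z) (S.bracket (bodyMap E O q y') v)) := fun l =>
      (h.hasDerivAt_bodyAut l v).unique (h'.hasDerivAt_bodyAut l v)
    exact (Module.forall_dual_apply_eq_zero_iff ℂ _).1 (fun l => by
      rw [map_sub, sub_eq_zero]; exact h0 l) |> sub_eq_zero.1
  · have h0 := (h v).symm.trans (h' v)
    have := congrArg (bodyMap E O q) h0
    rwa [bodyMap_points, bodyMap_points, bodyMap_grassmannBracket, bodyMap_grassmannBracket] at this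

/-- The logarithmic derivative in the direction of an even coordinate has even value at `θ = 0`. -/
theorem IsLogDeriv.parity_bodyMap (hS : S.IsCenterless) {p q : ℕ} {g : (Fin p → ℂ) → S.points q}
    {z : Fin p → ℂ} {i : Fin p} {y : Grassmann q ⊗[ℂ] (E × O)} (h : S.IsLogDeriv g z (.inl i) y) :
    parity E O (bodyMap E O q y) = bodyMap E O q y := by
  have hpp : ∀ v, parity E O (parity E O v) = v := fun v => by simp [parity_apply]
  refine hS.eq_of_bracket_eq fun u => S.bodyAut_injective (g z) ?_
  refine sub_eq_zero.1 ((Module.forall_dual_apply_eq_zero_iff ℂ _).1 fun l => ?_)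
  rw [map_sub, sub_eq_zero]
  have h1 := h.hasDerivAt_bodyAut (l ∘ₗ parity E O) (parity E O u)
  have h2 := h.hasDerivAt_bodyAut l u
  simp only [LinearMap.comp_apply, ← bodyAut_parity, parity_bracket, hpp] at h1
  exact h1.unique h2

variable [FiniteDimensional ℂ E] [FiniteDimensional ℂ O]

/-- The even-odd component of the Maurer-Cartan equation at `θ = 0`. -/
theorem bracket_bodyMap_mem_of_even_odd (hS : S.IsCenterless) {p q : ℕ} {N : Submodule ℂ (E × O)}
    {g : (Fin p → ℂ) → S.points q} {U : Set (Fin p → ℂ)} (hU : IsOpen U) {z : Fin p → ℂ}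
    (hz : z ∈ U) (y : (Fin p → ℂ) → Fin p ⊕ Fin q → Grassmann q ⊗[ℂ] (E × O))
    (hy : ∀ z ∈ U, ∀ a, y z a ∈ N.baseChange (Grassmann q) ∧ S.IsLogDeriv g z a (y z a))
    (i : Fin p) (j : Fin q) :
    S.bracket (bodyMap E O q (y z (.inl i))) (bodyMap E O q (y z (.inr j))) ∈ N := by
  let T : ℂ → Module.End ℂ (E × O) := fun s => S.bodyAut (g (z + s • Pi.single i 1))
  let R : ℂ → Module.End ℂ (E × O) := fun s => bodyMap E O q ∘ₗ thetaDerivT E O q j ∘ₗ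
    (g (z + s • Pi.single i 1)).1.toLinearMap.restrictScalars ℂ ∘ₗ
      TensorProduct.mk ℂ (Grassmann q) (E × O) 1
  let A : ℂ → Module.End ℂ (E × O) :=
    fun s => S.bracket (bodyMap E O q (y (z + s • Pi.single i 1) (.inr j)))
  have hz0 : z + (0 : ℂ) • (Pi.single i 1 : Fin p → ℂ) = z := by simp
  have hy1 := (hy z hz (.inl i)).2
  have hy2 : ∀ v : E × O, thetaDerivT E O q j ((g z).1 (1 ⊗ₜ v)) =
    (g z).1 (S.grassmannBracket q (y z (.inr j)) (1 ⊗ₜ v)) := (hy z hz (.inr j)).2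
  have hev : ∀ᶠ s in 𝓝 (0 : ℂ), z + s • (Pi.single i 1 : Fin p → ℂ) ∈ U := by
    have hc : Continuous fun s : ℂ => z + s • (Pi.single i 1 : Fin p → ℂ) := by fun_prop
    refine hc.continuousAt.eventually_mem ?_
    rw [hz0]; exact hU.mem_nhds hz
  -- `R` is `∂/∂θⱼ T` at `θ = 0`, hence `R = T A` with `A = ad yⱼ`, and `∂ᵢ R` is known
  obtain ⟨w, ⟨n, hn, rfl⟩, hw⟩ := exists_mem_end_deriv_eq (T := T) (S := R) (A := A)
    (T' := T 0 * S.bracket (bodyMap E O q (y z (.inl i))))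
    (S' := T 0 * (S.bracket (bodyMap E O q (thetaDerivT E O q j (y z (.inl i)))) +
      A 0 * S.bracket (bodyMap E O q (y z (.inl i)))))
    (N.map S.bracket)
    (fun l v => by
      simp only [T, hz0]
      exact hy1.hasDerivAt_bodyAut l v)
    (fun l v => by
      have := hy1 v (l ∘ₗ bodyMap E O q ∘ₗ thetaDerivT E O q j)
      simp only [LinearMap.comp_apply] at this
      rw [bodyMap_thetaDerivT_points S _ _ hy2, thetaDerivT_grassmannBracket,
        bodyMap_grassmannBracket, bodyMap_grassmannBracket] at this
      simp only [T, A, hz0]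
      exact this)
    (S.isUnit_bodyAut _)
    (hev.mono fun s hs => ⟨LinearMap.ext fun v => by
        have h1 : ∀ v : E × O, thetaDerivT E O q j ((g (z + s • Pi.single i 1)).1 (1 ⊗ₜ v)) =
          (g (z + s • Pi.single i 1)).1
            (S.grassmannBracket q (y (z + s • Pi.single i 1) (.inr j)) (1 ⊗ₜ v)) :=
          (hy _ hs (.inr j)).2
        change bodyMap E O q (thetaDerivT E O q j ((g (z + s • Pi.single i 1)).1 (1 ⊗ₜ v))) = _
        rw [h1, bodyMap_points, bodyMap_grassmannBracket]; rfl,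
      Submodule.mem_map_of_mem (bodyMap_mem_of_mem_baseChange (hy _ hs _).1)⟩)
  have hA0 : A 0 = S.bracket (bodyMap E O q (y z (.inr j))) := by simp only [A, hz0]
  have he : (bodyMap E O q (y z (.inl i))) = ((bodyMap E O q (y z (.inl i))).1, 0) := by
    have := congrArg Prod.snd (hy1.parity_bodyMap hS)
    rw [parity_apply] at this
    exact Prod.ext rfl (eq_zero_of_eq_neg this.symm)
  have key : S.bracket (bodyMap E O q (y z (.inl i))) (bodyMap E O q (y z (.inr j))) =
      bodyMap E O q (thetaDerivT E O q j (y z (.inl i))) - n := by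
    refine hS.eq_of_bracket_eq fun u => ?_
    rw [mul_assoc, ← mul_add] at hw
    have h1 := S.bodyAut_injective _ (LinearMap.congr_fun hw u)
    rw [hA0] at h1
    simp only [LinearMap.add_apply, Module.End.mul_apply] at h1
    have h2 := S.bracket_even_leibniz (bodyMap E O q (y z (.inl i))).1
      (bodyMap E O q (y z (.inr j))) u
    rw [← he] at h2
    rw [map_sub, LinearMap.sub_apply]
    linear_combination (norm := module) -h1 - h2
  rw [key]
  exact sub_mem (bodyMap_thetaDerivT_mem_of_mem_baseChange (hy z hz _).1 j) hn

/-- The even-even component of the Maurer-Cartan equation at `θ = 0`. -/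
theorem bracket_bodyMap_mem_of_even_even (hS : S.IsCenterless) {p q : ℕ}
    {N : Submodule ℂ (E × O)}
    {g : (Fin p → ℂ) → S.points q} {U : Set (Fin p → ℂ)} (hU : IsOpen U) {z : Fin p → ℂ}
    (hz : z ∈ U) (y : (Fin p → ℂ) → Fin p ⊕ Fin q → Grassmann q ⊗[ℂ] (E × O))
    (hy : ∀ z ∈ U, ∀ a, y z a ∈ N.baseChange (Grassmann q) ∧ S.IsLogDeriv g z a (y z a))
    (hg : ∀ (v : E × O) (l : Module.Dual ℂ (Grassmann q ⊗[ℂ] (E × O))),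
      DifferentiableOn ℂ (fun z => l ((g z).1 (1 ⊗ₜ v))) U)
    (i j : Fin p) :
    S.bracket (bodyMap E O q (y z (.inl i))) (bodyMap E O q (y z (.inl j))) ∈ N := by
  let T : Fin p → ℂ → Module.End ℂ (E × O) := fun i s => S.bodyAut (g (z + s • Pi.single i 1))
  let A : Fin p → Fin p → ℂ → Module.End ℂ (E × O) :=
    fun i j s => S.bracket (bodyMap E O q (y (z + s • Pi.single i 1) (.inl j)))
  have hz0 : ∀ i, z + (0 : ℂ) • (Pi.single i 1 : Fin p → ℂ) = z := by simp
  have hev : ∀ i, ∀ᶠ s in 𝓝 (0 : ℂ), z + s • (Pi.single i 1 : Fin p → ℂ) ∈ U := by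
    intro i
    have hc : Continuous fun s : ℂ => z + s • (Pi.single i 1 : Fin p → ℂ) := by fun_prop
    refine hc.continuousAt.eventually_mem ?_
    rw [hz0]; exact hU.mem_nhds hz
  let f : Fin p → Fin p → Module.Dual ℂ (E × O) → E × O → ℂ → ℂ → ℂ := fun i j l v s t =>
    l (S.bodyAut (g (z + s • Pi.single i 1 + t • Pi.single j 1)) v)
  have hfd : ∀ i j l v, ∀ᶠ p in 𝓝 (0 : ℂ × ℂ),
      DifferentiableAt ℂ (fun p : ℂ × ℂ => f i j l v p.1 p.2) p := by
    intro i j l v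
    have hc : Differentiable ℂ fun r : ℂ × ℂ =>
      z + r.1 • (Pi.single i 1 : Fin p → ℂ) + r.2 • (Pi.single j 1 : Fin p → ℂ) := by fun_prop
    have hmem : ∀ᶠ r in 𝓝 (0 : ℂ × ℂ),
        z + r.1 • (Pi.single i 1 : Fin p → ℂ) + r.2 • (Pi.single j 1 : Fin p → ℂ) ∈ U := by
      refine hc.continuous.continuousAt.eventually_mem ?_
      simpa using hU.mem_nhds hz
    filter_upwards [hmem] with r hr
    have h1 := (hg v (l ∘ₗ bodyMap E O q)).differentiableAt (hU.mem_nhds hr)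
    exact DifferentiableAt.comp (g := fun z => (l ∘ₗ bodyMap E O q) ((g z).1 (1 ⊗ₜ v))) r h1
      hc.differentiableAt
  -- `∂ⱼ T = T [yⱼ, ·]` along the line in the direction `i`, and the same with `i`, `j` exchanged
  have hder : ∀ i j l v, ∀ᶠ s in 𝓝 (0 : ℂ), deriv (f i j l v s) 0 = l ((T i s * A i j s) v) := by
    intro i j l v
    filter_upwards [hev i] with s hs
    exact ((hy _ hs (.inl j)).2.hasDerivAt_bodyAut l v).deriv
  have hder' : ∀ i j l v, ∀ᶠ t in 𝓝 (0 : ℂ),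
      deriv (fun s => f i j l v s t) 0 = l ((T j t * A j i t) v) := by
    intro i j l v
    have e : ∀ s t, f i j l v s t = f j i l v t s := fun s t => by
      simp only [f, add_right_comm]
    simp only [e]
    exact hder j i l v
  have hmain : ∀ i j (l : Module.Dual ℂ (E × O)) (v : E × O),
      HasDerivAt (fun s => l ((T i s * A i j s) v))
        (deriv (fun t => l ((T j t * A j i t) v)) 0) 0 := by
    intro i j l v
    have h := hasDerivAt_deriv_comm (hfd i j l v)
    rw [Filter.EventuallyEq.deriv_eq (hder' i j l v)] at h
    exact h.congr_of_eventuallyEq ((hder i j l v).mono fun s hs => hs.symm)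
  -- `R` is the mixed derivative `∂ᵢ ∂ⱼ T`, which is computed in the two possible orders below
  obtain ⟨R, hR⟩ := exists_hasDerivAt_end (S := fun s => T i s * A i j s)
    fun l v => (hmain i j l v).differentiableAt
  have hR' : ∀ (l : Module.Dual ℂ (E × O)) (v : E × O),
      HasDerivAt (fun s => l ((T j s * A j i s) v)) (l (R v)) 0 := by
    intro l v
    have := hmain j i l v
    rwa [(hR l v).deriv] at this
  have hstep : ∀ i j, (∀ (l : Module.Dual ℂ (E × O)) (v : E × O),
      HasDerivAt (fun s => l ((T i s * A i j s) v)) (l (R v)) 0) →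
      ∃ n ∈ N, R = S.bodyAut (g z) * (S.bracket (bodyMap E O q (y z (.inl i))) *
        S.bracket (bodyMap E O q (y z (.inl j))) + S.bracket n) := by
    intro i j hR
    obtain ⟨w, ⟨n, hn, rfl⟩, hw⟩ := exists_mem_end_deriv_eq (T := T i) (A := A i j)
      (T' := T i 0 * S.bracket (bodyMap E O q (y z (.inl i)))) (N.map S.bracket)
      (fun l v => by
        simp only [T, hz0]
        exact (hy z hz (.inl i)).2.hasDerivAt_bodyAut l v) hR
      (S.isUnit_bodyAut _)
      ((hev i).mono fun s hs => ⟨rfl,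
        Submodule.mem_map_of_mem (bodyMap_mem_of_mem_baseChange (hy _ hs _).1)⟩)
    refine ⟨n, hn, ?_⟩
    rw [hw, mul_add, mul_assoc]
    simp only [T, A, hz0]
  obtain ⟨n, hn, h1⟩ := hstep i j hR
  obtain ⟨m, hm, h2⟩ := hstep j i hR'
  have he : (bodyMap E O q (y z (.inl i))) = ((bodyMap E O q (y z (.inl i))).1, 0) := by
    have := congrArg Prod.snd ((hy z hz (.inl i)).2.parity_bodyMap hS)
    rw [parity_apply] at this
    exact Prod.ext rfl (eq_zero_of_eq_neg this.symm)
  have key : S.bracket (bodyMap E O q (y z (.inl i))) (bodyMap E O q (y z (.inl j))) = m - n := by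
    refine hS.eq_of_bracket_eq fun u => ?_
    have h3 := S.bodyAut_injective _ (LinearMap.congr_fun (h1.symm.trans h2) u)
    simp only [LinearMap.add_apply, Module.End.mul_apply] at h3
    have h4 := S.bracket_even_leibniz (bodyMap E O q (y z (.inl i))).1
      (bodyMap E O q (y z (.inl j))) u
    rw [← he] at h4
    rw [map_sub, LinearMap.sub_apply]
    linear_combination (norm := module) h3 - h4
  rw [key]
  exact sub_mem hm hn

/-- The degree `-1` parts of the tangent vectors of a nondegenerate integral submanifold span an
abelian subspace of `𝔤_{-1}`. -/
theorem isAbelianDim_of_mem_integralDims (hS : S.IsCenterless) {Z : E} {d : ℕ × ℕ}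
    (hd : d ∈ S.integralDims Z) : S.IsAbelianDim Z d.1 d.2 := by
  obtain ⟨φ, hint, hnd⟩ := hd
  obtain ⟨x, hx⟩ := φ.nonempty_domain
  have hU := φ.isOpen_nhd x hx
  have hxU := φ.mem_nhd x hx
  have hy' : ∀ z a, ∃ y, z ∈ φ.nhd x → y ∈ (S.fil Z (-1)).baseChange (Grassmann d.2) ∧
      S.IsLogDeriv (φ.lift x) z a y := by
    intro z a
    by_cases hz : z ∈ φ.nhd x
    · obtain ⟨y, h⟩ := hint x hx z hz a
      exact ⟨y, fun _ => h⟩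
    · exact ⟨0, fun h => absurd h hz⟩
  choose y hy0 using hy'
  have hy : ∀ z ∈ φ.nhd x, ∀ a, y z a ∈ (S.fil Z (-1)).baseChange (Grassmann d.2) ∧
      S.IsLogDeriv (φ.lift x) z a (y z a) := fun z hz a => hy0 z a hz
  have hodd : ∀ j, parity E O (bodyMap E O d.2 (y x (.inr j))) =
      -bodyMap E O d.2 (y x (.inr j)) := fun j =>
    S.parity_bodyMap_of_odd hS _ (hy x hxU (.inr j)).2
  have hodd0 : ∀ j, (bodyMap E O d.2 (y x (.inr j))).1 = 0 := fun j => by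
    have := congrArg Prod.fst (hodd j)
    rw [parity_apply] at this
    exact eq_zero_of_eq_neg this
  have hmix := bracket_bodyMap_mem_of_even_odd hS hU hxU y hy
  refine S.isAbelianDim_of_bracket_mem (fun a => bodyMap E O d.2 (y x a))
    (fun a => bodyMap_mem_of_mem_baseChange (hy x hxU a).1)
    (fun i => (hy x hxU (.inl i)).2.parity_bodyMap hS) hodd ?_ ?_
  · rintro (i | j) (i' | j')
    · exact bracket_bodyMap_mem_of_even_even hS hU hxU y hy (φ.holomorphic x hx) i i'
    · exact hmix i j'
    · have h := hmix i' j
      have e : S.bracket (bodyMap E O d.2 (y x (.inr j))) (bodyMap E O d.2 (y x (.inl i'))) =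
          - S.bracket (bodyMap E O d.2 (y x (.inl i'))) (bodyMap E O d.2 (y x (.inr j))) := by
        have h0 : (bodyMap E O d.2 (y x (.inl i'))).2 = 0 := by
          have := congrArg Prod.snd ((hy x hxU (.inl i')).2.parity_bodyMap hS)
          rw [parity_apply] at this
          exact eq_zero_of_eq_neg this.symm
        refine Prod.ext ?_ ?_ <;> simp [bracket_apply, hodd0, h0]
      rw [e]
      exact neg_mem h
    · exact S.bracket_bodyMap_mem_of_odd hS _ (hy x hxU (.inr j)).2 (hy x hxU (.inr j')).2
        (hy x hxU _).1 (hy x hxU _).1 (hodd0 j) (hodd0 j')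
  · obtain ⟨y', hy', hli⟩ := hnd x hx x hxU
    convert hli using 3 with a
    exact (hy x hxU a).2.bodyMap_unique hS (hy' a)

end Upper

end LieSuperalgebra

/-! ### Integral submanifolds from abelian subspaces -/

namespace LieSuperalgebra

section Exp

variable {V : Type*} [AddCommGroup V] [Module ℂ V] [Module ℚ (Module.End ℂ V)]

theorem exp_end_eq_sum {N : Module.End ℂ V} {K : ℕ} (h : N ^ K = 0) :
    IsNilpotent.exp N = ∑ k ∈ Finset.range K, ((k.factorial : ℂ))⁻¹ • N ^ k := by
  rw [IsNilpotent.exp_eq_sum h]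
  exact Finset.sum_congr rfl fun k _ => inv_natCast_smul_eq ℚ ℂ _ _

theorem commute_exp_end {N X : Module.End ℂ V} (hN : IsNilpotent N) (h : Commute X N) :
    Commute X (IsNilpotent.exp N) := by
  obtain ⟨K, hK⟩ := hN
  rw [exp_end_eq_sum hK]
  exact Commute.sum_right _ _ _ fun k _ => (h.pow_right k).smul_right _

/-- If `∂ N = N ∂ + Q` with `Q` commuting with `N`, then `∂ exp N = exp N (∂ + Q)`. -/
theorem mul_exp_end_of_commutator {N D Q : Module.End ℂ V} (hN : IsNilpotent N)
    (hD : D * N = N * D + Q) (hQ : Commute Q N) :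
    D * IsNilpotent.exp N = IsNilpotent.exp N * D + IsNilpotent.exp N * Q := by
  obtain ⟨K, hK⟩ := hN
  have hK1 : N ^ (K + 1) = 0 := by rw [pow_succ, hK, zero_mul]
  have hpow : ∀ k : ℕ, D * N ^ (k + 1) = N ^ (k + 1) * D + ((k + 1 : ℕ) : ℂ) • (N ^ k * Q) := by
    intro k
    induction k with
    | zero => simp [hD]
    | succ k ih =>
      have h1 : N ^ k * Q * N = N ^ (k + 1) * Q := by
        rw [mul_assoc, hQ.eq, ← mul_assoc, ← pow_succ]
      rw [pow_succ N (k + 1), ← mul_assoc, ih, add_mul, smul_mul_assoc, h1,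
        mul_assoc (N ^ (k + 1)) D N, hD, mul_add, ← mul_assoc]
      push_cast
      module
  conv_lhs => rw [exp_end_eq_sum hK1]
  nth_rewrite 1 [exp_end_eq_sum hK1]
  rw [exp_end_eq_sum hK, Finset.mul_sum, Finset.sum_mul, Finset.sum_mul, Finset.sum_range_succ',
    Finset.sum_range_succ', add_right_comm, ← Finset.sum_add_distrib]
  congr 1
  · refine Finset.sum_congr rfl fun k _ => ?_
    rw [mul_smul_comm, hpow, smul_add, smul_mul_assoc, smul_mul_assoc, smul_smul]
    congr 2
    rw [Nat.factorial_succ]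
    have h1 : ((k + 1 : ℕ) : ℂ) ≠ 0 := Nat.cast_ne_zero.2 (Nat.succ_ne_zero k)
    push_cast at h1 ⊢
    field_simp
  · simp

/-- `exp (z N)` has the derivative `N` at `z = 0`. -/
theorem hasDerivAt_exp_smul {N : Module.End ℂ V} (hN : IsNilpotent N) (l : Module.Dual ℂ V)
    (v : V) : HasDerivAt (fun t : ℂ => l (IsNilpotent.exp (t • N) v)) (l (N v)) 0 := by
  obtain ⟨K, hK⟩ := hN
  have hK2 : N ^ (K + 2) = 0 := by rw [pow_add, hK, zero_mul]
  have e : ∀ t : ℂ, l (IsNilpotent.exp (t • N) v) =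
      ∑ k ∈ Finset.range (K + 2), t ^ k * (((k.factorial : ℂ))⁻¹ * l ((N ^ k) v)) := by
    intro t
    have : (t • N) ^ (K + 2) = 0 := by rw [smul_pow, hK2, smul_zero]
    rw [exp_end_eq_sum this, LinearMap.sum_apply, map_sum]
    refine Finset.sum_congr rfl fun k _ => ?_
    rw [smul_pow, LinearMap.smul_apply, LinearMap.smul_apply, map_smul, map_smul, smul_eq_mul,
      smul_eq_mul]
    ring
  rw [funext e]
  have h := HasDerivAt.fun_sum (u := Finset.range (K + 2)) (x := (0 : ℂ))
    (A := fun k t => t ^ k * (((k.factorial : ℂ))⁻¹ * l ((N ^ k) v)))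
    (A' := fun k => ((k : ℂ) * 0 ^ (k - 1)) * (((k.factorial : ℂ))⁻¹ * l ((N ^ k) v)))
    fun k _ => (hasDerivAt_pow k 0).mul_const _
  rw [Finset.sum_eq_single 1 _ (by simp)] at h
  · simpa using h
  · intro k _ hk
    rcases k with _ | _ | k
    · simp
    · exact absurd rfl hk
    · simp

/-- `Module.End.exp_mul_of_derivation` with the exponential written as a sum over `ℂ`, which does
not depend on the `ℚ`-module structure of the endomorphisms. -/
theorem exp_sum_mul_of_derivation {B : Type*} [NonUnitalNonAssocRing B] [Module ℂ B]
    [SMulCommClass ℂ B B] [IsScalarTower ℂ B B] [Module ℚ B] (D : B →ₗ[ℂ] B)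
    (hD : ∀ x y, D (x * y) = x * D y + D x * y) {K : ℕ} (hK : D ^ K = 0) (x y : B) :
    (∑ k ∈ Finset.range K, ((k.factorial : ℂ))⁻¹ • D ^ k : Module.End ℂ B) (x * y) =
      (∑ k ∈ Finset.range K, ((k.factorial : ℂ))⁻¹ • D ^ k : Module.End ℂ B) x *
        (∑ k ∈ Finset.range K, ((k.factorial : ℂ))⁻¹ • D ^ k : Module.End ℂ B) y := by
  rw [← exp_end_eq_sum hK]
  exact Module.End.exp_mul_of_derivation ℂ B D hD ⟨K, hK⟩ x y

/-- The exponential of a nilpotent derivation of a bilinear product preserves the product. -/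
theorem exp_bilin_of_derivation [Module ℚ V] (B : V →ₗ[ℂ] V →ₗ[ℂ] V) {D : Module.End ℂ V}
    (hD : ∀ x y, D (B x y) = B (D x) y + B x (D y)) (hn : IsNilpotent D) (x y : V) :
    IsNilpotent.exp D (B x y) = B (IsNilpotent.exp D x) (IsNilpotent.exp D y) := by
  obtain ⟨K, hK⟩ := hn
  rw [exp_end_eq_sum hK]
  let i : NonUnitalNonAssocRing V :=
    { (inferInstance : AddCommGroup V) with
      mul := fun a b => B a b
      left_distrib := fun a b c => map_add (B a) b c
      right_distrib := fun a b c => by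
        change B (a + b) c = B a c + B b c
        rw [map_add, LinearMap.add_apply]
      zero_mul := fun a => by change B 0 a = 0; simp
      mul_zero := fun a => by change B a 0 = 0; simp }
  have h1 : SMulCommClass ℂ V V := ⟨fun c a b => by
    change c • B a b = B a (c • b); rw [map_smul]⟩
  have h2 : IsScalarTower ℂ V V := ⟨fun c a b => by
    change B (c • a) b = c • B a b; rw [map_smul, LinearMap.smul_apply]⟩
  exact @exp_sum_mul_of_derivation V i _ h1 h2 _ D (fun x y => by
    change D (B x y) = B x (D y) + B (D x) y
    rw [hD, add_comm]) K hK x y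

end Exp

section Ad

variable {E O : Type} [LieRing E] [LieAlgebra ℂ E] [AddCommGroup O] [Module ℂ O]
  (S : LieSuperalgebra E O)

/-- Elements of degree `-1` are `ad`-nilpotent: the powers of `ad w` are eigenvectors of `ad (ad Z)`
with distinct eigenvalues. -/
theorem isNilpotent_bracket [FiniteDimensional ℂ E] [FiniteDimensional ℂ O] {Z : E} {w : E × O}
    (hw : w ∈ S.gr Z (-1)) : IsNilpotent (S.bracket w : Module.End ℂ (E × O)) := by
  by_contra hn
  let N : Module.End ℂ (E × O) := S.bracket w
  let D : Module.End ℂ (E × O) := S.bracket (Z, 0)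
  have hDN : D * N - N * D = (-1 : ℂ) • N := by
    refine LinearMap.ext fun v => ?_
    have := S.bracket_even_leibniz Z w v
    rw [S.mem_gr.1 hw] at this
    simp only [D, N, Module.End.mul_apply, LinearMap.sub_apply, LinearMap.smul_apply]
    rw [this]
    simp
  let 𝒟 : Module.End ℂ (Module.End ℂ (E × O)) := LinearMap.mulLeft ℂ D - LinearMap.mulRight ℂ D
  have hpow : ∀ k : ℕ, D * N ^ k - N ^ k * D = (-(k : ℂ)) • N ^ k := by
    intro k
    induction k with
    | zero => simp
    | succ k ih =>
      have e : D * N ^ (k + 1) - N ^ (k + 1) * D =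
          (D * N ^ k - N ^ k * D) * N + N ^ k * (D * N - N * D) := by
        simp only [pow_succ, sub_mul, mul_sub, mul_assoc]
        abel
      rw [e, ih, hDN, mul_smul_comm, ← pow_succ, smul_mul_assoc, ← pow_succ]
      push_cast
      module
  have hli := Module.End.eigenvectors_linearIndependent' 𝒟 (fun k : ℕ => (-(k : ℂ)))
    (fun a b h => by simpa using h) (fun k => N ^ k) fun k =>
      ⟨Module.End.mem_eigenspace_iff.2 (hpow k), fun h => hn ⟨k, h⟩⟩
  exact not_finite_iff_infinite.2 inferInstance hli.finite

variable {q : ℕ}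

/-- The operator `b ⊗ v ↦ b c ⊗ [w, v]` on `Λ_q ⊗ 𝔤`; it is the bracket with `c ⊗ w` if `c` and `w`
have the same parity. -/
def adOp (c : Grassmann q) (w : E × O) : Module.End ℂ (Grassmann q ⊗[ℂ] (E × O)) :=
  TensorProduct.map (LinearMap.mulRight ℂ c) (S.bracket w)

theorem adOp_tmul (c b : Grassmann q) (w v : E × O) :
    S.adOp c w (b ⊗ₜ v) = (b * c) ⊗ₜ S.bracket w v := rfl

theorem adOp_smul (c a : Grassmann q) (w : E × O) (u : Grassmann q ⊗[ℂ] (E × O)) :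
    S.adOp c w (a • u) = a • S.adOp c w u := by
  induction u using TensorProduct.induction_on with
  | zero => simp
  | tmul b v => simp only [TensorProduct.smul_tmul', smul_eq_mul, adOp_tmul, mul_assoc]
  | add x y hx hy => simp only [smul_add, map_add, hx, hy]

theorem isNilpotent_adOp {w : E × O} (hw : IsNilpotent (S.bracket w : Module.End ℂ (E × O)))
    (c : Grassmann q) : IsNilpotent (S.adOp c w) := by
  obtain ⟨K, hK⟩ := hw
  refine ⟨K, ?_⟩
  rw [adOp, TensorProduct.map_pow, hK, TensorProduct.map_zero_right]

theorem grassmannBracket_tmul (b b' : Grassmann q) (x x' : E × O) :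
    S.grassmannBracket q (b ⊗ₜ x) (b' ⊗ₜ x') = (b * b') ⊗ₜ S.bracket (x.1, 0) x' +
      (b * grassmannParity q b') ⊗ₜ S.bracket (0, x.2) x' := by
  simp only [grassmannBracket, LinearMap.add_apply, TensorProduct.map₂_apply_tmul,
    TensorProduct.map_tmul, LinearMap.mul_apply', LinearMap.compl₂_apply, LinearMap.comp_apply,
    evenProj_apply, oddProj_apply]

/-- The bracket with `1 ⊗ w` for odd `w`. -/
theorem grassmannBracket_odd_tmul (o : O) (b : Grassmann q) (v : E × O) :
    S.grassmannBracket q (1 ⊗ₜ (0, o)) (b ⊗ₜ v) = grassmannParity q b ⊗ₜ S.bracket (0, o) v := by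
  have h : S.bracket ((0 : E), (0 : O)) v = 0 := by rw [Prod.mk_zero_zero, map_zero]; rfl
  rw [grassmannBracket_tmul, one_mul, one_mul, h, TensorProduct.tmul_zero, zero_add]

/-- The pairs `(c, w)` for which `c ⊗ w` is an even element of `Λ_q ⊗ 𝔤`, of the two kinds needed
to write down submanifolds: `1 ⊗ e` and `θ_j ⊗ o`. -/
inductive IsEvenGen : Grassmann q → E × O → Prop
  | even (e : E) : IsEvenGen 1 (e, 0)
  | odd (j : Fin q) (o : O) : IsEvenGen (theta q j) (0, o)

theorem adOp_derivation {c : Grassmann q} {w : E × O} (h : IsEvenGen c w)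
    (u u' : Grassmann q ⊗[ℂ] (E × O)) : S.adOp c w (S.grassmannBracket q u u') =
      S.grassmannBracket q (S.adOp c w u) u' + S.grassmannBracket q u (S.adOp c w u') := by
  induction u using TensorProduct.induction_on with
  | zero => simp
  | add x y hx hy => simp only [map_add, LinearMap.add_apply, hx, hy]; abel
  | tmul b x =>
    induction u' using TensorProduct.induction_on with
    | zero => simp
    | add x y hx hy => simp only [map_add, LinearMap.add_apply, hx, hy]; abel
    | tmul b' x' =>
      simp only [grassmannBracket_tmul, adOp_tmul, map_add]
      cases h with
      | even e =>
        have h1 : ((S.bracket (e, 0) x).1, (0 : O)) = S.bracket (e, 0) (x.1, 0) := by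
          simp [bracket_apply]
        have h2 : ((0 : E), (S.bracket (e, 0) x).2) = S.bracket (e, 0) (0, x.2) := by
          simp [bracket_apply]
        rw [h1, h2, S.bracket_even_leibniz e (x.1, 0), S.bracket_even_leibniz e (0, x.2)]
        simp only [mul_one, TensorProduct.tmul_add]
        abel
      | odd j o =>
        have h1 : ((S.bracket (0, o) x).1, (0 : O)) = S.bracket (0, o) (0, x.2) := by
          simp [bracket_apply]
        have h2 : ((0 : E), (S.bracket (0, o) x).2) = S.bracket (0, o) (x.1, 0) := by
          simp [bracket_apply]
        have h3 := S.bracket_odd_odd o x.2 x'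
        rw [h1, h2, S.bracket_odd_leibniz o x.1, ← h3, grassmannParity_mul, grassmannParity_theta]
        simp only [mul_assoc, theta_mul, grassmannParity_grassmannParity, mul_neg,
          TensorProduct.tmul_add, TensorProduct.neg_tmul]
        abel

theorem adOp_totalParity {c : Grassmann q} {w : E × O} (h : IsEvenGen c w)
    (u : Grassmann q ⊗[ℂ] (E × O)) :
    S.adOp c w (totalParity E O q u) = totalParity E O q (S.adOp c w u) := by
  induction u using TensorProduct.induction_on with
  | zero => simp
  | add x y hx hy => simp only [map_add, hx, hy]
  | tmul b x =>
    have ht : ∀ (b : Grassmann q) (x : E × O),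
      totalParity E O q (b ⊗ₜ x) = grassmannParity q b ⊗ₜ parity E O x := fun _ _ => rfl
    rw [adOp_tmul, ht, ht, adOp_tmul, parity_bracket, grassmannParity_mul]
    cases h with
    | even e => simp [grassmannParity_one, parity_apply]
    | odd j o =>
      have : parity E O ((0, o) : E × O) = -(0, o) := by simp [parity_apply]
      rw [grassmannParity_theta, this, map_neg, LinearMap.neg_apply, mul_neg,
        TensorProduct.neg_tmul, TensorProduct.tmul_neg, neg_neg]

/-- The operators of even elements `c ⊗ w`, `c' ⊗ w'` commute if `[w, w']` vanishes. -/
theorem adOp_commute {c c' : Grassmann q} {w w' : E × O} (h : IsEvenGen c w)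
    (h' : IsEvenGen c' w') (hww : S.bracket w w' = 0) : Commute (S.adOp c w) (S.adOp c' w') := by
  refine TensorProduct.ext' fun b v => ?_
  simp only [Module.End.mul_apply, adOp_tmul, mul_assoc]
  cases h with
  | even e =>
    have := S.bracket_even_leibniz e w' v
    rw [hww] at this
    rw [this]
    simp
  | odd j o =>
    cases h' with
    | even e =>
      have := S.bracket_odd_leibniz o e v
      rw [hww] at this
      rw [this]
      simp
    | odd k o' =>
      have := S.bracket_odd_odd o o' v
      rw [hww, map_zero, LinearMap.zero_apply, add_eq_zero_iff_eq_neg] at this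
      rw [this, theta_mul, grassmannParity_theta, neg_mul, mul_neg, TensorProduct.neg_tmul,
        TensorProduct.tmul_neg, neg_neg]

theorem grassmannBracket_odd_commute {c : Grassmann q} {w : E × O} (h : IsEvenGen c w) (o : O)
    (hww : S.bracket (0, o) w = 0) :
    Commute (S.grassmannBracket q (1 ⊗ₜ (0, o)) : Module.End ℂ _) (S.adOp c w) := by
  refine TensorProduct.ext' fun b v => ?_
  simp only [Module.End.mul_apply, adOp_tmul, grassmannBracket_odd_tmul, grassmannParity_mul]
  cases h with
  | even e =>
    have := S.bracket_odd_leibniz o e v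
    rw [hww] at this
    rw [this, grassmannParity_one]
    simp
  | odd k o' =>
    have := S.bracket_odd_odd o o' v
    rw [hww, map_zero, LinearMap.zero_apply, add_eq_zero_iff_eq_neg] at this
    rw [this, grassmannParity_theta, mul_neg, TensorProduct.neg_tmul,
      TensorProduct.tmul_neg, neg_neg]

theorem thetaDerivT_adOp_even (j : Fin q) (e : E) :
    (thetaDerivT E O q j : Module.End ℂ _) * S.adOp 1 (e, 0) =
      S.adOp 1 (e, 0) * thetaDerivT E O q j := by
  refine TensorProduct.ext' fun b v => ?_
  simp only [Module.End.mul_apply, adOp_tmul, thetaDerivT_tmul, mul_one]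

/-- The commutator of `∂/∂θ_j` and the bracket with `θ_k ⊗ o` is `δ_{jk}` times the bracket with `1
⊗ o`. -/
theorem thetaDerivT_adOp_odd (j k : Fin q) (o : O) :
    (thetaDerivT E O q j : Module.End ℂ _) * S.adOp (theta q k) (0, o) =
      S.adOp (theta q k) (0, o) * thetaDerivT E O q j +
        if j = k then (S.grassmannBracket q (1 ⊗ₜ (0, o)) : Module.End ℂ _) else 0 := by
  refine TensorProduct.ext' fun b v => ?_
  have h1 : thetaDeriv q j (theta q k) = if j = k then 1 else 0 := by
    rw [theta, thetaDeriv_ι, Pi.single_apply]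
    split_ifs <;> simp
  simp only [Module.End.mul_apply, LinearMap.add_apply, adOp_tmul, thetaDerivT_tmul, thetaDeriv_mul,
    h1, TensorProduct.add_tmul]
  split_ifs <;> simp [grassmannBracket_odd_tmul]

end Ad

section Lower

variable {E O : Type} [LieRing E] [LieAlgebra ℂ E] [AddCommGroup O] [Module ℂ O]
  (S : LieSuperalgebra E O) {q : ℕ}

/-- The exponential of an even nilpotent derivation of `Λ_q ⊗ 𝔤` as a point of the supergroup. -/
def expPoint (N : Module.End ℂ (Grassmann q ⊗[ℂ] (E × O))) (hn : IsNilpotent N)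
    (hs : ∀ (a : Grassmann q) u, N (a • u) = a • N u)
    (hp : ∀ u, N (totalParity E O q u) = totalParity E O q (N u))
    (hd : ∀ u u', N (S.grassmannBracket q u u') =
      S.grassmannBracket q (N u) u' + S.grassmannBracket q u (N u')) : S.points q :=
  ⟨{ toFun := (IsNilpotent.exp N : Module.End ℂ (Grassmann q ⊗[ℂ] (E × O)))
     map_add' := map_add _
     map_smul' := fun a u => by
       have h : Commute (Algebra.lsmul ℂ ℂ (Grassmann q ⊗[ℂ] (E × O)) a) N :=
         LinearMap.ext fun u => (hs a u).symm
       exact (LinearMap.congr_fun (commute_exp_end hn h) u).symm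
     invFun := (IsNilpotent.exp (-N) : Module.End ℂ (Grassmann q ⊗[ℂ] (E × O)))
     left_inv := fun u => LinearMap.congr_fun (IsNilpotent.exp_neg_mul_exp_self hn) u
     right_inv := fun u => LinearMap.congr_fun (IsNilpotent.exp_mul_exp_neg_self hn) u },
    fun u => by
      have h : Commute (totalParity E O q : Module.End ℂ _) N :=
        LinearMap.ext fun u => (hp u).symm
      exact (LinearMap.congr_fun (commute_exp_end hn h) u).symm,
    fun u u' => exp_bilin_of_derivation _ hd hn u u'⟩

theorem expPoint_apply (N : Module.End ℂ (Grassmann q ⊗[ℂ] (E × O))) (hn hs hp hd u) :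
    (S.expPoint N hn hs hp hd).1 u = IsNilpotent.exp N u := rfl

/-- An abelian subspace `W ⊆ 𝔤_{-1}` is tangent to the integral submanifold `exp(W) P / P`. -/
theorem mem_integralDims_of_isAbelianDim [FiniteDimensional ℂ E] [FiniteDimensional ℂ O] {Z : E}
    {p q : ℕ} (h : S.IsAbelianDim Z p q) : (p, q) ∈ S.integralDims Z := by
  obtain ⟨e, o, hle, hlo, hge, hgo, hee, heo, hoo⟩ := h
  let w : Fin p ⊕ Fin q → E × O := Sum.elim (fun i => (e i, 0)) fun j => (0, o j)
  let c : Fin p ⊕ Fin q → Grassmann q := Sum.elim (fun _ => 1) fun j => theta q j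
  have hw : ∀ a, w a ∈ S.gr Z (-1) := by rintro (i | j); exacts [hge i, hgo j]
  have hww : ∀ a b, S.bracket (w a) (w b) = 0 := by
    rintro (i | j) (i' | j') <;> simp [w, bracket_apply, hee, heo, hoo]
  have hcw : ∀ a, IsEvenGen (c a) (w a) := by rintro (i | j); exacts [.even _, .odd _ _]
  let M : Fin p ⊕ Fin q → Module.End ℂ (Grassmann q ⊗[ℂ] (E × O)) := fun a => S.adOp (c a) (w a)
  have hM : ∀ a b, Commute (M a) (M b) := fun a b => S.adOp_commute (hcw a) (hcw b) (hww a b)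
  have hMn : ∀ a, IsNilpotent (M a) := fun a => S.isNilpotent_adOp (S.isNilpotent_bracket (hw a)) _
  let x : (Fin p → ℂ) → Fin p ⊕ Fin q → ℂ := fun z => Sum.elim z fun _ => 1
  -- the coordinates `x_i`, `θ_j` of the superdomain are the coefficients of this even element
  let N : (Fin p → ℂ) → Module.End ℂ (Grassmann q ⊗[ℂ] (E × O)) := fun z => ∑ a, x z a • M a
  have hNM : ∀ z a, Commute (M a) (N z) := fun z a =>
    Commute.sum_right _ _ _ fun b _ => (hM a b).smul_right _
  -- nilpotency in the ring of functions of `z` gives an exponent independent of `z`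
  obtain ⟨K, hK⟩ : ∃ K, ∀ z, N z ^ K = 0 := by
    have h1 : IsNilpotent (∑ a, fun z => x z a • M a :
        (Fin p → ℂ) → Module.End ℂ (Grassmann q ⊗[ℂ] (E × O))) := by
      refine Commute.isNilpotent_sum (fun a _ => ?_) fun a b _ _ => ?_
      · obtain ⟨k, hk⟩ := hMn a
        refine ⟨k, funext fun z => ?_⟩
        rw [Pi.pow_apply, smul_pow, hk, smul_zero]; rfl
      · exact funext fun z => ((hM a b).smul_left _).smul_right _
    obtain ⟨K, hK⟩ := h1
    refine ⟨K, fun z => ?_⟩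
    have := congrFun hK z
    rw [Pi.pow_apply, Finset.sum_apply] at this
    exact this
  have hNn : ∀ z, IsNilpotent (N z) := fun z => ⟨K, hK z⟩
  have hNs : ∀ z (a : Grassmann q) u, N z (a • u) = a • N z u := fun z a u => by
    simp only [N, LinearMap.sum_apply, LinearMap.smul_apply, M, adOp_smul, Finset.smul_sum]
    exact Finset.sum_congr rfl fun b _ => smul_comm _ _ _
  have hNp : ∀ z u, N z (totalParity E O q u) = totalParity E O q (N z u) := fun z u => by
    simp only [N, LinearMap.sum_apply, LinearMap.smul_apply, M, S.adOp_totalParity (hcw _), map_sum,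
      map_smul]
  have hNd : ∀ z u u', N z (S.grassmannBracket q u u') =
      S.grassmannBracket q (N z u) u' + S.grassmannBracket q u (N z u') := fun z u u' => by
    simp only [N, LinearMap.sum_apply, LinearMap.smul_apply, M, S.adOp_derivation (hcw _), map_sum,
      map_smul, smul_add, Finset.sum_add_distrib]
  let g : (Fin p → ℂ) → S.points q := fun z => S.expPoint (N z) (hNn z) (hNs z) (hNp z) (hNd z)
  have hgb : ∀ (e : E) (u : Grassmann q ⊗[ℂ] (E × O)),
      S.grassmannBracket q (1 ⊗ₜ (e, 0)) u = S.adOp 1 (e, 0) u := by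
    intro e u
    induction u using TensorProduct.induction_on with
    | zero => simp
    | add x y hx hy => simp only [map_add, hx, hy]
    | tmul b v =>
      have h : S.bracket ((0 : E), (0 : O)) v = 0 := by rw [Prod.mk_zero_zero, map_zero]; rfl
      rw [grassmannBracket_tmul, h, TensorProduct.tmul_zero, add_zero, one_mul, adOp_tmul, mul_one]
  have hlog : ∀ z a, S.IsLogDeriv g z a (1 ⊗ₜ w a) := by
    rintro z (i | j)
    · intro v l
      have hx : ∀ t : ℂ, N (z + t • Pi.single i 1) = N z + t • M (.inl i) := by
        intro t
        simp only [N, Fintype.sum_sum_type, x, Sum.elim_inl, Sum.elim_inr, Pi.add_apply,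
          Pi.smul_apply, smul_eq_mul, add_smul, Finset.sum_add_distrib, Pi.single_apply, mul_ite,
          mul_one, mul_zero, ite_smul, zero_smul, Finset.sum_ite_eq', Finset.mem_univ, if_true]
        abel
      have he : ∀ t : ℂ, (g (z + t • Pi.single i 1)).1 (1 ⊗ₜ v) =
          IsNilpotent.exp (N z) (IsNilpotent.exp (t • M (.inl i)) (1 ⊗ₜ v)) := by
        intro t
        rw [S.expPoint_apply, hx, IsNilpotent.exp_add_of_commute
          ((hNM z _).symm.smul_right _) (hNn z) ((hMn _).smul t)]
        rfl
      rw [funext fun t => congrArg l (he t)]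
      have := hasDerivAt_exp_smul (hMn (.inl i)) (l ∘ₗ IsNilpotent.exp (N z)) (1 ⊗ₜ v)
      rw [← show S.grassmannBracket q (1 ⊗ₜ w (.inl i)) (1 ⊗ₜ v) = M (.inl i) (1 ⊗ₜ v) from
        hgb _ _] at this
      exact this
    · intro v
      have hD : (thetaDerivT E O q j : Module.End ℂ _) * N z = N z * thetaDerivT E O q j +
          S.grassmannBracket q (1 ⊗ₜ (0, o j)) := by
        simp only [N, Finset.mul_sum, Finset.sum_mul, Fintype.sum_sum_type, x, M, c, w,
          Sum.elim_inl, Sum.elim_inr, mul_smul_comm, smul_mul_assoc, thetaDerivT_adOp_even,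
          thetaDerivT_adOp_odd, one_smul, Finset.sum_add_distrib, Finset.sum_ite_eq,
          Finset.mem_univ, if_true, add_assoc, mul_add, add_mul]
      have hQ : Commute (S.grassmannBracket q (1 ⊗ₜ (0, o j)) : Module.End ℂ _) (N z) :=
        Commute.sum_right _ _ _ fun b _ =>
          (S.grassmannBracket_odd_commute (hcw b) (o j) (hww (.inr j) b)).smul_right _
      have := LinearMap.congr_fun (mul_exp_end_of_commutator (hNn z) hD hQ) (1 ⊗ₜ v)
      simp only [Module.End.mul_apply, LinearMap.add_apply, thetaDerivT_tmul, thetaDeriv_one,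
        TensorProduct.zero_tmul, map_zero, zero_add] at this
      exact this
  let φ : S.FlagMap Z p q :=
    { domain := Set.univ
      isOpen_domain := isOpen_univ
      nonempty_domain := Set.univ_nonempty
      nhd := fun _ => Set.univ
      isOpen_nhd := fun _ _ => isOpen_univ
      mem_nhd := fun _ _ => Set.mem_univ _
      nhd_subset := fun _ _ => Set.subset_univ _
      lift := fun _ => g
      holomorphic := fun _ _ v l => by
        have hpow : ∀ (k : ℕ) (l : Module.Dual ℂ (Grassmann q ⊗[ℂ] (E × O))) u,
            Differentiable ℂ fun z => l ((N z ^ k) u) := by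
          intro k
          induction k with
          | zero => intro l u; simp
          | succ k ih =>
            intro l u
            have h1 : ∀ z, l ((N z ^ (k + 1)) u) = ∑ a, x z a * l ((N z ^ k) (M a u)) := by
              intro z
              rw [pow_succ, Module.End.mul_apply]
              conv_lhs => enter [2, 2]; simp only [N]
              simp only [LinearMap.sum_apply, LinearMap.smul_apply, map_sum, map_smul, smul_eq_mul]
            rw [funext h1]
            refine Differentiable.fun_sum fun a _ => Differentiable.mul ?_ (ih l _)
            rcases a with i | j
            · exact differentiable_apply i
            · exact differentiable_const _
        have h2 : ∀ z, l ((g z).1 (1 ⊗ₜ v)) =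
            ∑ k ∈ Finset.range K, ((k.factorial : ℂ))⁻¹ * l ((N z ^ k) (1 ⊗ₜ v)) := by
          intro z
          rw [S.expPoint_apply, exp_end_eq_sum (hK z)]
          simp only [LinearMap.sum_apply, LinearMap.smul_apply, map_sum, map_smul, smul_eq_mul]
        change DifferentiableOn ℂ (fun z => l ((g z).1 (1 ⊗ₜ v))) _
        rw [funext h2]
        exact (Differentiable.fun_sum fun k _ => (hpow k l _).const_mul _).differentiableOn
      compatible := fun _ _ _ _ z _ => by
        rw [inv_mul_cancel]
        exact Submodule.map_id _ }
  refine ⟨φ, fun _ _ z _ a => ⟨1 ⊗ₜ w a, ?_, hlog z a⟩,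
    fun _ _ z _ => ⟨fun a => 1 ⊗ₜ w a, hlog z, ?_⟩⟩
  · exact Submodule.tmul_mem_baseChange_of_mem _ (S.gr_le_fil le_rfl (hw a))
  · have hwli : LinearIndependent ℂ w := by
      refine LinearIndependent.sum_type (hle.map' (LinearMap.inl ℂ E O) ?_)
        (hlo.map' (LinearMap.inr ℂ E O) ?_) ?_
      · exact LinearMap.ker_eq_bot.2 LinearMap.inl_injective
      · exact LinearMap.ker_eq_bot.2 LinearMap.inr_injective
      · refine (LinearMap.isCompl_range_inl_inr (R := ℂ) (M := E) (M₂ := O)).disjoint.mono ?_ ?_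
        · refine Submodule.span_le.2 ?_
          rintro _ ⟨i, rfl⟩
          exact ⟨e i, rfl⟩
        · refine Submodule.span_le.2 ?_
          rintro _ ⟨j, rfl⟩
          exact ⟨o j, rfl⟩
    have : (fun a => (S.parabolic Z).mkQ (bodyMap E O q ((1 : Grassmann q) ⊗ₜ w a))) =
        (S.parabolic Z).mkQ ∘ w := funext fun a => by
      rw [bodyMap_tmul, map_one, one_smul]; rfl
    rw [this]
    refine hwli.map ?_
    rw [Submodule.ker_mkQ]
    refine Disjoint.mono_left (Submodule.span_le.2 ?_)
      (disjoint_iff.2 (S.gr_inf_fil (Z := Z) (j := -1) (k := 0) (by omega)))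
    rintro _ ⟨a, rfl⟩
    exact hw a

variable {S} in
/-- The dimensions of nondegenerate integral submanifolds of `𝒟` are the dimensions of the abelian
subspaces of `𝔤_{-1}`. -/
theorem mem_integralDims_iff [FiniteDimensional ℂ E] [FiniteDimensional ℂ O]
    (hS : S.IsCenterless) {Z : E} {d : ℕ × ℕ} :
    d ∈ S.integralDims Z ↔ S.IsAbelianDim Z d.1 d.2 :=
  ⟨isAbelianDim_of_mem_integralDims hS, S.mem_integralDims_of_isAbelianDim⟩

end Lower

/-! ### Maximal dimensions -/

section Max

variable {E O : Type} [LieRing E] [LieAlgebra ℂ E] [AddCommGroup O] [Module ℂ O]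
  [FiniteDimensional ℂ E] [FiniteDimensional ℂ O] {S : LieSuperalgebra E O}

/-- To determine the maximal dimensions it suffices to find abelian subspaces whose dimensions form
an antichain and bound the dimension of every abelian subspace by one of them. -/
theorem maxIntegralDims_eq (hS : S.IsCenterless) {Z : E} {M : Set (ℕ × ℕ)}
    (hM : IsAntichain (· ≤ ·) M) (hex : ∀ m ∈ M, S.IsAbelianDim Z m.1 m.2)
    (hle : ∀ p q, S.IsAbelianDim Z p q → ∃ m ∈ M, (p, q) ≤ m) : S.maxIntegralDims Z = M := by
  ext d
  simp only [maxIntegralDims, Set.mem_ofPred_eq, Maximal, mem_integralDims_iff hS]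
  constructor
  · rintro ⟨hd, hmax⟩
    obtain ⟨m, hm, hdm⟩ := hle _ _ hd
    have := hmax (hex m hm) hdm
    rwa [le_antisymm (show d ≤ m from hdm) this]
  · intro hd
    refine ⟨hex d hd, fun {d'} hd' hdd' => ?_⟩
    obtain ⟨m, hm, hdm⟩ := hle _ _ hd'
    have := hM.eq hd hm (hdd'.trans hdm)
    rwa [this]

end Max

/-! ### Superalgebras with odd part `ℂ² ⊗ V` are centerless -/

section Doublet

variable {V : Type} [AddCommGroup V] [Module ℂ V]

/-- Lie superalgebras with odd part `ℂ² ⊗ V`, `V ≠ 0`, are centerless: the even part acts faithfully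
on the odd part, and `𝔰𝔩(2)` annihilates no odd element. -/
theorem isCenterless_ofOrthogonal [Nontrivial V] (β : V →ₗ[ℂ] V →ₗ[ℂ] ℂ)
    (k : LieSubalgebra ℂ (Module.End ℂ V)) (K : V →ₗ[ℂ] V →ₗ[ℂ] k) (h1 h2 h3 h4 h5) :
    (ofOrthogonal β k K h1 h2 h3 h4 h5).IsCenterless := by
  rintro ⟨⟨A, X⟩, Q⟩ h
  have hact : ∀ (A : SL2) (X : k) (P : Fin 2 → V) (a : Fin 2),
      (ofOrthogonal β k K h1 h2 h3 h4 h5).act (A, X) P a =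
        (A : Matrix (Fin 2) (Fin 2) ℂ) a 0 • P 0 + (A : Matrix (Fin 2) (Fin 2) ℂ) a 1 • P 1
          + (X : Module.End ℂ V) (P a) := by
    intro A X P a
    change (∑ b : Fin 2, (A : Matrix (Fin 2) (Fin 2) ℂ) a b • P b + _) = _
    rw [Fin.sum_univ_two]
  have hQ0 : Q = 0 := by
    have h6 := congrFun (congrArg Prod.snd (h ((sl2Diag 1, 0), 0)))
    refine funext fun a => ?_
    have := h6 a
    simp only [bracket_apply, map_zero, zero_sub, Pi.neg_apply, hact, sl2Diag] at this
    fin_cases a <;> simpa using this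
  have hE : ∀ (P : Fin 2 → V) (a : Fin 2), (A : Matrix (Fin 2) (Fin 2) ℂ) a 0 • P 0 +
      (A : Matrix (Fin 2) (Fin 2) ℂ) a 1 • P 1 + (X : Module.End ℂ V) (P a) = 0 := by
    intro P a
    have := congrFun (congrArg Prod.snd (h (0, P))) a
    simp only [bracket_apply, map_zero, LinearMap.zero_apply, sub_zero] at this
    rwa [hact] at this
  have tr : (A : Matrix (Fin 2) (Fin 2) ℂ) 1 1 = - (A : Matrix (Fin 2) (Fin 2) ℂ) 0 0 := by
    have h : Matrix.trace (A : Matrix (Fin 2) (Fin 2) ℂ) = 0 := A.2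
    rw [Matrix.trace_fin_two] at h
    linear_combination h
  have e01 : ∀ s : V, (A : Matrix (Fin 2) (Fin 2) ℂ) 0 1 • s = 0 := fun s => by
    simpa using hE ![0, s] 0
  have e10 : ∀ s : V, (A : Matrix (Fin 2) (Fin 2) ℂ) 1 0 • s = 0 := fun s => by
    simpa using hE ![s, 0] 1
  have e00 : ∀ s : V, (A : Matrix (Fin 2) (Fin 2) ℂ) 0 0 • s + (X : Module.End ℂ V) s = 0 :=
    fun s => by simpa using hE ![s, 0] 0
  have e11 : ∀ s : V, -((A : Matrix (Fin 2) (Fin 2) ℂ) 0 0 • s) + (X : Module.End ℂ V) s = 0 :=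
    fun s => by simpa [tr] using hE ![0, s] 1
  have e00' : ∀ s : V, (A : Matrix (Fin 2) (Fin 2) ℂ) 0 0 • s = 0 := fun s => by
    have h6 : (2 : ℂ) • ((A : Matrix (Fin 2) (Fin 2) ℂ) 0 0 • s) = 0 := by
      linear_combination (norm := module) e00 s - e11 s
    exact (smul_eq_zero.1 h6).resolve_left two_ne_zero
  obtain ⟨s, hs⟩ := exists_ne (0 : V)
  have hA : A = 0 := by
    refine Subtype.ext (Matrix.ext fun a b => ?_)
    fin_cases a <;> fin_cases b
    · exact (smul_eq_zero.1 (e00' s)).resolve_right hs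
    · exact (smul_eq_zero.1 (e01 s)).resolve_right hs
    · exact (smul_eq_zero.1 (e10 s)).resolve_right hs
    · exact tr.trans (by rw [(smul_eq_zero.1 (e00' s)).resolve_right hs]; simp)
  have hX : X = 0 := by
    refine Subtype.ext (LinearMap.ext fun s => ?_)
    have := e00 s
    rwa [e00', zero_add] at this
  rw [hQ0, hA, hX]; rfl

end Doublet

end LieSuperalgebra

/-! ### Bounds for isotropic families -/

section Isotropic

/-- Orthogonal linearly independent families in `ℂ^m` have together at most `m` members. -/
theorem add_le_of_dotProduct_eq_zero {m n n' : ℕ} {u : Fin n → Fin m → ℂ} {v : Fin n' → Fin m → ℂ}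
    (hu : LinearIndependent ℂ u) (hv : LinearIndependent ℂ v) (h : ∀ i j, u i ⬝ᵥ v j = 0) :
    n + n' ≤ m := by
  let f : (Fin m → ℂ) →ₗ[ℂ] (Fin n → ℂ) := (Matrix.of u).mulVecLin
  have h1 : Module.finrank ℂ (LinearMap.range f) = n := by
    have : LinearIndependent ℂ (Matrix.of u).row := hu
    simpa [Matrix.rank] using this.rank_matrix
  have h2 : n' ≤ Module.finrank ℂ (LinearMap.ker f) := by
    have hmem : ∀ j, v j ∈ LinearMap.ker f := fun j =>
      LinearMap.mem_ker.2 (funext fun i => h i j)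
    have hli : LinearIndependent ℂ fun j => (⟨v j, hmem j⟩ : LinearMap.ker f) :=
      LinearIndependent.of_comp (LinearMap.ker f).subtype hv
    simpa using hli.fintype_card_le_finrank
  have := f.finrank_range_add_finrank_ker
  rw [Module.finrank_fintype_fun_eq_card, Fintype.card_fin] at this
  omega

/-- A totally isotropic family for a nondegenerate pairing of `ℂ^m` whose matrix is a permutation
matrix up to nonzero factors. -/
theorem two_mul_le_of_isotropic {m n : ℕ} {v : Fin n → Fin m → ℂ} (hv : LinearIndependent ℂ v)
    (c : Fin m → ℂ) (σ : Fin m → Fin m) (hc : ∀ k, c k ≠ 0) (hσ : Function.Injective σ)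
    (h : ∀ i j, ∑ k, c k * v i k * v j (σ k) = 0) : 2 * n ≤ m := by
  let T : (Fin m → ℂ) →ₗ[ℂ] (Fin m → ℂ) := LinearMap.pi fun k => c k • LinearMap.proj k
  let R : (Fin m → ℂ) →ₗ[ℂ] (Fin m → ℂ) := LinearMap.funLeft ℂ ℂ σ
  have hT : LinearMap.ker T = ⊥ := LinearMap.ker_eq_bot'.2 fun w hw => funext fun k => by
    simpa [T, hc k] using congrFun hw k
  have hR : LinearMap.ker R = ⊥ := LinearMap.ker_eq_bot.2
    (LinearMap.funLeft_injective_of_surjective ℂ ℂ σ (Finite.injective_iff_surjective.1 hσ))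
  have := add_le_of_dotProduct_eq_zero (hv.map' T hT) (hv.map' R hR) (fun i j => h i j)
  omega

end Isotropic

/-! ### Weight coordinates -/

namespace LieSuperalgebra

section Weights

variable {E O : Type} [LieRing E] [LieAlgebra ℂ E] [AddCommGroup O] [Module ℂ O]

/-- Coordinates of `𝔤` with respect to a basis of weight vectors for the Cartan subalgebra
parametrized by `cartan`. The integers `wE k i`, `wO k i` are twice the coefficients of the weights,
so that half-integral weights are covered. The even part has the coordinates `LE`, the odd part the
coordinates `LO`. -/
structure WeightCoords (S : LieSuperalgebra E O) {r : ℕ} (cartan : (Fin r → ℂ) → E)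
    (m n : ℕ) where
  LE : E ≃ₗ[ℂ] (Fin m → ℂ)
  LO : O ≃ₗ[ℂ] (Fin n → ℂ)
  wE : Fin m → Fin r → ℤ
  wO : Fin n → Fin r → ℤ
  lie_cartan : ∀ x e k, LE ⁅cartan x, e⁆ k = (∑ i, (wE k i : ℂ) * x i) / 2 * LE e k
  act_cartan : ∀ x p k, LO (S.act (cartan x) p) k = (∑ i, (wO k i : ℂ) * x i) / 2 * LO p k

namespace WeightCoords

variable {S : LieSuperalgebra E O} {r : ℕ} {cartan : (Fin r → ℂ) → E} {m n : ℕ}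
  (L : WeightCoords S cartan m n)

/-- Twice the degree of the weight vector with index `k` of the even part. -/
def degE (x : Fin r → ℤ) (k : Fin m) : ℤ := ∑ i, L.wE k i * x i

/-- Twice the degree of the weight vector with index `k` of the odd part. -/
def degO (x : Fin r → ℤ) (k : Fin n) : ℤ := ∑ i, L.wO k i * x i

/-- The equation cutting out degree `-1`; `d` is twice a degree. -/
theorem mul_eq_neg_iff {d : ℤ} {a : ℂ} : (d : ℂ) / 2 * a = -a ↔ (d ≠ -2 → a = 0) := by
  have h1 : (d : ℂ) / 2 * a = -a ↔ ((d + 2 : ℤ) : ℂ) * a = 0 := by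
    push_cast
    constructor <;> intro h
    · linear_combination 2 * h
    · linear_combination h / 2
  rw [h1, mul_eq_zero, Int.cast_eq_zero, or_iff_not_imp_left]
  refine imp_congr_left (not_congr ?_)
  omega

theorem even_mem_gr {x : Fin r → ℤ} {e : E} :
    ((e, 0) : E × O) ∈ S.gr (cartan fun i => (x i : ℂ)) (-1) ↔
      ∀ k, L.degE x k ≠ -2 → L.LE e k = 0 := by
  have h : ((e, 0) : E × O) ∈ S.gr (cartan fun i => (x i : ℂ)) (-1) ↔
      ⁅cartan fun i => (x i : ℂ), e⁆ = -e := by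
    rw [mem_gr]; simp [bracket_apply, Prod.ext_iff]
  rw [h, ← L.LE.injective.eq_iff, funext_iff]
  refine forall_congr' fun k => ?_
  rw [L.lie_cartan, map_neg, Pi.neg_apply, ← mul_eq_neg_iff, degE]
  push_cast; rfl

theorem odd_mem_gr {x : Fin r → ℤ} {p : O} :
    ((0, p) : E × O) ∈ S.gr (cartan fun i => (x i : ℂ)) (-1) ↔
      ∀ k, L.degO x k ≠ -2 → L.LO p k = 0 := by
  have h : ((0, p) : E × O) ∈ S.gr (cartan fun i => (x i : ℂ)) (-1) ↔
      S.act (cartan fun i => (x i : ℂ)) p = -p := by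
    rw [mem_gr]; simp [bracket_apply, Prod.ext_iff]
  rw [h, ← L.LO.injective.eq_iff, funext_iff]
  refine forall_congr' fun k => ?_
  rw [L.act_cartan, map_neg, Pi.neg_apply, ← mul_eq_neg_iff, degO]
  push_cast; rfl

theorem finrank_forall_eq_zero {ι : Type*} [Fintype ι] (P : ι → Prop) [DecidablePred P]
    (W : Submodule ℂ (ι → ℂ)) (hW : ∀ f, f ∈ W ↔ ∀ k, ¬ P k → f k = 0) :
    Module.finrank ℂ W = Fintype.card {k // P k} := by
  let e : W ≃ₗ[ℂ] ({k // P k} → ℂ) :=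
    { toFun := fun f k => f.1 k.1
      map_add' := fun _ _ => rfl
      map_smul' := fun _ _ => rfl
      invFun := fun g => ⟨fun k => if h : P k then g ⟨k, h⟩ else 0, (hW _).2 fun k hk => dif_neg hk⟩
      left_inv := fun f => Subtype.ext (funext fun k => by
        by_cases h : P k
        · simp [h]
        · simp [h, (hW _).1 f.2 k h])
      right_inv := fun g => funext fun k => by simp [k.2] }
  rw [e.finrank_eq, Module.finrank_fintype_fun_eq_card]

/-- The dimension of `𝔤_{-1}` is the number of weight vectors of degree `-1`. -/
theorem superDim_gr (x : Fin r → ℤ) :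
    superDim (S.gr (cartan fun i => (x i : ℂ)) (-1)) =
      (Fintype.card {k // L.degE x k = -2}, Fintype.card {k // L.degO x k = -2}) := by
  have hfr : ∀ {M : Type} [AddCommGroup M] [Module ℂ M] {d : ℕ} (f : M →ₗ[ℂ] E × O)
      (_ : Function.Injective f) (e : M ≃ₗ[ℂ] (Fin d → ℂ)) (W : Submodule ℂ (E × O))
      (P : Fin d → Prop) [DecidablePred P] (_ : ∀ v, f v ∈ W ↔ ∀ k, ¬ P k → e v k = 0),
      Module.finrank ℂ ↥(W ⊓ LinearMap.range f) = Fintype.card {k // P k} := by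
    intro M _ _ d f hf e W P _ hW
    rw [inf_comm, ← Submodule.map_comap_eq, ← (Submodule.equivMapOfInjective f hf _).finrank_eq,
      ← e.finrank_map_eq, finrank_forall_eq_zero P]
    intro g
    rw [← e.apply_symm_apply g, Submodule.mem_map_equiv, e.symm_apply_apply,
      Submodule.mem_comap, hW]
  have he : LinearMap.range (evenProj E O) = LinearMap.range (LinearMap.inl ℂ E O) :=
    LinearMap.range_comp_of_range_eq_top _ (LinearMap.range_eq_top.2 LinearMap.fst_surjective)
  have ho : LinearMap.range (oddProj E O) = LinearMap.range (LinearMap.inr ℂ E O) :=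
    LinearMap.range_comp_of_range_eq_top _ (LinearMap.range_eq_top.2 LinearMap.snd_surjective)
  rw [superDim, he, ho]
  exact Prod.ext
    (hfr (LinearMap.inl ℂ E O) LinearMap.inl_injective L.LE _ _ fun v => L.even_mem_gr)
    (hfr (LinearMap.inr ℂ E O) LinearMap.inr_injective L.LO _ _ fun v => L.odd_mem_gr)

theorem symm_single_eigen_even (x : Fin r → ℂ) (k : Fin m) :
    ⁅cartan x, L.LE.symm (Pi.single k 1)⁆ =
      ((∑ i, (L.wE k i : ℂ) * x i) / 2) • L.LE.symm (Pi.single k 1) := by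
  refine L.LE.injective (funext fun l => ?_)
  rw [L.lie_cartan, map_smul, L.LE.apply_symm_apply, Pi.smul_apply, smul_eq_mul]
  by_cases h : l = k
  · rw [h]
  · simp [h]

theorem symm_single_eigen_odd (x : Fin r → ℂ) (k : Fin n) :
    S.act (cartan x) (L.LO.symm (Pi.single k 1)) =
      ((∑ i, (L.wO k i : ℂ) * x i) / 2) • L.LO.symm (Pi.single k 1) := by
  refine L.LO.injective (funext fun l => ?_)
  rw [L.act_cartan, map_smul, L.LO.apply_symm_apply, Pi.smul_apply, smul_eq_mul]
  by_cases h : l = k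
  · rw [h]
  · simp [h]

/-- A weight vector whose weight does not occur vanishes. The weights are doubled. -/
theorem eq_zero_of_eigen {ι : Type*} (w : ι → Fin r → ℤ) (u u' : Fin r → ℤ) (f : ι → ℂ)
    (hf : ∀ x : Fin r → ℂ, ∀ k, ((∑ i, (u i : ℂ) * x i) / 2 + (∑ i, (u' i : ℂ) * x i) / 2) * f k =
      (∑ i, (w k i : ℂ) * x i) / 2 * f k) (hw : ∀ k, w k ≠ u + u') : f = 0 := by
  refine funext fun k => ?_
  obtain ⟨i, hi⟩ := Function.ne_iff.1 (hw k)
  have h := hf (Pi.single i 1) k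
  simp only [Pi.single_apply, mul_ite, mul_one, mul_zero, Finset.sum_ite_eq', Finset.mem_univ,
    if_true] at h
  have h2 : ((w k i - (u i + u' i) : ℤ) : ℂ) * f k = 0 := by
    push_cast; linear_combination -2 * h
  refine (mul_eq_zero.1 h2).resolve_left fun h3 => hi ?_
  have := Int.cast_eq_zero.1 h3
  simp only [Pi.add_apply]
  omega

/-- Weight vectors of degree `-1` such that no sum of two of their weights is a weight span an
abelian subspace. -/
theorem isAbelianDim {p q : ℕ} (x : Fin r → ℤ) (f : Fin p → Fin m) (g : Fin q → Fin n)
    (hf : Function.Injective f) (hg : Function.Injective g) (hfx : ∀ i, L.degE x (f i) = -2)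
    (hgx : ∀ j, L.degO x (g j) = -2) (hff : ∀ i i' k, L.wE k ≠ L.wE (f i) + L.wE (f i'))
    (hfg : ∀ i j k, L.wO k ≠ L.wE (f i) + L.wO (g j))
    (hgg : ∀ j j' k, L.wE k ≠ L.wO (g j) + L.wO (g j')) :
    S.IsAbelianDim (cartan fun i => (x i : ℂ)) p q := by
  refine ⟨fun i => L.LE.symm (Pi.single (f i) 1), fun j => L.LO.symm (Pi.single (g j) 1),
    ?_, ?_, fun i => ?_, fun j => ?_, fun i i' => ?_, fun i j => ?_, fun j j' => ?_⟩
  · exact ((Pi.linearIndependent_single_one (Fin m) ℂ).comp f hf).map' L.LE.symm.toLinearMap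
      L.LE.symm.ker
  · exact ((Pi.linearIndependent_single_one (Fin n) ℂ).comp g hg).map' L.LO.symm.toLinearMap
      L.LO.symm.ker
  · refine L.even_mem_gr.2 fun k hk => ?_
    rw [L.LE.apply_symm_apply, Pi.single_eq_of_ne]
    rintro rfl; exact hk (hfx i)
  · refine L.odd_mem_gr.2 fun k hk => ?_
    rw [L.LO.apply_symm_apply, Pi.single_eq_of_ne]
    rintro rfl; exact hk (hgx j)
  · refine L.LE.map_eq_zero_iff.1 (eq_zero_of_eigen L.wE _ _ _ (fun x k => ?_) (hff i i'))
    rw [← L.lie_cartan, leibniz_lie, L.symm_single_eigen_even, L.symm_single_eigen_even, smul_lie,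
      lie_smul, ← add_smul, map_smul]
    rfl
  · refine L.LO.map_eq_zero_iff.1 (eq_zero_of_eigen L.wO _ _ _ (fun x k => ?_) (hfg i j))
    have h : ∀ e e' : E, ∀ q, S.act e (S.act e' q) = S.act ⁅e, e'⁆ q + S.act e' (S.act e q) := by
      intro e e' q
      rw [LieHom.map_lie, LieRing.of_associative_ring_bracket, LinearMap.sub_apply,
        Module.End.mul_apply, Module.End.mul_apply, sub_add_cancel]
    rw [← L.act_cartan, h, L.symm_single_eigen_even, L.symm_single_eigen_odd, map_smul, map_smul,
      LinearMap.smul_apply, ← add_smul, map_smul]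
    rfl
  · refine L.LE.map_eq_zero_iff.1 (eq_zero_of_eigen L.wE _ _ _ (fun x k => ?_) (hgg j j'))
    rw [← L.lie_cartan, S.odd_equivariant, L.symm_single_eigen_odd, L.symm_single_eigen_odd,
      map_smul, map_smul, LinearMap.smul_apply, ← add_smul, map_smul]
    rfl

/-- A linearly independent family stays linearly independent after forgetting coordinates that
vanish on all of its members. -/
theorem linearIndependent_coord {M : Type*} [AddCommGroup M] [Module ℂ M] {ι : Type*} [Fintype ι]
    {m d : ℕ} (F : M ≃ₗ[ℂ] (Fin m → ℂ)) {v : ι → M} (hv : LinearIndependent ℂ v)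
    (f : Fin d → Fin m) (hf : ∀ i k, (∀ j, f j ≠ k) → F (v i) k = 0) :
    LinearIndependent ℂ fun i j => F (v i) (f j) := by
  have h1 := hv.map' F.toLinearMap F.ker
  rw [Fintype.linearIndependent_iff] at h1 ⊢
  intro g hg
  refine h1 g (funext fun k => ?_)
  by_cases hk : ∃ j, f j = k
  · obtain ⟨j, rfl⟩ := hk
    simpa using congrFun hg j
  · push Not at hk
    simp [hf _ k hk]

theorem even_eq_zero {d : ℕ} {x : Fin r → ℤ} {e : E}
    (he : ((e, 0) : E × O) ∈ S.gr (cartan fun i => (x i : ℂ)) (-1)) {f : Fin d → Fin m}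
    (hf : ∀ k, L.degE x k = -2 → ∃ j, f j = k) (k : Fin m) (hk : ∀ j, f j ≠ k) : L.LE e k = 0 :=
  L.even_mem_gr.1 he k fun h => (hf k h).elim hk

theorem odd_eq_zero {d : ℕ} {x : Fin r → ℤ} {p : O}
    (hp : ((0, p) : E × O) ∈ S.gr (cartan fun i => (x i : ℂ)) (-1)) {f : Fin d → Fin n}
    (hf : ∀ k, L.degO x k = -2 → ∃ j, f j = k) (k : Fin n) (hk : ∀ j, f j ≠ k) : L.LO p k = 0 :=
  L.odd_mem_gr.1 hp k fun h => (hf k h).elim hk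

theorem linearIndependent_even {p d : ℕ} {x : Fin r → ℤ} {e : Fin p → E}
    (he : LinearIndependent ℂ e)
    (hgr : ∀ i, ((e i, 0) : E × O) ∈ S.gr (cartan fun i => (x i : ℂ)) (-1)) (f : Fin d → Fin m)
    (hf : ∀ k, L.degE x k = -2 → ∃ j, f j = k) :
    LinearIndependent ℂ fun i j => L.LE (e i) (f j) :=
  linearIndependent_coord L.LE he f fun i => L.even_eq_zero (hgr i) hf

theorem linearIndependent_odd {q d : ℕ} {x : Fin r → ℤ} {o : Fin q → O}
    (ho : LinearIndependent ℂ o)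
    (hgr : ∀ i, ((0, o i) : E × O) ∈ S.gr (cartan fun i => (x i : ℂ)) (-1)) (f : Fin d → Fin n)
    (hf : ∀ k, L.degO x k = -2 → ∃ j, f j = k) :
    LinearIndependent ℂ fun i j => L.LO (o i) (f j) :=
  linearIndependent_coord L.LO ho f fun i => L.odd_eq_zero (hgr i) hf

theorem le_of_linearIndependent_even {p d : ℕ} {x : Fin r → ℤ} {e : Fin p → E}
    (he : LinearIndependent ℂ e)
    (hgr : ∀ i, ((e i, 0) : E × O) ∈ S.gr (cartan fun i => (x i : ℂ)) (-1)) (f : Fin d → Fin m)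
    (hf : ∀ k, L.degE x k = -2 → ∃ j, f j = k) : p ≤ d := by
  simpa using (L.linearIndependent_even he hgr f hf).fintype_card_le_finrank

theorem le_of_linearIndependent_odd {q d : ℕ} {x : Fin r → ℤ} {o : Fin q → O}
    (ho : LinearIndependent ℂ o)
    (hgr : ∀ i, ((0, o i) : E × O) ∈ S.gr (cartan fun i => (x i : ℂ)) (-1)) (f : Fin d → Fin n)
    (hf : ∀ k, L.degO x k = -2 → ∃ j, f j = k) : q ≤ d := by
  simpa using (L.linearIndependent_odd ho hgr f hf).fintype_card_le_finrank

end WeightCoords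

end Weights

end LieSuperalgebra

/-! ### Weight coordinates of `G(3)` -/

namespace G3

open LieSuperalgebra

theorem imOct_ext {s t : ImOct} (h1 : s.1 0 = t.1 0) (h2 : s.1 1 = t.1 1) (h3 : s.1 2 = t.1 2)
    (h4 : s.2.1 0 = t.2.1 0) (h5 : s.2.1 1 = t.2.1 1) (h6 : s.2.1 2 = t.2.1 2)
    (h7 : s.2.2 = t.2.2) : s = t := by
  refine Prod.ext (funext fun i => ?_) (Prod.ext (funext fun i => ?_) h7) <;> fin_cases i <;>
    assumption

/-- The action of `G₂ = 𝔰𝔩(3) ⊕ ℂ³ ⊕ ℂ³ ∋ (A, u, v)` on the imaginary octonions,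
`(a, b, c) ↦ (A a + 2 c u - v × b, -Aᵀ b + 2 c v + u × a, v ⬝ a + u ⬝ b)`. The coordinates are
`A₀₀, A₁₁, A₀₁, A₀₂, A₁₀, A₁₂, A₂₀, A₂₁`, followed by those of `u` and `v`. -/
def g2Act (y : Fin 14 → ℂ) (s : ImOct) : ImOct :=
  (![y 0 * s.1 0 + y 2 * s.1 1 + y 3 * s.1 2 + 2 * s.2.2 * y 8 -
        (y 12 * s.2.1 2 - y 13 * s.2.1 1),
      y 4 * s.1 0 + y 1 * s.1 1 + y 5 * s.1 2 + 2 * s.2.2 * y 9 -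
        (y 13 * s.2.1 0 - y 11 * s.2.1 2),
      y 6 * s.1 0 + y 7 * s.1 1 - (y 0 + y 1) * s.1 2 + 2 * s.2.2 * y 10 -
        (y 11 * s.2.1 1 - y 12 * s.2.1 0)],
    ![-y 0 * s.2.1 0 - y 4 * s.2.1 1 - y 6 * s.2.1 2 + 2 * s.2.2 * y 11 +
        (y 9 * s.1 2 - y 10 * s.1 1),
      -y 2 * s.2.1 0 - y 1 * s.2.1 1 - y 7 * s.2.1 2 + 2 * s.2.2 * y 12 +
        (y 10 * s.1 0 - y 8 * s.1 2),
      -y 3 * s.2.1 0 - y 5 * s.2.1 1 + (y 0 + y 1) * s.2.1 2 + 2 * s.2.2 * y 13 +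
        (y 8 * s.1 1 - y 9 * s.1 0)],
    y 11 * s.1 0 + y 12 * s.1 1 + y 13 * s.1 2 + y 8 * s.2.1 0 + y 9 * s.2.1 1 + y 10 * s.2.1 2)

/-- The endomorphism `g2Act y` as an element of `G₂`. -/
def g2OfCoord (y : Fin 14 → ℂ) : g2 :=
  ⟨{ toFun := g2Act y
     map_add' := fun s t => by
      apply imOct_ext <;> simp only [g2Act, Prod.fst_add, Prod.snd_add, Pi.add_apply,
        Matrix.cons_val] <;> ring
     map_smul' := fun c s => by
      apply imOct_ext <;> simp only [g2Act, Prod.smul_fst, Prod.smul_snd, Pi.smul_apply,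
        smul_eq_mul, Matrix.cons_val, RingHom.id_apply] <;> ring }, by
    refine ⟨fun s t => ?_, fun s t => ?_⟩
    · simp only [LinearMap.coe_mk, AddHom.coe_mk, g2Act, form, LinearMap.mk₂_apply, dotProduct,
        Fin.sum_univ_three, Matrix.cons_val]
      ring
    · apply imOct_ext <;>
      · simp only [LinearMap.coe_mk, AddHom.coe_mk, g2Act, cross, LinearMap.mk₂_apply, cross_apply,
          dotProduct, Fin.sum_univ_three, Prod.fst_add, Prod.snd_add, Prod.fst_sub, Prod.snd_sub,
          Prod.smul_fst, Prod.smul_snd, Pi.add_apply, Pi.sub_apply, Pi.smul_apply, smul_eq_mul,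
          Matrix.cons_val]
        ring⟩

/-- The coordinates of an element of `G₂`. -/
def g2Coord (X : g2) : Fin 14 → ℂ :=
  ![(X.1 (![1, 0, 0], 0, 0)).1 0, (X.1 (![0, 1, 0], 0, 0)).1 1, (X.1 (![0, 1, 0], 0, 0)).1 0,
    (X.1 (![0, 0, 1], 0, 0)).1 0, (X.1 (![1, 0, 0], 0, 0)).1 1, (X.1 (![0, 0, 1], 0, 0)).1 1,
    (X.1 (![1, 0, 0], 0, 0)).1 2, (X.1 (![0, 1, 0], 0, 0)).1 2, (X.1 (0, 0, 1)).1 0 / 2,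
    (X.1 (0, 0, 1)).1 1 / 2, (X.1 (0, 0, 1)).1 2 / 2, (X.1 (0, 0, 1)).2.1 0 / 2,
    (X.1 (0, 0, 1)).2.1 1 / 2, (X.1 (0, 0, 1)).2.1 2 / 2]

/-- Every element of `G₂` is of the form `g2Act y`. -/
theorem g2_apply (X : g2) (s : ImOct) : X.1 s = g2Act (g2Coord X) s := by
  obtain ⟨X, hX⟩ := X
  change X s = g2Act _ s
  have hs : s = s.1 0 • ((![1, 0, 0], 0, 0) : ImOct) + s.1 1 • ((![0, 1, 0], 0, 0) : ImOct) +
      s.1 2 • ((![0, 0, 1], 0, 0) : ImOct) + s.2.1 0 • ((0, ![1, 0, 0], 0) : ImOct) +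
      s.2.1 1 • ((0, ![0, 1, 0], 0) : ImOct) + s.2.1 2 • ((0, ![0, 0, 1], 0) : ImOct) +
      s.2.2 • ((0, 0, 1) : ImOct) := by
    apply imOct_ext <;> simp
  have hXs : X s = s.1 0 • X (![1, 0, 0], 0, 0) + s.1 1 • X (![0, 1, 0], 0, 0) +
      s.1 2 • X (![0, 0, 1], 0, 0) + s.2.1 0 • X (0, ![1, 0, 0], 0) +
      s.2.1 1 • X (0, ![0, 1, 0], 0) + s.2.1 2 • X (0, ![0, 0, 1], 0) + s.2.2 • X (0, 0, 1) := by
    conv_lhs => rw [hs]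
    simp only [map_add, map_smul]
  have hz := hX.1 (0, 0, 1) (0, 0, 1)
  -- the invariance of the form under `e_i`, `f_j`
  have hef : ∀ a b : Fin 3 → ℂ, (X (a, 0, 0)).1 ⬝ᵥ b + a ⬝ᵥ (X (0, b, 0)).2.1 = 0 := by
    intro a b
    have := hX.1 (a, 0, 0) (0, b, 0)
    simp only [form, LinearMap.mk₂_apply, dotProduct, Fin.sum_univ_three, Pi.zero_apply] at this ⊢
    linear_combination 2 * this
  -- the derivation property on `e_i × z` and on `f_i × z`
  have hneg : ∀ t : ImOct, X (-t) = -X t := map_neg X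
  have he : ∀ a : Fin 3 → ℂ, -X (a, 0, 0) = cross (X (a, 0, 0)) (0, 0, 1) +
      cross (a, 0, 0) (X (0, 0, 1)) := by
    intro a
    rw [← hX.2, ← hneg]
    congr 1
    apply imOct_ext <;> simp [cross, cross_apply, dotProduct, Fin.sum_univ_three] <;> rfl
  have hf : ∀ b : Fin 3 → ℂ, X (0, b, 0) = cross (X (0, b, 0)) (0, 0, 1) +
      cross (0, b, 0) (X (0, 0, 1)) := by
    intro b
    rw [← hX.2]
    congr 1
    apply imOct_ext <;> simp [cross, cross_apply, dotProduct, Fin.sum_univ_three] <;> rfl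
  -- the derivation property on `e₀ × e₁ = f₂`, which shows that `A` has trace zero
  have htr : X (0, ![0, 0, 1], 0) = cross (X (![1, 0, 0], 0, 0)) (![0, 1, 0], 0, 0) +
      cross (![1, 0, 0], 0, 0) (X (![0, 1, 0], 0, 0)) := by
    rw [← hX.2]
    congr 1
    apply imOct_ext <;> simp [cross, cross_apply, dotProduct, Fin.sum_univ_three]
  simp only [form, cross, LinearMap.mk₂_apply, cross_apply, dotProduct, Fin.sum_univ_three,
    Prod.ext_iff, funext_iff, Fin.forall_fin_succ, Fin.isEmpty.forall_iff, and_true,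
    Prod.fst_add, Prod.snd_add, Prod.fst_neg, Prod.snd_neg, Prod.smul_fst, Prod.smul_snd,
    Pi.add_apply, Pi.sub_apply, Pi.smul_apply, Pi.neg_apply, Pi.zero_apply, smul_eq_mul,
    Matrix.cons_val, Fin.succ_zero_eq_one, Fin.succ_one_eq_two, mul_zero, zero_mul, zero_add,
    add_zero, mul_one, one_mul, zero_sub, sub_zero, Prod.fst_sub, Prod.snd_sub] at hz he hf htr
  have he0 := he ![1, 0, 0]
  have he1 := he ![0, 1, 0]
  have he2 := he ![0, 0, 1]
  have hf0 := hf ![1, 0, 0]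
  have hf1 := hf ![0, 1, 0]
  have hf2 := hf ![0, 0, 1]
  have h00 := hef ![1, 0, 0] ![1, 0, 0]
  have h01 := hef ![1, 0, 0] ![0, 1, 0]
  have h02 := hef ![1, 0, 0] ![0, 0, 1]
  have h10 := hef ![0, 1, 0] ![1, 0, 0]
  have h11 := hef ![0, 1, 0] ![0, 1, 0]
  have h12 := hef ![0, 1, 0] ![0, 0, 1]
  have h20 := hef ![0, 0, 1] ![1, 0, 0]
  have h21 := hef ![0, 0, 1] ![0, 1, 0]
  have h22 := hef ![0, 0, 1] ![0, 0, 1]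
  simp only [dotProduct, Fin.sum_univ_three, Matrix.cons_val, mul_zero, zero_mul, zero_add,
    add_zero, mul_one, one_mul, zero_sub, sub_zero]
    at he0 he1 he2 hf0 hf1 hf2 h00 h01 h02 h10 h11 h12 h20 h21 h22
  rw [hXs]
  apply imOct_ext <;>
  · simp only [g2Act, g2Coord, Prod.fst_add, Prod.snd_add, Prod.smul_fst, Prod.smul_snd,
      Pi.add_apply, Pi.smul_apply, smul_eq_mul, Matrix.cons_val]
    grind

theorem g2Coord_g2OfCoord (y : Fin 14 → ℂ) : g2Coord (g2OfCoord y) = y := by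
  refine funext fun k => ?_
  fin_cases k <;> simp [g2Coord, g2OfCoord, g2Act]

theorem sl2_apply_one_one (A : SL2) :
    (A : Matrix (Fin 2) (Fin 2) ℂ) 1 1 = -(A : Matrix (Fin 2) (Fin 2) ℂ) 0 0 := by
  have h : Matrix.trace (A : Matrix (Fin 2) (Fin 2) ℂ) = 0 := A.2
  rw [Matrix.trace_fin_two] at h
  linear_combination h

/-- The coordinates of the even part of `G(3)`: the entries `01`, `10`, `00` of the matrix in
`𝔰𝔩(2)`, followed by the coordinates of `G₂`. -/
def evenCoord : (SL2 × g2) ≃ₗ[ℂ] (Fin 17 → ℂ) where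
  toFun e := ![(e.1 : Matrix (Fin 2) (Fin 2) ℂ) 0 1, (e.1 : Matrix (Fin 2) (Fin 2) ℂ) 1 0,
    (e.1 : Matrix (Fin 2) (Fin 2) ℂ) 0 0, g2Coord e.2 0, g2Coord e.2 1, g2Coord e.2 2,
    g2Coord e.2 3, g2Coord e.2 4, g2Coord e.2 5, g2Coord e.2 6, g2Coord e.2 7, g2Coord e.2 8,
    g2Coord e.2 9, g2Coord e.2 10, g2Coord e.2 11, g2Coord e.2 12, g2Coord e.2 13]
  map_add' e e' := by
    refine funext fun k => ?_
    fin_cases k <;> simp [g2Coord, add_div]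
  map_smul' c e := by
    refine funext fun k => ?_
    fin_cases k <;> simp [g2Coord, mul_div_assoc]
  invFun c := (⟨!![c 2, c 0; c 1, -c 2], (LieAlgebra.SpecialLinear.sl _ _).mem_toSubmodule.mp (by
    simp [LieAlgebra.SpecialLinear.sl])⟩,
    g2OfCoord ![c 3, c 4, c 5, c 6, c 7, c 8, c 9, c 10, c 11, c 12, c 13, c 14, c 15, c 16])
  left_inv e := by
    refine Prod.ext (Subtype.ext ?_) (Subtype.ext (LinearMap.ext fun s => ?_))
    · ext a b
      fin_cases a <;> fin_cases b <;> simp [sl2_apply_one_one]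
    · rw [g2_apply e.2, g2_apply, g2Coord_g2OfCoord]
      rfl
  right_inv c := by
    refine funext fun k => ?_
    fin_cases k <;> simp [g2Coord_g2OfCoord]

/-- The coordinates of the odd part `ℂ² ⊗ ℂ⁷` of `G(3)`. -/
def oddCoord : (Fin 2 → ImOct) ≃ₗ[ℂ] (Fin 14 → ℂ) where
  toFun P := ![(P 0).1 0, (P 0).1 1, (P 0).1 2, (P 0).2.1 0, (P 0).2.1 1, (P 0).2.1 2, (P 0).2.2,
    (P 1).1 0, (P 1).1 1, (P 1).1 2, (P 1).2.1 0, (P 1).2.1 1, (P 1).2.1 2, (P 1).2.2]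
  map_add' P Q := by
    refine funext fun k => ?_
    fin_cases k <;> rfl
  map_smul' c P := by
    refine funext fun k => ?_
    fin_cases k <;> rfl
  invFun c := ![(![c 0, c 1, c 2], ![c 3, c 4, c 5], c 6),
    (![c 7, c 8, c 9], ![c 10, c 11, c 12], c 13)]
  left_inv P := by
    refine funext fun a => ?_
    fin_cases a <;> apply imOct_ext <;> rfl
  right_inv c := by
    refine funext fun k => ?_
    fin_cases k <;> rfl

/-- The weights of `evenCoord`, in the basis `δ, ε₁, ε₂` and doubled. -/
def evenWeight : Fin 17 → Fin 3 → ℤ :=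
  ![![4, 0, 0], ![-4, 0, 0], ![0, 0, 0], ![0, 0, 0], ![0, 0, 0], ![0, 2, -2], ![0, 4, 2],
    ![0, -2, 2], ![0, 2, 4], ![0, -4, -2], ![0, -2, -4], ![0, 2, 0], ![0, 0, 2], ![0, -2, -2],
    ![0, -2, 0], ![0, 0, -2], ![0, 2, 2]]

/-- The weights of `oddCoord`, in the basis `δ, ε₁, ε₂` and doubled. -/
def oddWeight : Fin 14 → Fin 3 → ℤ :=
  ![![2, 2, 0], ![2, 0, 2], ![2, -2, -2], ![2, -2, 0], ![2, 0, -2], ![2, 2, 2], ![2, 0, 0],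
    ![-2, 2, 0], ![-2, 0, 2], ![-2, -2, -2], ![-2, -2, 0], ![-2, 0, -2], ![-2, 2, 2], ![-2, 0, 0]]

theorem cartan_snd_apply (x : Fin 3 → ℂ) (s : ImOct) : (cartan x).2.1 s =
    (![x 1 * s.1 0, x 2 * s.1 1, -(x 1 + x 2) * s.1 2],
      ![-(x 1) * s.2.1 0, -(x 2) * s.2.1 1, (x 1 + x 2) * s.2.1 2], 0) := by
  apply imOct_ext <;> simp [cartan]
  ring

theorem act_apply (e : SL2 × g2) (P : Fin 2 → ImOct) (a : Fin 2) :
    superalgebra.act e P a = (e.1 : Matrix (Fin 2) (Fin 2) ℂ) a 0 • P 0 +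
      (e.1 : Matrix (Fin 2) (Fin 2) ℂ) a 1 • P 1 + e.2.1 (P a) := by
  change ∑ b, (e.1 : Matrix (Fin 2) (Fin 2) ℂ) a b • P b + e.2.1 (P a) = _
  rw [Fin.sum_univ_two]

theorem lie_fst_coe (e e' : SL2 × g2) : (⁅e, e'⁆.1 : Matrix (Fin 2) (Fin 2) ℂ) =
    (e.1 : Matrix (Fin 2) (Fin 2) ℂ) * e'.1 - (e'.1 : Matrix (Fin 2) (Fin 2) ℂ) * e.1 := rfl

theorem lie_snd_apply (e e' : SL2 × g2) (s : ImOct) :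
    ⁅e, e'⁆.2.1 s = e.2.1 (e'.2.1 s) - e'.2.1 (e.2.1 s) := rfl

/-- The weight coordinates of `G(3)`. -/
def weightCoords : WeightCoords superalgebra cartan 17 14 where
  LE := evenCoord
  LO := oddCoord
  wE := evenWeight
  wO := oddWeight
  lie_cartan x e k := by
    have he := g2_apply e.2
    generalize g2Coord e.2 = y at he
    fin_cases k <;>
    simp only [evenCoord, evenWeight, LinearEquiv.coe_mk, LinearMap.coe_mk, AddHom.coe_mk,
      lie_fst_coe, Matrix.sub_apply, Matrix.mul_apply, Fin.sum_univ_two, Fin.sum_univ_three,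
      g2Coord, lie_snd_apply, cartan_snd_apply, he, g2Act, Matrix.cons_val,
      Fin.zero_eta, Fin.mk_one, Fin.reduceFinMk, Prod.fst_sub, Prod.snd_sub, Pi.sub_apply,
      Pi.zero_apply] <;>
    simp [cartan, sl2Diag, sl2_apply_one_one] <;> ring
  act_cartan x P k := by
    fin_cases k <;>
    simp only [oddCoord, oddWeight, LinearEquiv.coe_mk, LinearMap.coe_mk, AddHom.coe_mk,
      act_apply, Fin.sum_univ_three, cartan_snd_apply, Matrix.cons_val,
      Fin.zero_eta, Fin.mk_one, Fin.reduceFinMk, Prod.fst_add, Prod.snd_add, Pi.add_apply,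
      Prod.smul_fst, Prod.smul_snd, Pi.smul_apply] <;>
    simp [cartan, sl2Diag] <;> ring

theorem isCenterless : superalgebra.IsCenterless :=
  isCenterless_ofOrthogonal _ _ _ _ _ _ _ _

end G3

/-! ### Integral submanifolds for `G(3)` -/

namespace G3

open LieSuperalgebra

theorem g2Coord_lie_seven (X Y : g2) : g2Coord ⁅X, Y⁆ 7 =
    g2Coord X 6 * g2Coord Y 2 - g2Coord Y 6 * g2Coord X 2 +
      g2Coord X 7 * (2 * g2Coord Y 1 + g2Coord Y 0) -
      g2Coord Y 7 * (2 * g2Coord X 1 + g2Coord X 0) +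
      3 * (g2Coord X 10 * g2Coord Y 12 - g2Coord X 12 * g2Coord Y 10) := by
  have h : g2Coord ⁅X, Y⁆ 7 =
    (X.1 (Y.1 (![0, 1, 0], 0, 0))).1 2 - (Y.1 (X.1 (![0, 1, 0], 0, 0))).1 2 := rfl
  simp only [h, g2_apply, g2Act, Matrix.cons_val, Pi.zero_apply]
  ring

theorem g2Coord_lie_ten (X Y : g2) : g2Coord ⁅X, Y⁆ 10 =
    g2Coord X 6 * g2Coord Y 8 - g2Coord Y 6 * g2Coord X 8 +
      (g2Coord X 7 * g2Coord Y 9 - g2Coord Y 7 * g2Coord X 9) -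
      ((g2Coord X 0 + g2Coord X 1) * g2Coord Y 10 - (g2Coord Y 0 + g2Coord Y 1) * g2Coord X 10) -
      2 * (g2Coord X 11 * g2Coord Y 12 - g2Coord X 12 * g2Coord Y 11) := by
  have h : g2Coord ⁅X, Y⁆ 10 =
    ((X.1 (Y.1 (0, 0, 1))).1 2 - (Y.1 (X.1 (0, 0, 1))).1 2) / 2 := rfl
  simp only [h, g2_apply, g2Act, Matrix.cons_val, Pi.zero_apply]
  ring

theorem g2Coord_der_seven (s t : ImOct) :
    g2Coord (der s t) 7 = 3 / 4 * (s.1 2 * t.2.1 1 - s.2.1 1 * t.1 2) := by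
  have h : g2Coord (der s t) 7 = (derEnd s t (![0, 1, 0], 0, 0)).1 2 := rfl
  simp only [h, derEnd_apply, cross, form, LinearMap.mk₂_apply, cross_apply, dotProduct,
    Fin.sum_univ_three, Prod.fst_add, Prod.snd_add, Prod.fst_sub, Prod.snd_sub, Prod.smul_fst,
    Prod.smul_snd, Pi.add_apply, Pi.sub_apply, Pi.smul_apply, smul_eq_mul, Matrix.cons_val,
    Pi.zero_apply]
  ring

theorem g2Coord_der_ten (s t : ImOct) : g2Coord (der s t) 10 =
    1 / 2 * (s.2.2 * t.1 2 - t.2.2 * s.1 2) -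
      1 / 4 * (s.2.1 0 * t.2.1 1 - s.2.1 1 * t.2.1 0) := by
  have h : g2Coord (der s t) 10 = (derEnd s t (0, 0, 1)).1 2 / 2 := rfl
  simp only [h, derEnd_apply, cross, form, LinearMap.mk₂_apply, cross_apply, dotProduct,
    Fin.sum_univ_three, Prod.fst_add, Prod.snd_add, Prod.fst_sub, Prod.snd_sub, Prod.smul_fst,
    Prod.smul_snd, Pi.add_apply, Pi.sub_apply, Pi.smul_apply, smul_eq_mul, Matrix.cons_val,
    Pi.zero_apply]
  ring

variable {p q : ℕ} {x : Fin 3 → ℤ}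

/-- The component of weight `ε₃ - ε₂` of the bracket of even elements. -/
theorem lie_coord_ten (e e' : SL2 × g2) : weightCoords.LE ⁅e, e'⁆ 10 =
    weightCoords.LE e 9 * weightCoords.LE e' 5 - weightCoords.LE e' 9 * weightCoords.LE e 5 +
      weightCoords.LE e 10 * (2 * weightCoords.LE e' 4 + weightCoords.LE e' 3) -
      weightCoords.LE e' 10 * (2 * weightCoords.LE e 4 + weightCoords.LE e 3) +
      3 * (weightCoords.LE e 13 * weightCoords.LE e' 15 -
        weightCoords.LE e 15 * weightCoords.LE e' 13) :=
  g2Coord_lie_seven e.2 e'.2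

/-- The component of weight `ε₃` of the bracket of even elements. -/
theorem lie_coord_thirteen (e e' : SL2 × g2) : weightCoords.LE ⁅e, e'⁆ 13 =
    weightCoords.LE e 9 * weightCoords.LE e' 11 - weightCoords.LE e' 9 * weightCoords.LE e 11 +
      (weightCoords.LE e 10 * weightCoords.LE e' 12 -
        weightCoords.LE e' 10 * weightCoords.LE e 12) -
      ((weightCoords.LE e 3 + weightCoords.LE e 4) * weightCoords.LE e' 13 -
        (weightCoords.LE e' 3 + weightCoords.LE e' 4) * weightCoords.LE e 13) -
      2 * (weightCoords.LE e 14 * weightCoords.LE e' 15 -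
        weightCoords.LE e 15 * weightCoords.LE e' 14) :=
  g2Coord_lie_ten e.2 e'.2

/-- The component of weight `-2δ` of the bracket of odd elements. -/
theorem odd_coord_one (P Q : Fin 2 → ImOct) : weightCoords.LE (superalgebra.odd P Q) 1 =
    2 * weightCoords.LO P 13 * weightCoords.LO Q 13 -
      (weightCoords.LO P 7 * weightCoords.LO Q 10 + weightCoords.LO P 8 * weightCoords.LO Q 11 +
        weightCoords.LO P 9 * weightCoords.LO Q 12 + weightCoords.LO P 10 * weightCoords.LO Q 7 +
        weightCoords.LO P 11 * weightCoords.LO Q 8 +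
        weightCoords.LO P 12 * weightCoords.LO Q 9) := by
  have h : weightCoords.LE (superalgebra.odd P Q) 1 =
    -(form (P 1) (Q 1) + form (Q 1) (P 1)) + 0 := rfl
  rw [h]
  simp only [weightCoords, oddCoord, form, LinearEquiv.coe_mk, LinearMap.coe_mk, AddHom.coe_mk,
    LinearMap.mk₂_apply, dotProduct, Fin.sum_univ_three, Matrix.cons_val]
  ring

/-- The component of weight `ε₃ - ε₂` of the bracket of odd elements. -/
theorem odd_coord_ten (P Q : Fin 2 → ImOct) : weightCoords.LE (superalgebra.odd P Q) 10 =
    3 / 4 * (weightCoords.LO P 2 * weightCoords.LO Q 11 -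
      weightCoords.LO P 4 * weightCoords.LO Q 9 -
      weightCoords.LO P 9 * weightCoords.LO Q 4 + weightCoords.LO P 11 * weightCoords.LO Q 2) := by
  have h : weightCoords.LE (superalgebra.odd P Q) 10 =
    0 + (g2Coord (der (P 0) (Q 1)) 7 + g2Coord (der (Q 0) (P 1)) 7) := rfl
  rw [h, g2Coord_der_seven, g2Coord_der_seven]
  simp only [weightCoords, oddCoord, LinearEquiv.coe_mk, LinearMap.coe_mk, AddHom.coe_mk,
    Matrix.cons_val]
  ring

/-- The component of weight `ε₃` of the bracket of odd elements. -/
theorem odd_coord_thirteen (P Q : Fin 2 → ImOct) : weightCoords.LE (superalgebra.odd P Q) 13 =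
    1 / 2 * (weightCoords.LO P 6 * weightCoords.LO Q 9 + weightCoords.LO P 9 * weightCoords.LO Q 6 -
        weightCoords.LO P 2 * weightCoords.LO Q 13 - weightCoords.LO P 13 * weightCoords.LO Q 2) -
      1 / 4 * (weightCoords.LO P 3 * weightCoords.LO Q 11 -
        weightCoords.LO P 4 * weightCoords.LO Q 10 -
        weightCoords.LO P 10 * weightCoords.LO Q 4 +
        weightCoords.LO P 11 * weightCoords.LO Q 3) := by
  have h1 : ((der (P 0) (Q 1)).1 (0, 0, 1)).1 2 / 2 = _ := g2Coord_der_ten (P 0) (Q 1)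
  have h2 : ((der (Q 0) (P 1)).1 (0, 0, 1)).1 2 / 2 = _ := g2Coord_der_ten (Q 0) (P 1)
  have h : weightCoords.LE (superalgebra.odd P Q) 13 =
    (0 + (((der (P 0) (Q 1)).1 (0, 0, 1)).1 2 + ((der (Q 0) (P 1)).1 (0, 0, 1)).1 2)) / 2 := rfl
  rw [h]
  simp only [weightCoords, oddCoord, LinearEquiv.coe_mk, LinearMap.coe_mk, AddHom.coe_mk,
    Matrix.cons_val]
  linear_combination h1 + h2

/-- The component of weight `-δ` of the action of an even on an odd element. -/
theorem act_coord_thirteen (e : SL2 × g2) (P : Fin 2 → ImOct) :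
    weightCoords.LO (superalgebra.act e P) 13 =
      weightCoords.LE e 1 * weightCoords.LO P 6 - weightCoords.LE e 2 * weightCoords.LO P 13 +
      (weightCoords.LE e 14 * weightCoords.LO P 7 + weightCoords.LE e 15 * weightCoords.LO P 8 +
        weightCoords.LE e 16 * weightCoords.LO P 9 + weightCoords.LE e 11 * weightCoords.LO P 10 +
        weightCoords.LE e 12 * weightCoords.LO P 11 +
        weightCoords.LE e 13 * weightCoords.LO P 12) := by
  have h : weightCoords.LO (superalgebra.act e P) 13 = (superalgebra.act e P 1).2.2 := rfl
  simp only [h, act_apply, g2_apply, g2Act, sl2_apply_one_one, weightCoords, oddCoord, evenCoord,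
    LinearEquiv.coe_mk, LinearMap.coe_mk, AddHom.coe_mk, Matrix.cons_val, Prod.snd_add,
    Prod.smul_snd, smul_eq_mul]
  ring

/-- The case that the even part of `𝔤_{-1}` has the weights `-ε₁` and `-ε₂`, and a nondegenerate
alternating bracket with values in the root space of `ε₃ = -ε₁ - ε₂`. -/
theorem even_le_one (h : superalgebra.IsAbelianDim (cartan fun i => (x i : ℂ)) p q)
    (hx : ∀ k, weightCoords.degE x k = -2 → ∃ j, ![14, 15] j = k) : p ≤ 1 := by
  obtain ⟨e, o, he, ho, hge, hgo, hee, heo, hoo⟩ := h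
  have hE := fun i => weightCoords.even_eq_zero (hge i) hx
  have := two_mul_le_of_isotropic (weightCoords.linearIndependent_even he hge ![14, 15] hx)
    ![-2, 2] Fin.rev (by simp [Fin.forall_fin_succ]) Fin.rev_injective fun i j => by
      have h := lie_coord_thirteen (e i) (e j)
      simp (disch := decide) only [hee, map_zero, Pi.zero_apply, hE] at h
      simp only [Fin.sum_univ_two, Fin.reduceRev, Matrix.cons_val]
      linear_combination -h
  omega

/-- The case that the even part of `𝔤_{-1}` has the weights `ε₁ - ε₂`, `ε₃`, `-ε₂` and `ε₃ - ε₁`,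
and a nondegenerate alternating bracket with values in the root space of `ε₃ - ε₂`. -/
theorem even_le_two (h : superalgebra.IsAbelianDim (cartan fun i => (x i : ℂ)) p q)
    (hx : ∀ k, weightCoords.degE x k = -2 → ∃ j, ![5, 13, 15, 9] j = k) : p ≤ 2 := by
  obtain ⟨e, o, he, ho, hge, hgo, hee, heo, hoo⟩ := h
  have hE := fun i => weightCoords.even_eq_zero (hge i) hx
  have := two_mul_le_of_isotropic (weightCoords.linearIndependent_even he hge ![5, 13, 15, 9] hx)
    ![-1, 3, -3, 1] Fin.rev (by simp [Fin.forall_fin_succ]) Fin.rev_injective fun i j => by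
      have h := lie_coord_ten (e i) (e j)
      simp (disch := decide) only [hee, map_zero, Pi.zero_apply, hE] at h
      simp only [Fin.sum_univ_four, Fin.reduceRev, Matrix.cons_val]
      linear_combination -h
  omega

/-- Here `𝔤_{-1} = ℂ⁷` is odd, and its bracket is the invariant form with values in the root space
of `-2δ`. -/
theorem dims_one_zero_zero :
    superDim (superalgebra.gr (cartan fun i => ((![1, 0, 0] : Fin 3 → ℤ) i : ℂ)) (-1)) = (0, 7) ∧
    superalgebra.maxIntegralDims (cartan fun i => ((![1, 0, 0] : Fin 3 → ℤ) i : ℂ)) = {(0, 3)} := by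
  refine ⟨(weightCoords.superDim_gr _).trans (by decide),
    maxIntegralDims_eq isCenterless (by simp) ?_ fun p q h => ⟨_, rfl, ?_⟩⟩
  · rintro _ rfl
    exact weightCoords.isAbelianDim _ ![] ![7, 8, 9] (by decide) (by decide) (by decide) (by decide)
      (by decide) (by decide) (by decide)
  · obtain ⟨e, o, he, ho, hge, hgo, hee, heo, hoo⟩ := h
    have := two_mul_le_of_isotropic
      (weightCoords.linearIndependent_odd ho hgo ![7, 8, 9, 13, 12, 11, 10] (by decide))
      ![-1, -1, -1, 2, -1, -1, -1] Fin.rev (by simp [Fin.forall_fin_succ]) Fin.rev_injective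
      fun i j => by
        have h := odd_coord_one (o i) (o j)
        simp only [hoo, map_zero, Pi.zero_apply] at h
        simp only [Fin.sum_univ_seven, Fin.reduceRev, Matrix.cons_val]
        linear_combination -h
    exact ⟨weightCoords.le_of_linearIndependent_even he hge ![] (by decide), by
      change q ≤ 3; omega⟩

/-- Here the weights of `𝔤_{-1}` are `-ε₁`, `-ε₂` and `-δ + ε₁`, `-δ + ε₂`. The odd part is abelian,
and the action on it of the even part is a perfect pairing with values in the weight space of `-δ`.
-/
theorem dims_two_one_one :
    superDim (superalgebra.gr (cartan fun i => ((![2, 1, 1] : Fin 3 → ℤ) i : ℂ)) (-1)) = (2, 2) ∧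
    superalgebra.maxIntegralDims (cartan fun i => ((![2, 1, 1] : Fin 3 → ℤ) i : ℂ)) =
      {(1, 1), (0, 2)} := by
  refine ⟨(weightCoords.superDim_gr _).trans (by decide),
    maxIntegralDims_eq isCenterless (by simp [IsAntichain, Set.Pairwise]) ?_ fun p q h => ?_⟩
  · rintro _ (rfl | rfl)
    · exact weightCoords.isAbelianDim _ ![14] ![8] (by decide) (by decide) (by decide) (by decide)
        (by decide) (by decide) (by decide)
    · exact weightCoords.isAbelianDim _ ![] ![7, 8] (by decide) (by decide) (by decide) (by decide)
        (by decide) (by decide) (by decide)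
  · have hp := even_le_one h (by decide)
    obtain ⟨e, o, he, ho, hge, hgo, hee, heo, hoo⟩ := h
    have hE := fun i => weightCoords.even_mem_gr.1 (hge i)
    have hO := fun i => weightCoords.odd_mem_gr.1 (hgo i)
    have := add_le_of_dotProduct_eq_zero
      (weightCoords.linearIndependent_even he hge ![14, 15] (by decide))
      (weightCoords.linearIndependent_odd ho hgo ![7, 8] (by decide)) fun i j => by
        have h := act_coord_thirteen (e i) (o j)
        simp (disch := decide) only [heo, map_zero, Pi.zero_apply, hE, hO] at h
        simp only [dotProduct, Fin.sum_univ_two, Matrix.cons_val]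
        linear_combination -h
    rcases Nat.eq_zero_or_pos p with rfl | hp'
    · exact ⟨(0, 2), by simp, le_refl _, by change q ≤ 2; omega⟩
    · exact ⟨(1, 1), by simp, hp, by change q ≤ 1; omega⟩

/-- The odd weights `-δ + ε₁`, `-δ`, `-δ - ε₁` are paired by the root `-2δ`. -/
theorem dims_one_zero_one :
    superDim (superalgebra.gr (cartan fun i => ((![1, 0, 1] : Fin 3 → ℤ) i : ℂ)) (-1)) = (4, 3) ∧
    superalgebra.maxIntegralDims (cartan fun i => ((![1, 0, 1] : Fin 3 → ℤ) i : ℂ)) = {(2, 1)} := by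
  refine ⟨(weightCoords.superDim_gr _).trans (by decide),
    maxIntegralDims_eq isCenterless (by simp) ?_ fun p q h =>
      ⟨_, rfl, even_le_two h (by decide), ?_⟩⟩
  · rintro _ rfl
    exact weightCoords.isAbelianDim _ ![5, 15] ![7] (by decide) (by decide) (by decide) (by decide)
      (by decide) (by decide) (by decide)
  · obtain ⟨e, o, he, ho, hge, hgo, hee, heo, hoo⟩ := h
    have hO := fun i => weightCoords.odd_mem_gr.1 (hgo i)
    have := two_mul_le_of_isotropic
      (weightCoords.linearIndependent_odd ho hgo ![7, 13, 10] (by decide)) ![-1, 2, -1]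
      Fin.rev (by simp [Fin.forall_fin_succ]) Fin.rev_injective fun i j => by
        have h := odd_coord_one (o i) (o j)
        simp (disch := decide) only [hoo, map_zero, Pi.zero_apply, hO] at h
        simp only [Fin.sum_univ_three, Fin.reduceRev, Matrix.cons_val]
        linear_combination -h
    change q ≤ 1
    omega

/-- The odd weights `δ + ε₃` and `-δ` are paired by the root `ε₃`. -/
theorem dims_one_one_one :
    superDim (superalgebra.gr (cartan fun i => ((![1, 1, 1] : Fin 3 → ℤ) i : ℂ)) (-1)) = (2, 2) ∧
    superalgebra.maxIntegralDims (cartan fun i => ((![1, 1, 1] : Fin 3 → ℤ) i : ℂ)) = {(1, 1)} := by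
  refine ⟨(weightCoords.superDim_gr _).trans (by decide),
    maxIntegralDims_eq isCenterless (by simp) ?_ fun p q h =>
      ⟨_, rfl, even_le_one h (by decide), ?_⟩⟩
  · rintro _ rfl
    exact weightCoords.isAbelianDim _ ![14] ![2] (by decide) (by decide) (by decide) (by decide)
      (by decide) (by decide) (by decide)
  · obtain ⟨e, o, he, ho, hge, hgo, hee, heo, hoo⟩ := h
    have hO := fun i => weightCoords.odd_mem_gr.1 (hgo i)
    have := two_mul_le_of_isotropic
      (weightCoords.linearIndependent_odd ho hgo ![2, 13] (by decide)) ![1, 1]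
      Fin.rev (by simp [Fin.forall_fin_succ]) Fin.rev_injective fun i j => by
        have h := odd_coord_thirteen (o i) (o j)
        simp (disch := decide) only [hoo, map_zero, Pi.zero_apply, hO] at h
        simp only [Fin.sum_univ_two, Fin.reduceRev, Matrix.cons_val]
        linear_combination 2 * h
    change q ≤ 1
    omega

/-- The odd weights `±δ + ε₃` and `±δ - ε₂` are paired by the root `ε₃ - ε₂`. -/
theorem dims_zero_zero_one :
    superDim (superalgebra.gr (cartan fun i => ((![0, 0, 1] : Fin 3 → ℤ) i : ℂ)) (-1)) = (4, 4) ∧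
    superalgebra.maxIntegralDims (cartan fun i => ((![0, 0, 1] : Fin 3 → ℤ) i : ℂ)) = {(2, 2)} := by
  refine ⟨(weightCoords.superDim_gr _).trans (by decide),
    maxIntegralDims_eq isCenterless (by simp) ?_ fun p q h =>
      ⟨_, rfl, even_le_two h (by decide), ?_⟩⟩
  · rintro _ rfl
    exact weightCoords.isAbelianDim _ ![5, 15] ![4, 11] (by decide) (by decide) (by decide)
      (by decide) (by decide) (by decide) (by decide)
  · obtain ⟨e, o, he, ho, hge, hgo, hee, heo, hoo⟩ := h
    have hO := fun i => weightCoords.odd_mem_gr.1 (hgo i)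
    have := two_mul_le_of_isotropic
      (weightCoords.linearIndependent_odd ho hgo ![2, 4, 9, 11] (by decide)) ![1, -1, -1, 1]
      Fin.rev (by simp [Fin.forall_fin_succ]) Fin.rev_injective fun i j => by
        have h := odd_coord_ten (o i) (o j)
        simp (disch := decide) only [hoo, map_zero, Pi.zero_apply, hO] at h
        simp only [Fin.sum_univ_four, Fin.reduceRev, Matrix.cons_val]
        linear_combination -(4 / 3) * h
    change q ≤ 2
    omega

/-- The odd weights `±δ - ε₁` and `±δ - ε₂` are paired by the root `ε₃ = -ε₁ - ε₂`. -/
theorem dims_zero_one_one :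
    superDim (superalgebra.gr (cartan fun i => ((![0, 1, 1] : Fin 3 → ℤ) i : ℂ)) (-1)) = (2, 4) ∧
    superalgebra.maxIntegralDims (cartan fun i => ((![0, 1, 1] : Fin 3 → ℤ) i : ℂ)) = {(1, 2)} := by
  refine ⟨(weightCoords.superDim_gr _).trans (by decide),
    maxIntegralDims_eq isCenterless (by simp) ?_ fun p q h =>
      ⟨_, rfl, even_le_one h (by decide), ?_⟩⟩
  · rintro _ rfl
    exact weightCoords.isAbelianDim _ ![14] ![3, 10] (by decide) (by decide) (by decide) (by decide)
      (by decide) (by decide) (by decide)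
  · obtain ⟨e, o, he, ho, hge, hgo, hee, heo, hoo⟩ := h
    have hO := fun i => weightCoords.odd_mem_gr.1 (hgo i)
    have := two_mul_le_of_isotropic
      (weightCoords.linearIndependent_odd ho hgo ![3, 4, 10, 11] (by decide)) ![1, -1, -1, 1]
      Fin.rev (by simp [Fin.forall_fin_succ]) Fin.rev_injective fun i j => by
        have h := odd_coord_thirteen (o i) (o j)
        simp (disch := decide) only [hoo, map_zero, Pi.zero_apply, hO] at h
        simp only [Fin.sum_univ_four, Fin.reduceRev, Matrix.cons_val]
        linear_combination 4 * h
    change q ≤ 2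
    omega

/-- The coordinates `x` of the grading elements `Z = cartan x`. -/
def gradingVector : Diagram → Fin 3 → Fin 3 → ℤ
  | .I => ![![1, 0, 0], ![2, 1, 1], ![1, 0, 1]]
  | .II => ![![1, 1, 1], ![2, 1, 1], ![1, 0, 1]]
  | .III => ![![0, 0, 1], ![1, 0, 1], ![1, 1, 1]]
  | .IV => ![![0, 0, 1], ![0, 1, 1], ![1, 1, 1]]

theorem isGrading_gradingVector (Ξ : Diagram) (i : Fin 3) :
    IsGrading Ξ i fun k => (gradingVector Ξ i k : ℂ) := by
  refine funext fun k => ?_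
  cases Ξ <;> fin_cases i <;> fin_cases k <;> simp [simpleRoot, gradingVector] <;> norm_num

theorem superDim_and_maxIntegralDims (Ξ : Diagram) (i : Fin 3) (x : Fin 3 → ℂ)
    (hx : IsGrading Ξ i x) :
    superDim (superalgebra.gr (cartan x) (-1)) = dimTable Ξ i ∧
      superalgebra.maxIntegralDims (cartan x) = maxDimTable Ξ i := by
  obtain rfl := (existsUnique_isGrading Ξ i).unique hx (isGrading_gradingVector Ξ i)
  cases Ξ <;> fin_cases i
  exacts [dims_one_zero_zero, dims_two_one_one, dims_one_zero_one, dims_one_one_one,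
    dims_two_one_one, dims_one_zero_one, dims_zero_zero_one, dims_one_zero_one,
    dims_one_one_one, dims_zero_zero_one, dims_zero_one_one, dims_one_one_one]

end G3

/-! ### Weight coordinates of `F(4)` -/

namespace F4

open LieSuperalgebra

/-- The matrix `A` of `spinAct`, from its entries `A₀₀, A₁₁, A₂₂` and its entries off the diagonal,
row by row. The entry `A₃₃` is not used by `spinAct`. -/
def slMatrix (y : Fin 21 → ℂ) : Fin 4 → Fin 4 → ℂ :=
  ![![y 0, y 3, y 4, y 5], ![y 6, y 1, y 7, y 8], ![y 9, y 10, y 2, y 11],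
    ![y 12, y 13, y 14, 0]]

/-- The vector `p` of `spinAct`. -/
def pVector (y : Fin 21 → ℂ) : Fin 6 → ℂ := ![y 15, y 16, y 17, y 18, y 19, y 20]

/-- The endomorphism `spinAct (slMatrix y) (pVector y)` as an element of `𝔰𝔭𝔦𝔫(7)`. -/
def spinOfCoord (y : Fin 21 → ℂ) : spin7 :=
  ⟨{ toFun := spinAct (slMatrix y) (pVector y)
     map_add' := fun s t => by
      apply spinor_ext <;> simp only [spinAct, Prod.fst_add, Prod.snd_add, Pi.add_apply,
        Matrix.cons_val] <;> ring
     map_smul' := fun c s => by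
      apply spinor_ext <;> simp only [spinAct, Prod.smul_fst, Prod.smul_snd, Pi.smul_apply,
        smul_eq_mul, Matrix.cons_val, RingHom.id_apply] <;> ring },
    spinAct_form _ _, spinAct_triple _ _⟩

/-- The coordinates of an element of `𝔰𝔭𝔦𝔫(7)`. -/
def spinCoord (X : spin7) : Fin 21 → ℂ :=
  ![(X.1 (![1, 0, 0, 0], 0)).1 0, (X.1 (![0, 1, 0, 0], 0)).1 1, (X.1 (![0, 0, 1, 0], 0)).1 2,
    (X.1 (![0, 1, 0, 0], 0)).1 0, (X.1 (![0, 0, 1, 0], 0)).1 0, (X.1 (![0, 0, 0, 1], 0)).1 0,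
    (X.1 (![1, 0, 0, 0], 0)).1 1, (X.1 (![0, 0, 1, 0], 0)).1 1, (X.1 (![0, 0, 0, 1], 0)).1 1,
    (X.1 (![1, 0, 0, 0], 0)).1 2, (X.1 (![0, 1, 0, 0], 0)).1 2, (X.1 (![0, 0, 0, 1], 0)).1 2,
    (X.1 (![1, 0, 0, 0], 0)).1 3, (X.1 (![0, 1, 0, 0], 0)).1 3, (X.1 (![0, 0, 1, 0], 0)).1 3,
    (X.1 (0, ![0, 1, 0, 0])).1 0, (X.1 (0, ![0, 0, 1, 0])).1 0, (X.1 (0, ![0, 0, 0, 1])).1 0,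
    (X.1 (0, ![0, 0, 1, 0])).1 1, (X.1 (0, ![0, 0, 0, 1])).1 1, (X.1 (0, ![0, 0, 0, 1])).1 2]

set_option maxHeartbeats 1000000 in
/-- Every element of `𝔰𝔭𝔦𝔫(7)` is of the form `spinAct A p`. -/
theorem spin7_apply (X : spin7) (s : Spinor) :
    X.1 s = spinAct (slMatrix (spinCoord X)) (pVector (spinCoord X)) s := by
  obtain ⟨X, hX⟩ := X
  change X s = spinAct _ _ s
  have hs : s = s.1 0 • ((![1, 0, 0, 0], 0) : Spinor) + s.1 1 • ((![0, 1, 0, 0], 0) : Spinor) +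
      s.1 2 • ((![0, 0, 1, 0], 0) : Spinor) + s.1 3 • ((![0, 0, 0, 1], 0) : Spinor) +
      s.2 0 • ((0, ![1, 0, 0, 0]) : Spinor) + s.2 1 • ((0, ![0, 1, 0, 0]) : Spinor) +
      s.2 2 • ((0, ![0, 0, 1, 0]) : Spinor) + s.2 3 • ((0, ![0, 0, 0, 1]) : Spinor) := by
    apply spinor_ext <;> simp
  have hXs : X s = s.1 0 • X (![1, 0, 0, 0], 0) + s.1 1 • X (![0, 1, 0, 0], 0) +
      s.1 2 • X (![0, 0, 1, 0], 0) + s.1 3 • X (![0, 0, 0, 1], 0) +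
      s.2 0 • X (0, ![1, 0, 0, 0]) + s.2 1 • X (0, ![0, 1, 0, 0]) +
      s.2 2 • X (0, ![0, 0, 1, 0]) + s.2 3 • X (0, ![0, 0, 0, 1]) := by
    conv_lhs => rw [hs]
    simp only [map_add, map_smul]
  -- the invariance of the form under `e_i` and `f_j`
  have hee : ∀ a b : Fin 4 → ℂ, (X (a, 0)).2 ⬝ᵥ b + a ⬝ᵥ (X (b, 0)).2 = 0 := by
    intro a b
    have := hX.1 (a, 0) (b, 0)
    simp only [form, LinearMap.mk₂_apply, dotProduct, Fin.sum_univ_four, Pi.zero_apply] at this ⊢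
    linear_combination this
  have hff : ∀ a b : Fin 4 → ℂ, (X (0, a)).1 ⬝ᵥ b + a ⬝ᵥ (X (0, b)).1 = 0 := by
    intro a b
    have := hX.1 (0, a) (0, b)
    simp only [form, LinearMap.mk₂_apply, dotProduct, Fin.sum_univ_four, Pi.zero_apply] at this ⊢
    linear_combination this
  have hef : ∀ a b : Fin 4 → ℂ, (X (a, 0)).1 ⬝ᵥ b + a ⬝ᵥ (X (0, b)).2 = 0 := by
    intro a b
    have := hX.1 (a, 0) (0, b)
    simp only [form, LinearMap.mk₂_apply, dotProduct, Fin.sum_univ_four, Pi.zero_apply] at this ⊢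
    linear_combination this
  -- the derivation property on `e_i × e_j × e_k`, a multiple of one of the `f_l`
  have ht : ∀ (a b c d : Fin 4 → ℂ) (_ : d = cross₃ a b c), (2 : ℂ) • X (0, d) =
      triple (X (a, 0)) (b, 0) (c, 0) + triple (a, 0) (X (b, 0)) (c, 0) +
        triple (a, 0) (b, 0) (X (c, 0)) := by
    rintro a b c _ rfl
    rw [← hX.2, ← map_smul]
    congr 1
    apply spinor_ext <;> simp [triple_apply, tripleFun, symp, cross₃_eq, dotProduct]
  have t3 := ht ![1, 0, 0, 0] ![0, 1, 0, 0] ![0, 0, 1, 0] ![0, 0, 0, 1] (by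
    rw [cross₃_eq]; ext k; fin_cases k <;> simp)
  have t2 := ht ![1, 0, 0, 0] ![0, 0, 0, 1] ![0, 1, 0, 0] ![0, 0, 1, 0] (by
    rw [cross₃_eq]; ext k; fin_cases k <;> simp)
  have t1 := ht ![1, 0, 0, 0] ![0, 0, 1, 0] ![0, 0, 0, 1] ![0, 1, 0, 0] (by
    rw [cross₃_eq]; ext k; fin_cases k <;> simp)
  simp only [triple_apply, tripleFun, symp, cross₃_eq, dotProduct, Fin.sum_univ_four,
    Prod.ext_iff, funext_iff, Fin.forall_fin_succ, Fin.isEmpty.forall_iff, and_true,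
    Prod.fst_add, Prod.snd_add, Prod.fst_neg, Prod.snd_neg, Prod.smul_fst, Prod.smul_snd,
    Pi.add_apply, Pi.sub_apply, Pi.smul_apply, Pi.neg_apply, Pi.zero_apply, smul_eq_mul,
    Matrix.cons_val, Fin.succ_zero_eq_one, Fin.succ_one_eq_two, mul_zero, zero_mul, zero_add,
    add_zero, mul_one, one_mul, zero_sub, sub_zero, Prod.fst_sub, Prod.snd_sub, neg_zero,
    Fin.reduceSucc] at t1 t2 t3
  have e00 := hee ![1, 0, 0, 0] ![1, 0, 0, 0]
  have e01 := hee ![1, 0, 0, 0] ![0, 1, 0, 0]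
  have e02 := hee ![1, 0, 0, 0] ![0, 0, 1, 0]
  have e03 := hee ![1, 0, 0, 0] ![0, 0, 0, 1]
  have e11 := hee ![0, 1, 0, 0] ![0, 1, 0, 0]
  have e12 := hee ![0, 1, 0, 0] ![0, 0, 1, 0]
  have e13 := hee ![0, 1, 0, 0] ![0, 0, 0, 1]
  have e22 := hee ![0, 0, 1, 0] ![0, 0, 1, 0]
  have e23 := hee ![0, 0, 1, 0] ![0, 0, 0, 1]
  have e33 := hee ![0, 0, 0, 1] ![0, 0, 0, 1]
  have f00 := hff ![1, 0, 0, 0] ![1, 0, 0, 0]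
  have f01 := hff ![1, 0, 0, 0] ![0, 1, 0, 0]
  have f02 := hff ![1, 0, 0, 0] ![0, 0, 1, 0]
  have f03 := hff ![1, 0, 0, 0] ![0, 0, 0, 1]
  have f11 := hff ![0, 1, 0, 0] ![0, 1, 0, 0]
  have f12 := hff ![0, 1, 0, 0] ![0, 0, 1, 0]
  have f13 := hff ![0, 1, 0, 0] ![0, 0, 0, 1]
  have f22 := hff ![0, 0, 1, 0] ![0, 0, 1, 0]
  have f23 := hff ![0, 0, 1, 0] ![0, 0, 0, 1]
  have f33 := hff ![0, 0, 0, 1] ![0, 0, 0, 1]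
  have h := fun a : Fin 4 → ℂ => And.intro (hef a ![1, 0, 0, 0]) (And.intro (hef a ![0, 1, 0, 0])
    (And.intro (hef a ![0, 0, 1, 0]) (hef a ![0, 0, 0, 1])))
  have h0 := h ![1, 0, 0, 0]
  have h1 := h ![0, 1, 0, 0]
  have h2 := h ![0, 0, 1, 0]
  have h3 := h ![0, 0, 0, 1]
  simp only [dotProduct, Fin.sum_univ_four, Matrix.cons_val, mul_zero, zero_mul, zero_add,
    add_zero, mul_one, one_mul, zero_sub, sub_zero]
    at e00 e01 e02 e03 e11 e12 e13 e22 e23 e33 f00 f01 f02 f03 f11 f12 f13 f22 f23 f33 h0 h1 h2 h3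
  clear h hee hff hef ht hs
  rw [hXs]
  apply spinor_ext <;>
  · simp only [spinAct, slMatrix, pVector, spinCoord, Prod.fst_add, Prod.snd_add, Prod.smul_fst,
      Prod.smul_snd, Pi.add_apply, Pi.smul_apply, smul_eq_mul, Matrix.cons_val]
    grind

theorem spinCoord_spinOfCoord (y : Fin 21 → ℂ) : spinCoord (spinOfCoord y) = y := by
  refine funext fun k => ?_
  fin_cases k <;> simp [spinCoord, spinOfCoord, spinAct, slMatrix, pVector]

/-- The coordinates of the even part of `F(4)`: the entries `01`, `10`, `00` of the matrix in
`𝔰𝔩(2)`, followed by the coordinates of `𝔰𝔭𝔦𝔫(7)`. -/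
def evenCoord : (SL2 × spin7) ≃ₗ[ℂ] (Fin 24 → ℂ) where
  toFun e := ![(e.1 : Matrix (Fin 2) (Fin 2) ℂ) 0 1, (e.1 : Matrix (Fin 2) (Fin 2) ℂ) 1 0,
    (e.1 : Matrix (Fin 2) (Fin 2) ℂ) 0 0, spinCoord e.2 0, spinCoord e.2 1, spinCoord e.2 2,
    spinCoord e.2 3, spinCoord e.2 4, spinCoord e.2 5, spinCoord e.2 6, spinCoord e.2 7,
    spinCoord e.2 8, spinCoord e.2 9, spinCoord e.2 10, spinCoord e.2 11, spinCoord e.2 12,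
    spinCoord e.2 13, spinCoord e.2 14, spinCoord e.2 15, spinCoord e.2 16, spinCoord e.2 17,
    spinCoord e.2 18, spinCoord e.2 19, spinCoord e.2 20]
  map_add' e e' := by
    refine funext fun k => ?_
    fin_cases k <;> simp [spinCoord]
  map_smul' c e := by
    refine funext fun k => ?_
    fin_cases k <;> simp [spinCoord]
  invFun c := (⟨!![c 2, c 0; c 1, -c 2], (LieAlgebra.SpecialLinear.sl _ _).mem_toSubmodule.mp (by
    simp [LieAlgebra.SpecialLinear.sl])⟩,
    spinOfCoord ![c 3, c 4, c 5, c 6, c 7, c 8, c 9, c 10, c 11, c 12, c 13, c 14, c 15, c 16,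
      c 17, c 18, c 19, c 20, c 21, c 22, c 23])
  left_inv e := by
    refine Prod.ext (Subtype.ext ?_) (Subtype.ext (LinearMap.ext fun s => ?_))
    · ext a b
      fin_cases a <;> fin_cases b <;> simp [G3.sl2_apply_one_one]
    · rw [spin7_apply e.2, spin7_apply, spinCoord_spinOfCoord]
      rfl
  right_inv c := by
    refine funext fun k => ?_
    fin_cases k <;> simp [spinCoord_spinOfCoord]

/-- The coordinates of the odd part `ℂ² ⊗ ℂ⁸` of `F(4)`. -/
def oddCoord : (Fin 2 → Spinor) ≃ₗ[ℂ] (Fin 16 → ℂ) where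
  toFun P := ![(P 0).1 0, (P 0).1 1, (P 0).1 2, (P 0).1 3, (P 0).2 0, (P 0).2 1, (P 0).2 2,
    (P 0).2 3, (P 1).1 0, (P 1).1 1, (P 1).1 2, (P 1).1 3, (P 1).2 0, (P 1).2 1, (P 1).2 2,
    (P 1).2 3]
  map_add' P Q := by
    refine funext fun k => ?_
    fin_cases k <;> rfl
  map_smul' c P := by
    refine funext fun k => ?_
    fin_cases k <;> rfl
  invFun c := ![(![c 0, c 1, c 2, c 3], ![c 4, c 5, c 6, c 7]),
    (![c 8, c 9, c 10, c 11], ![c 12, c 13, c 14, c 15])]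
  left_inv P := by
    refine funext fun a => ?_
    fin_cases a <;> apply spinor_ext <;> rfl
  right_inv c := by
    refine funext fun k => ?_
    fin_cases k <;> rfl

/-- The weights of `evenCoord`, in the basis `δ, ε₁, ε₂, ε₃` and doubled. -/
def evenWeight : Fin 24 → Fin 4 → ℤ :=
  ![![2, 0, 0, 0], ![-2, 0, 0, 0], ![0, 0, 0, 0], ![0, 0, 0, 0], ![0, 0, 0, 0], ![0, 0, 0, 0],
    ![0, 0, 2, 2], ![0, 2, 0, 2], ![0, 2, 2, 0], ![0, 0, -2, -2], ![0, 2, -2, 0], ![0, 2, 0, -2],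
    ![0, -2, 0, -2], ![0, -2, 2, 0], ![0, 0, 2, -2], ![0, -2, -2, 0], ![0, -2, 0, 2],
    ![0, 0, -2, 2], ![0, 2, 0, 0], ![0, 0, 2, 0], ![0, 0, 0, 2], ![0, 0, 0, -2], ![0, 0, -2, 0],
    ![0, -2, 0, 0]]

/-- The weights of `oddCoord`, in the basis `δ, ε₁, ε₂, ε₃` and doubled. -/
def oddWeight : Fin 16 → Fin 4 → ℤ :=
  ![![1, 1, 1, 1], ![1, 1, -1, -1], ![1, -1, 1, -1], ![1, -1, -1, 1], ![1, -1, -1, -1],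
    ![1, -1, 1, 1], ![1, 1, -1, 1], ![1, 1, 1, -1], ![-1, 1, 1, 1], ![-1, 1, -1, -1],
    ![-1, -1, 1, -1], ![-1, -1, -1, 1], ![-1, -1, -1, -1], ![-1, -1, 1, 1], ![-1, 1, -1, 1],
    ![-1, 1, 1, -1]]

theorem cartan_snd_apply (x : Fin 4 → ℂ) (s : Spinor) : (cartan x).2.1 s =
    (![(x 1 + x 2 + x 3) / 2 * s.1 0, (x 1 - x 2 - x 3) / 2 * s.1 1,
        (-x 1 + x 2 - x 3) / 2 * s.1 2, (-x 1 - x 2 + x 3) / 2 * s.1 3],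
      ![-((x 1 + x 2 + x 3) / 2) * s.2 0, -((x 1 - x 2 - x 3) / 2) * s.2 1,
        -((-x 1 + x 2 - x 3) / 2) * s.2 2, -((-x 1 - x 2 + x 3) / 2) * s.2 3]) := by
  apply spinor_ext <;> simp [cartan]

theorem act_apply (e : SL2 × spin7) (P : Fin 2 → Spinor) (a : Fin 2) :
    superalgebra.act e P a = (e.1 : Matrix (Fin 2) (Fin 2) ℂ) a 0 • P 0 +
      (e.1 : Matrix (Fin 2) (Fin 2) ℂ) a 1 • P 1 + e.2.1 (P a) := by
  change ∑ b, (e.1 : Matrix (Fin 2) (Fin 2) ℂ) a b • P b + e.2.1 (P a) = _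
  rw [Fin.sum_univ_two]

theorem lie_fst_coe (e e' : SL2 × spin7) : (⁅e, e'⁆.1 : Matrix (Fin 2) (Fin 2) ℂ) =
    (e.1 : Matrix (Fin 2) (Fin 2) ℂ) * e'.1 - (e'.1 : Matrix (Fin 2) (Fin 2) ℂ) * e.1 := rfl

theorem lie_snd_apply (e e' : SL2 × spin7) (s : Spinor) :
    ⁅e, e'⁆.2.1 s = e.2.1 (e'.2.1 s) - e'.2.1 (e.2.1 s) := rfl

set_option maxHeartbeats 1000000 in
/-- The weight coordinates of `F(4)`. -/
def weightCoords : WeightCoords superalgebra cartan 24 16 where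
  LE := evenCoord
  LO := oddCoord
  wE := evenWeight
  wO := oddWeight
  lie_cartan x e k := by
    have he := spin7_apply e.2
    generalize spinCoord e.2 = y at he
    fin_cases k <;>
    simp only [evenCoord, evenWeight, LinearEquiv.coe_mk, LinearMap.coe_mk, AddHom.coe_mk,
      lie_fst_coe, Matrix.sub_apply, Matrix.mul_apply, Fin.sum_univ_two, Fin.sum_univ_four,
      spinCoord, lie_snd_apply, cartan_snd_apply, he, spinAct, slMatrix, pVector, Matrix.cons_val,
      Fin.zero_eta, Fin.mk_one, Fin.reduceFinMk, Prod.fst_sub, Prod.snd_sub, Pi.sub_apply,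
      Pi.zero_apply] <;>
    simp [cartan, sl2Diag, G3.sl2_apply_one_one] <;> ring
  act_cartan x P k := by
    fin_cases k <;>
    simp only [oddCoord, oddWeight, LinearEquiv.coe_mk, LinearMap.coe_mk, AddHom.coe_mk,
      act_apply, Fin.sum_univ_four, cartan_snd_apply, Matrix.cons_val,
      Fin.zero_eta, Fin.mk_one, Fin.reduceFinMk, Prod.fst_add, Prod.snd_add, Pi.add_apply,
      Prod.smul_fst, Prod.smul_snd, Pi.smul_apply] <;>
    simp [cartan, sl2Diag] <;> ring

theorem isCenterless : superalgebra.IsCenterless :=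
  isCenterless_ofOrthogonal _ _ _ _ _ _ _ _

end F4

/-! ### Brackets of `F(4)` in weight coordinates -/

namespace F4

open LieSuperalgebra

section Spin

variable (X Y : spin7)

theorem spinCoord_lie_six : spinCoord ⁅X, Y⁆ 6 =
    spinCoord X 6 * spinCoord Y 0 + spinCoord X 1 * spinCoord Y 6 + spinCoord X 7 * spinCoord Y 9 +
      spinCoord X 8 * spinCoord Y 12 -
      (spinCoord Y 6 * spinCoord X 0 + spinCoord Y 1 * spinCoord X 6 +
        spinCoord Y 7 * spinCoord X 9 + spinCoord Y 8 * spinCoord X 12) +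
      2 * (spinCoord X 18 * spinCoord Y 19 - spinCoord X 19 * spinCoord Y 18) := by
  have h : spinCoord ⁅X, Y⁆ 6 =
    (X.1 (Y.1 (![1, 0, 0, 0], 0))).1 1 - (Y.1 (X.1 (![1, 0, 0, 0], 0))).1 1 := rfl
  simp only [h, spin7_apply, spinAct, slMatrix, pVector, Matrix.cons_val, Pi.zero_apply]
  ring

theorem spinCoord_lie_nine : spinCoord ⁅X, Y⁆ 9 =
    spinCoord X 9 * spinCoord Y 0 + spinCoord X 10 * spinCoord Y 6 +
      spinCoord X 2 * spinCoord Y 9 + spinCoord X 11 * spinCoord Y 12 -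
      (spinCoord Y 9 * spinCoord X 0 + spinCoord Y 10 * spinCoord X 6 +
        spinCoord Y 2 * spinCoord X 9 + spinCoord Y 11 * spinCoord X 12) +
      2 * (spinCoord X 18 * spinCoord Y 20 - spinCoord X 20 * spinCoord Y 18) := by
  have h : spinCoord ⁅X, Y⁆ 9 =
    (X.1 (Y.1 (![1, 0, 0, 0], 0))).1 2 - (Y.1 (X.1 (![1, 0, 0, 0], 0))).1 2 := rfl
  simp only [h, spin7_apply, spinAct, slMatrix, pVector, Matrix.cons_val, Pi.zero_apply]
  ring

theorem spinCoord_lie_twelve : spinCoord ⁅X, Y⁆ 12 =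
    spinCoord X 12 * spinCoord Y 0 + spinCoord X 13 * spinCoord Y 6 +
      spinCoord X 14 * spinCoord Y 9 -
      (spinCoord X 0 + spinCoord X 1 + spinCoord X 2) * spinCoord Y 12 -
      (spinCoord Y 12 * spinCoord X 0 + spinCoord Y 13 * spinCoord X 6 +
        spinCoord Y 14 * spinCoord X 9 -
        (spinCoord Y 0 + spinCoord Y 1 + spinCoord Y 2) * spinCoord X 12) +
      2 * (spinCoord X 19 * spinCoord Y 20 - spinCoord X 20 * spinCoord Y 19) := by
  have h : spinCoord ⁅X, Y⁆ 12 =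
    (X.1 (Y.1 (![1, 0, 0, 0], 0))).1 3 - (Y.1 (X.1 (![1, 0, 0, 0], 0))).1 3 := rfl
  simp only [h, spin7_apply, spinAct, slMatrix, pVector, Matrix.cons_val, Pi.zero_apply]
  ring

theorem spinCoord_lie_twenty : spinCoord ⁅X, Y⁆ 20 =
    spinCoord X 9 * spinCoord Y 17 + spinCoord X 10 * spinCoord Y 19 +
      spinCoord X 16 * spinCoord Y 12 + spinCoord X 18 * spinCoord Y 13 -
      (spinCoord X 0 + spinCoord X 1) * spinCoord Y 20 -
      (spinCoord Y 9 * spinCoord X 17 + spinCoord Y 10 * spinCoord X 19 +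
        spinCoord Y 16 * spinCoord X 12 + spinCoord Y 18 * spinCoord X 13 -
        (spinCoord Y 0 + spinCoord Y 1) * spinCoord X 20) := by
  have h : spinCoord ⁅X, Y⁆ 20 =
    (X.1 (Y.1 (0, ![0, 0, 0, 1]))).1 2 - (Y.1 (X.1 (0, ![0, 0, 0, 1]))).1 2 := rfl
  simp only [h, spin7_apply, spinAct, slMatrix, pVector, Matrix.cons_val, Pi.zero_apply]
  ring

variable (s t : Spinor)

theorem spinCoord_der_six :
    spinCoord (der s t) 6 = 4 / 3 * (s.1 1 * t.2 0 - t.1 1 * s.2 0) := by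
  have h : spinCoord (der s t) 6 = (derEnd s t (![1, 0, 0, 0], 0)).1 1 := rfl
  rw [h, derEnd_eq]
  simp [spinAct]

theorem spinCoord_der_nine :
    spinCoord (der s t) 9 = 4 / 3 * (s.1 2 * t.2 0 - t.1 2 * s.2 0) := by
  have h : spinCoord (der s t) 9 = (derEnd s t (![1, 0, 0, 0], 0)).1 2 := rfl
  rw [h, derEnd_eq]
  simp [spinAct]

theorem spinCoord_der_twelve :
    spinCoord (der s t) 12 = 4 / 3 * (s.1 3 * t.2 0 - t.1 3 * s.2 0) := by
  have h : spinCoord (der s t) 12 = (derEnd s t (![1, 0, 0, 0], 0)).1 3 := rfl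
  rw [h, derEnd_eq]
  simp [spinAct]

theorem spinCoord_der_eighteen : spinCoord (der s t) 18 =
    2 / 3 * ((s.1 1 * t.1 2 - s.1 2 * t.1 1) + (s.2 0 * t.2 3 - s.2 3 * t.2 0)) := by
  have h : spinCoord (der s t) 18 = (derEnd s t (0, ![0, 0, 1, 0])).1 1 := rfl
  rw [h, derEnd_eq]
  simp [spinAct]

theorem spinCoord_der_nineteen : spinCoord (der s t) 19 =
    2 / 3 * ((s.1 1 * t.1 3 - s.1 3 * t.1 1) - (s.2 0 * t.2 2 - s.2 2 * t.2 0)) := by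
  have h : spinCoord (der s t) 19 = (derEnd s t (0, ![0, 0, 0, 1])).1 1 := rfl
  rw [h, derEnd_eq]
  simp [spinAct]

theorem spinCoord_der_twenty : spinCoord (der s t) 20 =
    2 / 3 * ((s.1 2 * t.1 3 - s.1 3 * t.1 2) + (s.2 0 * t.2 1 - s.2 1 * t.2 0)) := by
  have h : spinCoord (der s t) 20 = (derEnd s t (0, ![0, 0, 0, 1])).1 2 := rfl
  rw [h, derEnd_eq]
  simp [spinAct]

end Spin

section Lie

variable (e e' : SL2 × spin7)

/-- The component of weight `-ε₂ - ε₃` of the bracket of even elements. -/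
theorem lie_coord_nine : weightCoords.LE ⁅e, e'⁆ 9 =
    weightCoords.LE e 9 * weightCoords.LE e' 3 + weightCoords.LE e 4 * weightCoords.LE e' 9 +
      weightCoords.LE e 10 * weightCoords.LE e' 12 + weightCoords.LE e 11 * weightCoords.LE e' 15 -
      (weightCoords.LE e' 9 * weightCoords.LE e 3 + weightCoords.LE e' 4 * weightCoords.LE e 9 +
        weightCoords.LE e' 10 * weightCoords.LE e 12 +
        weightCoords.LE e' 11 * weightCoords.LE e 15) +
      2 * (weightCoords.LE e 21 * weightCoords.LE e' 22 -
        weightCoords.LE e 22 * weightCoords.LE e' 21) :=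
  spinCoord_lie_six e.2 e'.2

set_option maxRecDepth 2000 in
/-- The component of weight `-ε₁ - ε₃` of the bracket of even elements. -/
theorem lie_coord_twelve : weightCoords.LE ⁅e, e'⁆ 12 =
    weightCoords.LE e 12 * weightCoords.LE e' 3 + weightCoords.LE e 13 * weightCoords.LE e' 9 +
      weightCoords.LE e 5 * weightCoords.LE e' 12 + weightCoords.LE e 14 * weightCoords.LE e' 15 -
      (weightCoords.LE e' 12 * weightCoords.LE e 3 + weightCoords.LE e' 13 * weightCoords.LE e 9 +
        weightCoords.LE e' 5 * weightCoords.LE e 12 +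
        weightCoords.LE e' 14 * weightCoords.LE e 15) +
      2 * (weightCoords.LE e 21 * weightCoords.LE e' 23 -
        weightCoords.LE e 23 * weightCoords.LE e' 21) :=
  spinCoord_lie_nine e.2 e'.2

set_option maxRecDepth 2000 in
/-- The component of weight `-ε₁ - ε₂` of the bracket of even elements. -/
theorem lie_coord_fifteen : weightCoords.LE ⁅e, e'⁆ 15 =
    weightCoords.LE e 15 * weightCoords.LE e' 3 + weightCoords.LE e 16 * weightCoords.LE e' 9 +
      weightCoords.LE e 17 * weightCoords.LE e' 12 -
      (weightCoords.LE e 3 + weightCoords.LE e 4 + weightCoords.LE e 5) *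
        weightCoords.LE e' 15 -
      (weightCoords.LE e' 15 * weightCoords.LE e 3 + weightCoords.LE e' 16 * weightCoords.LE e 9 +
        weightCoords.LE e' 17 * weightCoords.LE e 12 -
        (weightCoords.LE e' 3 + weightCoords.LE e' 4 + weightCoords.LE e' 5) *
          weightCoords.LE e 15) +
      2 * (weightCoords.LE e 22 * weightCoords.LE e' 23 -
        weightCoords.LE e 23 * weightCoords.LE e' 22) :=
  spinCoord_lie_twelve e.2 e'.2

set_option maxRecDepth 2000 in
/-- The component of weight `-ε₁` of the bracket of even elements. -/
theorem lie_coord_twenty_three : weightCoords.LE ⁅e, e'⁆ 23 =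
    weightCoords.LE e 12 * weightCoords.LE e' 20 + weightCoords.LE e 13 * weightCoords.LE e' 22 +
      weightCoords.LE e 19 * weightCoords.LE e' 15 + weightCoords.LE e 21 * weightCoords.LE e' 16 -
      (weightCoords.LE e 3 + weightCoords.LE e 4) * weightCoords.LE e' 23 -
      (weightCoords.LE e' 12 * weightCoords.LE e 20 + weightCoords.LE e' 13 * weightCoords.LE e 22 +
        weightCoords.LE e' 19 * weightCoords.LE e 15 +
        weightCoords.LE e' 21 * weightCoords.LE e 16 -
        (weightCoords.LE e' 3 + weightCoords.LE e' 4) * weightCoords.LE e 23) :=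
  spinCoord_lie_twenty e.2 e'.2

end Lie

section Odd

variable (P Q : Fin 2 → Spinor)

/-- The component of weight `-δ` of the bracket of odd elements. -/
theorem odd_coord_one : weightCoords.LE (superalgebra.odd P Q) 1 =
    -2 * (weightCoords.LO P 8 * weightCoords.LO Q 12 + weightCoords.LO P 9 * weightCoords.LO Q 13 +
        weightCoords.LO P 10 * weightCoords.LO Q 14 + weightCoords.LO P 11 * weightCoords.LO Q 15 +
        weightCoords.LO P 12 * weightCoords.LO Q 8 + weightCoords.LO P 13 * weightCoords.LO Q 9 +
        weightCoords.LO P 14 * weightCoords.LO Q 10 +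
        weightCoords.LO P 15 * weightCoords.LO Q 11) := by
  have h : weightCoords.LE (superalgebra.odd P Q) 1 =
    -(form (P 1) (Q 1) + form (Q 1) (P 1)) + 0 := rfl
  rw [h]
  simp only [weightCoords, oddCoord, form, LinearEquiv.coe_mk, LinearMap.coe_mk, AddHom.coe_mk,
    LinearMap.mk₂_apply, dotProduct, Fin.sum_univ_four, Matrix.cons_val]
  ring

/-- The component of weight `-ε₂ - ε₃` of the bracket of odd elements. -/
theorem odd_coord_nine : weightCoords.LE (superalgebra.odd P Q) 9 =
    4 / 3 * (weightCoords.LO P 1 * weightCoords.LO Q 12 -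
      weightCoords.LO P 4 * weightCoords.LO Q 9 -
      weightCoords.LO P 9 * weightCoords.LO Q 4 + weightCoords.LO P 12 * weightCoords.LO Q 1) := by
  have h : weightCoords.LE (superalgebra.odd P Q) 9 =
    0 + (spinCoord (der (P 0) (Q 1)) 6 + spinCoord (der (Q 0) (P 1)) 6) := rfl
  rw [h, spinCoord_der_six, spinCoord_der_six]
  simp only [weightCoords, oddCoord, LinearEquiv.coe_mk, LinearMap.coe_mk, AddHom.coe_mk,
    Matrix.cons_val]
  ring

/-- The component of weight `-ε₁ - ε₃` of the bracket of odd elements. -/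
theorem odd_coord_twelve : weightCoords.LE (superalgebra.odd P Q) 12 =
    4 / 3 * (weightCoords.LO P 2 * weightCoords.LO Q 12 -
      weightCoords.LO P 4 * weightCoords.LO Q 10 - weightCoords.LO P 10 * weightCoords.LO Q 4 +
      weightCoords.LO P 12 * weightCoords.LO Q 2) := by
  have h : weightCoords.LE (superalgebra.odd P Q) 12 =
    0 + (spinCoord (der (P 0) (Q 1)) 9 + spinCoord (der (Q 0) (P 1)) 9) := rfl
  rw [h, spinCoord_der_nine, spinCoord_der_nine]
  simp only [weightCoords, oddCoord, LinearEquiv.coe_mk, LinearMap.coe_mk, AddHom.coe_mk,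
    Matrix.cons_val]
  ring

/-- The component of weight `-ε₁ - ε₂` of the bracket of odd elements. -/
theorem odd_coord_fifteen : weightCoords.LE (superalgebra.odd P Q) 15 =
    4 / 3 * (weightCoords.LO P 3 * weightCoords.LO Q 12 -
      weightCoords.LO P 4 * weightCoords.LO Q 11 - weightCoords.LO P 11 * weightCoords.LO Q 4 +
      weightCoords.LO P 12 * weightCoords.LO Q 3) := by
  have h : weightCoords.LE (superalgebra.odd P Q) 15 =
    0 + (spinCoord (der (P 0) (Q 1)) 12 + spinCoord (der (Q 0) (P 1)) 12) := rfl
  rw [h, spinCoord_der_twelve, spinCoord_der_twelve]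
  simp only [weightCoords, oddCoord, LinearEquiv.coe_mk, LinearMap.coe_mk, AddHom.coe_mk,
    Matrix.cons_val]
  ring

/-- The component of weight `-ε₃` of the bracket of odd elements. -/
theorem odd_coord_twenty_one : weightCoords.LE (superalgebra.odd P Q) 21 =
    2 / 3 * (weightCoords.LO P 1 * weightCoords.LO Q 10 -
      weightCoords.LO P 2 * weightCoords.LO Q 9 - weightCoords.LO P 9 * weightCoords.LO Q 2 +
      weightCoords.LO P 10 * weightCoords.LO Q 1 + weightCoords.LO P 4 * weightCoords.LO Q 15 -
      weightCoords.LO P 7 * weightCoords.LO Q 12 - weightCoords.LO P 12 * weightCoords.LO Q 7 +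
      weightCoords.LO P 15 * weightCoords.LO Q 4) := by
  have h : weightCoords.LE (superalgebra.odd P Q) 21 =
    0 + (spinCoord (der (P 0) (Q 1)) 18 + spinCoord (der (Q 0) (P 1)) 18) := rfl
  rw [h, spinCoord_der_eighteen, spinCoord_der_eighteen]
  simp only [weightCoords, oddCoord, LinearEquiv.coe_mk, LinearMap.coe_mk, AddHom.coe_mk,
    Matrix.cons_val]
  ring

/-- The component of weight `-ε₂` of the bracket of odd elements. -/
theorem odd_coord_twenty_two : weightCoords.LE (superalgebra.odd P Q) 22 =
    2 / 3 * (weightCoords.LO P 1 * weightCoords.LO Q 11 -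
      weightCoords.LO P 3 * weightCoords.LO Q 9 - weightCoords.LO P 9 * weightCoords.LO Q 3 +
      weightCoords.LO P 11 * weightCoords.LO Q 1 - weightCoords.LO P 4 * weightCoords.LO Q 14 +
      weightCoords.LO P 6 * weightCoords.LO Q 12 + weightCoords.LO P 12 * weightCoords.LO Q 6 -
      weightCoords.LO P 14 * weightCoords.LO Q 4) := by
  have h : weightCoords.LE (superalgebra.odd P Q) 22 =
    0 + (spinCoord (der (P 0) (Q 1)) 19 + spinCoord (der (Q 0) (P 1)) 19) := rfl
  rw [h, spinCoord_der_nineteen, spinCoord_der_nineteen]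
  simp only [weightCoords, oddCoord, LinearEquiv.coe_mk, LinearMap.coe_mk, AddHom.coe_mk,
    Matrix.cons_val]
  ring

/-- The component of weight `-ε₁` of the bracket of odd elements. -/
theorem odd_coord_twenty_three : weightCoords.LE (superalgebra.odd P Q) 23 =
    2 / 3 * (weightCoords.LO P 2 * weightCoords.LO Q 11 -
      weightCoords.LO P 3 * weightCoords.LO Q 10 - weightCoords.LO P 10 * weightCoords.LO Q 3 +
      weightCoords.LO P 11 * weightCoords.LO Q 2 + weightCoords.LO P 4 * weightCoords.LO Q 13 -
      weightCoords.LO P 5 * weightCoords.LO Q 12 - weightCoords.LO P 12 * weightCoords.LO Q 5 +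
      weightCoords.LO P 13 * weightCoords.LO Q 4) := by
  have h : weightCoords.LE (superalgebra.odd P Q) 23 =
    0 + (spinCoord (der (P 0) (Q 1)) 20 + spinCoord (der (Q 0) (P 1)) 20) := rfl
  rw [h, spinCoord_der_twenty, spinCoord_der_twenty]
  simp only [weightCoords, oddCoord, LinearEquiv.coe_mk, LinearMap.coe_mk, AddHom.coe_mk,
    Matrix.cons_val]
  ring

end Odd

section Act

variable (e : SL2 × spin7) (P : Fin 2 → Spinor)

/-- The component of weight `½ (-δ + ε₁ - ε₂ - ε₃)` of the action of an even on an odd element. -/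
theorem act_coord_nine : weightCoords.LO (superalgebra.act e P) 9 =
    weightCoords.LE e 1 * weightCoords.LO P 1 - weightCoords.LE e 2 * weightCoords.LO P 9 +
      weightCoords.LE e 9 * weightCoords.LO P 8 + weightCoords.LE e 4 * weightCoords.LO P 9 +
      weightCoords.LE e 10 * weightCoords.LO P 10 + weightCoords.LE e 11 * weightCoords.LO P 11 -
      weightCoords.LE e 18 * weightCoords.LO P 12 + weightCoords.LE e 21 * weightCoords.LO P 14 +
      weightCoords.LE e 22 * weightCoords.LO P 15 := by
  have h : weightCoords.LO (superalgebra.act e P) 9 = (superalgebra.act e P 1).1 1 := rfl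
  simp only [h, act_apply, spin7_apply, spinAct, slMatrix, pVector, G3.sl2_apply_one_one,
    weightCoords, oddCoord, evenCoord, LinearEquiv.coe_mk, LinearMap.coe_mk, AddHom.coe_mk,
    Matrix.cons_val, Prod.fst_add, Prod.smul_fst, Pi.add_apply, Pi.smul_apply, smul_eq_mul]
  ring

/-- The component of weight `½ (-δ - ε₁ + ε₂ - ε₃)` of the action of an even on an odd element. -/
theorem act_coord_ten : weightCoords.LO (superalgebra.act e P) 10 =
    weightCoords.LE e 1 * weightCoords.LO P 2 - weightCoords.LE e 2 * weightCoords.LO P 10 +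
      weightCoords.LE e 12 * weightCoords.LO P 8 + weightCoords.LE e 13 * weightCoords.LO P 9 +
      weightCoords.LE e 5 * weightCoords.LO P 10 + weightCoords.LE e 14 * weightCoords.LO P 11 -
      weightCoords.LE e 19 * weightCoords.LO P 12 - weightCoords.LE e 21 * weightCoords.LO P 13 +
      weightCoords.LE e 23 * weightCoords.LO P 15 := by
  have h : weightCoords.LO (superalgebra.act e P) 10 = (superalgebra.act e P 1).1 2 := rfl
  simp only [h, act_apply, spin7_apply, spinAct, slMatrix, pVector, G3.sl2_apply_one_one,
    weightCoords, oddCoord, evenCoord, LinearEquiv.coe_mk, LinearMap.coe_mk, AddHom.coe_mk,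
    Matrix.cons_val, Prod.fst_add, Prod.smul_fst, Pi.add_apply, Pi.smul_apply, smul_eq_mul]
  ring

/-- The component of weight `½ (-δ - ε₁ - ε₂ + ε₃)` of the action of an even on an odd element. -/
theorem act_coord_eleven : weightCoords.LO (superalgebra.act e P) 11 =
    weightCoords.LE e 1 * weightCoords.LO P 3 - weightCoords.LE e 2 * weightCoords.LO P 11 +
      weightCoords.LE e 15 * weightCoords.LO P 8 + weightCoords.LE e 16 * weightCoords.LO P 9 +
      weightCoords.LE e 17 * weightCoords.LO P 10 -
      (weightCoords.LE e 3 + weightCoords.LE e 4 + weightCoords.LE e 5) * weightCoords.LO P 11 -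
      weightCoords.LE e 20 * weightCoords.LO P 12 - weightCoords.LE e 22 * weightCoords.LO P 13 -
      weightCoords.LE e 23 * weightCoords.LO P 14 := by
  have h : weightCoords.LO (superalgebra.act e P) 11 = (superalgebra.act e P 1).1 3 := rfl
  simp only [h, act_apply, spin7_apply, spinAct, slMatrix, pVector, G3.sl2_apply_one_one,
    weightCoords, oddCoord, evenCoord, LinearEquiv.coe_mk, LinearMap.coe_mk, AddHom.coe_mk,
    Matrix.cons_val, Prod.fst_add, Prod.smul_fst, Pi.add_apply, Pi.smul_apply, smul_eq_mul]
  ring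

/-- The component of weight `½ (-δ - ε₁ - ε₂ - ε₃)` of the action of an even on an odd element. -/
theorem act_coord_twelve : weightCoords.LO (superalgebra.act e P) 12 =
    weightCoords.LE e 1 * weightCoords.LO P 4 - weightCoords.LE e 2 * weightCoords.LO P 12 -
      weightCoords.LE e 3 * weightCoords.LO P 12 - weightCoords.LE e 9 * weightCoords.LO P 13 -
      weightCoords.LE e 12 * weightCoords.LO P 14 - weightCoords.LE e 15 * weightCoords.LO P 15 +
      weightCoords.LE e 23 * weightCoords.LO P 9 - weightCoords.LE e 22 * weightCoords.LO P 10 +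
      weightCoords.LE e 21 * weightCoords.LO P 11 := by
  have h : weightCoords.LO (superalgebra.act e P) 12 = (superalgebra.act e P 1).2 0 := rfl
  simp only [h, act_apply, spin7_apply, spinAct, slMatrix, pVector, G3.sl2_apply_one_one,
    weightCoords, oddCoord, evenCoord, LinearEquiv.coe_mk, LinearMap.coe_mk, AddHom.coe_mk,
    Matrix.cons_val, Prod.snd_add, Prod.smul_snd, Pi.add_apply, Pi.smul_apply, smul_eq_mul]
  ring

end Act

end F4

/-! ### Families with vanishing cross products -/

section Cross

theorem le_of_eq_sum_smul {M : Type*} [AddCommGroup M] [Module ℂ M] {n d : ℕ} {v : Fin n → M}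
    (hv : LinearIndependent ℂ v) (c : Fin n → Fin d → ℂ) (b : Fin d → M)
    (h : ∀ i, v i = ∑ j, c i j • b j) : n ≤ d := by
  have hc : LinearIndependent ℂ c := by
    refine LinearIndependent.of_comp (Fintype.linearCombination ℂ b) ?_
    convert hv using 1
    exact funext fun i => (h i).symm
  simpa using hc.fintype_card_le_finrank

theorem exists_eq_smul_of_cross_eq_zero {w v : Fin 3 → ℂ} (hw : w ≠ 0) (h : w ⨯₃ v = 0) :
    ∃ c : ℂ, v = c • w := by
  obtain ⟨k, hk⟩ := Function.ne_iff.1 hw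
  have h0 := congrFun h 0
  have h1 := congrFun h 1
  have h2 := congrFun h 2
  simp only [cross_apply, Matrix.cons_val, Pi.zero_apply] at h0 h1 h2 hk
  refine ⟨v k / w k, funext fun l => ?_⟩
  rw [Pi.smul_apply, smul_eq_mul, div_mul_eq_mul_div, eq_div_iff hk]
  fin_cases k <;> fin_cases l <;> simp only [Fin.zero_eta, Fin.mk_one, Fin.reduceFinMk] <;>
    first | rfl | linear_combination h0 | linear_combination -h0 | linear_combination h1 |
      linear_combination -h1 | linear_combination h2 | linear_combination -h2

/-- A linearly independent family `v i = (a i, b i)` in `ℂ² ⊗ ℂ³` such that the bracket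
`ℂ² ⊗ ℂ³ × ℂ² ⊗ ℂ³ → ℂ³` given by the cross product vanishes on it has at most three members: if
some `a i₀` is not zero, a shear in `SL(2)` makes `b i₀` vanish, and then all `b j` are multiples of
`a i₀`, which vanish unless all `a j` are multiples of `a i₀`. -/
theorem le_three_of_cross_add_cross_eq_zero {n : ℕ} {a b : Fin n → Fin 3 → ℂ}
    (hv : LinearIndependent ℂ fun i => (a i, b i))
    (h : ∀ i j, a i ⨯₃ b j + a j ⨯₃ b i = 0) : n ≤ 3 := by
  have hsum : ∀ u : Fin 3 → ℂ, u = ∑ k, u k • Pi.single k (1 : ℂ) := fun u => by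
    simpa using pi_eq_sum_univ' u
  by_cases ha : ∀ i, a i = 0
  · refine le_of_eq_sum_smul hv b (fun k => (0, Pi.single k 1)) fun i => ?_
    refine Prod.ext ?_ ?_
    · simp [ha, Prod.fst_sum]
    · simpa [Prod.snd_sum] using hsum (b i)
  push Not at ha
  obtain ⟨i₀, hi₀⟩ := ha
  have hself : ∀ i, a i ⨯₃ b i = 0 := fun i =>
    LieSuperalgebra.eq_zero_of_eq_neg (eq_neg_of_add_eq_zero_left (h i i))
  obtain ⟨l, hl⟩ := exists_eq_smul_of_cross_eq_zero hi₀ (hself i₀)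
  have hb : ∀ j, ∃ m : ℂ, b j - l • a j = m • a i₀ := by
    intro j
    refine exists_eq_smul_of_cross_eq_zero hi₀ ?_
    have h1 := h i₀ j
    rw [hl, map_smul, ← cross_anticomm (a i₀) (a j)] at h1
    rw [map_sub, map_smul, ← h1]
    module
  choose m hm using hb
  have hb : ∀ j, b j = l • a j + m j • a i₀ := fun j => by rw [← hm]; abel
  have hma : ∀ j, m j • (a j ⨯₃ a i₀) = 0 := fun j => by
    have := hself j
    rwa [hb, map_add, map_smul, map_smul, cross_self, smul_zero, zero_add] at this
  by_cases hpar : ∀ j, a i₀ ⨯₃ a j = 0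
  · choose c hc using fun j => exists_eq_smul_of_cross_eq_zero hi₀ (hpar j)
    refine (le_of_eq_sum_smul hv (fun j => ![c j, m j]) ![(a i₀, l • a i₀), (0, a i₀)]
      fun j => ?_).trans (by norm_num)
    rw [Fin.sum_univ_two]
    refine Prod.ext ?_ ?_
    · simpa using hc j
    · simp only [Matrix.cons_val, Prod.snd_add, Prod.smul_snd, hb j]
      rw [hc j]
      module
  · push Not at hpar
    obtain ⟨i, hi⟩ := hpar
    have hi' : a i ⨯₃ a i₀ ≠ 0 := by rwa [← cross_anticomm, neg_ne_zero]
    have hmi : m i = 0 := (smul_eq_zero.1 (hma i)).resolve_right hi'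
    have hm0 : ∀ j, m j = 0 := fun j => by
      have h1 := h i j
      rw [hb, hb i, hmi, zero_smul, add_zero, map_add, map_smul, map_smul, map_smul,
        ← cross_anticomm (a i) (a j)] at h1
      have h2 : m j • (a i ⨯₃ a i₀) = 0 := by rw [← h1]; module
      exact (smul_eq_zero.1 h2).resolve_right hi'
    refine le_of_eq_sum_smul hv a (fun k => (Pi.single k 1, l • Pi.single k 1)) fun j => ?_
    refine Prod.ext ?_ ?_
    · simpa [Prod.fst_sum] using hsum (a j)
    · simp only [Prod.snd_sum, Prod.smul_snd, hb j, hm0, zero_smul, add_zero]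
      conv_lhs => rw [hsum (a j)]
      simp only [Finset.smul_sum, smul_comm l]

end Cross

/-! ### Integral submanifolds for `F(4)` -/

namespace F4

open LieSuperalgebra

variable {p q : ℕ} {x : Fin 4 → ℤ}

/-- The case that the even part of `𝔤_{-1}` has the weights `-ε₁ ± ε₃`, `-ε₂ ± ε₃`, `-ε₁` and `-ε₂`,
and a nondegenerate alternating bracket with values in the root space of `-ε₁ - ε₂`. -/
theorem even_le_three (h : superalgebra.IsAbelianDim (cartan fun i => (x i : ℂ)) p q)
    (hx : ∀ k, weightCoords.degE x k = -2 → ∃ j, ![9, 12, 22, 23, 17, 16] j = k) : p ≤ 3 := by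
  obtain ⟨e, o, he, ho, hge, hgo, hee, heo, hoo⟩ := h
  have hE := fun i => weightCoords.even_eq_zero (hge i) hx
  have := two_mul_le_of_isotropic
    (weightCoords.linearIndependent_even he hge ![9, 12, 22, 23, 17, 16] hx)
    ![-1, -1, 2, -2, 1, 1] Fin.rev (by simp [Fin.forall_fin_succ]) Fin.rev_injective fun i j => by
      have h := lie_coord_fifteen (e i) (e j)
      simp (disch := decide) only [hee, map_zero, Pi.zero_apply, hE] at h
      simp only [Fin.sum_univ_six, Fin.reduceRev, Matrix.cons_val]
      linear_combination -h
  omega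

/-- The bracket of the root vectors of `-ε₁`, `-ε₂`, `-ε₃` is the cross product, with values in the
root spaces of `-ε_i - ε_j`. -/
theorem cross_even_eq_zero {e e' : SL2 × spin7}
    (he : ∀ k, (∀ j, ![1, 21, 22, 23] j ≠ k) → weightCoords.LE e k = 0)
    (he' : ∀ k, (∀ j, ![1, 21, 22, 23] j ≠ k) → weightCoords.LE e' k = 0) (h : ⁅e, e'⁆ = 0) :
    (fun j => weightCoords.LE e ((![21, 22, 23] : Fin 3 → Fin 24) j)) ⨯₃
      (fun j => weightCoords.LE e' ((![21, 22, 23] : Fin 3 → Fin 24) j)) = 0 := by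
  have h1 := lie_coord_nine e e'
  have h2 := lie_coord_twelve e e'
  have h3 := lie_coord_fifteen e e'
  simp (disch := decide) only [h, map_zero, Pi.zero_apply, he, he'] at h1 h2 h3
  refine funext fun k => ?_
  fin_cases k <;> simp only [cross_apply, Matrix.cons_val, Fin.zero_eta, Fin.mk_one,
    Fin.reduceFinMk, Pi.zero_apply]
  · linear_combination -h3 / 2
  · linear_combination h2 / 2
  · linear_combination -h1 / 2

/-- Here `𝔤_{-1}` is the odd spinor module, and its bracket is the invariant form with values in the
root space of `-δ`. -/
theorem dims_two_zero_zero_zero :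
    superDim (superalgebra.gr (cartan fun i => ((![2, 0, 0, 0] : Fin 4 → ℤ) i : ℂ)) (-1)) =
      (0, 8) ∧
    superalgebra.maxIntegralDims (cartan fun i => ((![2, 0, 0, 0] : Fin 4 → ℤ) i : ℂ)) =
      {(0, 4)} := by
  refine ⟨(weightCoords.superDim_gr _).trans (by decide),
    maxIntegralDims_eq isCenterless (by simp) ?_ fun p q h => ⟨_, rfl, ?_⟩⟩
  · rintro _ rfl
    exact weightCoords.isAbelianDim _ ![] ![8, 9, 10, 11] (by decide) (by decide) (by decide)
      (by decide) (by decide) (by decide) (by decide)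
  · obtain ⟨e, o, he, ho, hge, hgo, hee, heo, hoo⟩ := h
    have := two_mul_le_of_isotropic
      (weightCoords.linearIndependent_odd ho hgo ![8, 9, 10, 11, 15, 14, 13, 12] (by decide))
      (fun _ => -2) Fin.rev (by simp) Fin.rev_injective fun i j => by
        have h := odd_coord_one (o i) (o j)
        simp only [hoo, map_zero, Pi.zero_apply] at h
        simp only [Fin.sum_univ_eight, Fin.reduceRev, Matrix.cons_val]
        linear_combination -h
    exact ⟨weightCoords.le_of_linearIndependent_even he hge ![] (by decide), by
      change q ≤ 4; omega⟩

/-- Here `𝔤_{-1}` has the odd weights `½ (±δ - ε₁ ± ε₂ ± ε₃)`, which are paired by the root `-ε₁`.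
-/
theorem dims_zero_two_zero_zero :
    superDim (superalgebra.gr (cartan fun i => ((![0, 2, 0, 0] : Fin 4 → ℤ) i : ℂ)) (-1)) =
      (0, 8) ∧
    superalgebra.maxIntegralDims (cartan fun i => ((![0, 2, 0, 0] : Fin 4 → ℤ) i : ℂ)) =
      {(0, 4)} := by
  refine ⟨(weightCoords.superDim_gr _).trans (by decide),
    maxIntegralDims_eq isCenterless (by simp) ?_ fun p q h => ⟨_, rfl, ?_⟩⟩
  · rintro _ rfl
    exact weightCoords.isAbelianDim _ ![] ![2, 3, 4, 5] (by decide) (by decide) (by decide)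
      (by decide) (by decide) (by decide) (by decide)
  · obtain ⟨e, o, he, ho, hge, hgo, hee, heo, hoo⟩ := h
    have := two_mul_le_of_isotropic
      (weightCoords.linearIndependent_odd ho hgo ![2, 3, 4, 5, 12, 13, 10, 11] (by decide))
      ![1, -1, 1, -1, -1, 1, -1, 1] Fin.rev (by simp [Fin.forall_fin_succ]) Fin.rev_injective
      fun i j => by
        have h := odd_coord_twenty_three (o i) (o j)
        simp only [hoo, map_zero, Pi.zero_apply] at h
        simp only [Fin.sum_univ_eight, Fin.reduceRev, Matrix.cons_val]
        linear_combination -(3 / 2) * h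
    exact ⟨weightCoords.le_of_linearIndependent_even he hge ![] (by decide), by
      change q ≤ 4; omega⟩

/-- Here the odd part of `𝔤_{-1}` is abelian, and both the bracket of the even part and its action
on the odd part are cross products in `ℂ³`. If there is a nonzero even vector, all others, and all
odd vectors, are proportional to it under
identifications of the two parts with `ℂ³`. -/
theorem dims_three_one_one_one :
    superDim (superalgebra.gr (cartan fun i => ((![3, 1, 1, 1] : Fin 4 → ℤ) i : ℂ)) (-1)) =
      (3, 3) ∧
    superalgebra.maxIntegralDims (cartan fun i => ((![3, 1, 1, 1] : Fin 4 → ℤ) i : ℂ)) =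
      {(1, 1), (0, 3)} := by
  refine ⟨(weightCoords.superDim_gr _).trans (by decide),
    maxIntegralDims_eq isCenterless (by simp [IsAntichain, Set.Pairwise]) ?_ fun p q h => ?_⟩
  · rintro _ (rfl | rfl)
    · exact weightCoords.isAbelianDim _ ![23] ![13] (by decide) (by decide) (by decide)
        (by decide) (by decide) (by decide) (by decide)
    · exact weightCoords.isAbelianDim _ ![] ![13, 14, 15] (by decide) (by decide) (by decide)
        (by decide) (by decide) (by decide) (by decide)
  · obtain ⟨e, o, he, ho, hge, hgo, hee, heo, hoo⟩ := h
    have hE := fun i => weightCoords.even_mem_gr.1 (hge i)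
    have hO := fun i => weightCoords.odd_mem_gr.1 (hgo i)
    have hle := weightCoords.linearIndependent_even he hge ![21, 22, 23] (by decide)
    have hlo := weightCoords.linearIndependent_odd ho hgo ![13, 14, 15] (by decide)
    rcases Nat.eq_zero_or_pos p with rfl | hp
    · exact ⟨(0, 3), by simp, le_refl _,
        weightCoords.le_of_linearIndependent_odd ho hgo ![13, 14, 15] (by decide)⟩
    have hu : (fun j => weightCoords.LE (e ⟨0, hp⟩) ((![21, 22, 23] : Fin 3 → Fin 24) j)) ≠ 0 :=
      hle.ne_zero ⟨0, hp⟩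
    refine ⟨(1, 1), by simp, ?_, ?_⟩
    · have h1 : ∀ i, ∃ c : ℂ,
          (fun j => weightCoords.LE (e i) ((![21, 22, 23] : Fin 3 → Fin 24) j)) =
            c • fun j => weightCoords.LE (e ⟨0, hp⟩) ((![21, 22, 23] : Fin 3 → Fin 24) j) := by
        intro i
        refine exists_eq_smul_of_cross_eq_zero hu ?_
        have hsub : ∀ k, (∀ j, ![1, 21, 22, 23] j ≠ k) →
            weightCoords.degE ![3, 1, 1, 1] k ≠ -2 := by decide
        exact cross_even_eq_zero (fun k hk => hE ⟨0, hp⟩ k (hsub k hk))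
          (fun k hk => hE i k (hsub k hk)) (hee ⟨0, hp⟩ i)
      choose c hc using h1
      exact le_of_eq_sum_smul hle (fun i _ => c i) (fun _ : Fin 1 => _) fun i => by
        rw [Fin.sum_univ_one]; exact hc i
    · have h1 : ∀ i, ∃ c : ℂ, (![weightCoords.LO (o i) 15, -weightCoords.LO (o i) 14,
          weightCoords.LO (o i) 13] : Fin 3 → ℂ) =
            c • fun j => weightCoords.LE (e ⟨0, hp⟩) ((![21, 22, 23] : Fin 3 → Fin 24) j) := by
        intro i
        refine exists_eq_smul_of_cross_eq_zero hu ?_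
        have h1 := act_coord_nine (e ⟨0, hp⟩) (o i)
        have h2 := act_coord_ten (e ⟨0, hp⟩) (o i)
        have h3 := act_coord_eleven (e ⟨0, hp⟩) (o i)
        simp (disch := decide) only [heo, map_zero, Pi.zero_apply, hE, hO] at h1 h2 h3
        refine funext fun k => ?_
        fin_cases k <;> simp only [cross_apply, Matrix.cons_val, Fin.zero_eta, Fin.mk_one,
          Fin.reduceFinMk, Pi.zero_apply]
        · linear_combination h3
        · linear_combination -h2
        · linear_combination h1
      choose c hc using h1
      refine le_of_eq_sum_smul hlo (fun i _ => c i) (fun _ : Fin 1 =>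
        ![weightCoords.LE (e ⟨0, hp⟩) 23, -weightCoords.LE (e ⟨0, hp⟩) 22,
          weightCoords.LE (e ⟨0, hp⟩) 21]) fun i => ?_
      rw [Fin.sum_univ_one]
      have h0 := congrFun (hc i) 0
      have h1 := congrFun (hc i) 1
      have h2 := congrFun (hc i) 2
      simp only [Pi.smul_apply, smul_eq_mul, Matrix.cons_val] at h0 h1 h2
      refine funext fun k => ?_
      fin_cases k <;> simp only [Matrix.cons_val, Fin.zero_eta, Fin.mk_one, Fin.reduceFinMk,
        Pi.smul_apply, smul_eq_mul]
      · exact h2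
      · linear_combination -h1
      · exact h0

/-- The odd weights `½ (-δ + ε₁ - ε₂ ± ε₃)` and `½ (-δ - ε₁ + ε₂ ± ε₃)` are paired by the root `-δ`.
-/
theorem dims_two_one_one_zero :
    superDim (superalgebra.gr (cartan fun i => ((![2, 1, 1, 0] : Fin 4 → ℤ) i : ℂ)) (-1)) =
      (6, 4) ∧
    superalgebra.maxIntegralDims (cartan fun i => ((![2, 1, 1, 0] : Fin 4 → ℤ) i : ℂ)) =
      {(3, 2)} := by
  refine ⟨(weightCoords.superDim_gr _).trans (by decide), maxIntegralDims_eq isCenterless (by simp)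
    ?_ fun p q h => ⟨_, rfl, even_le_three h (by decide), ?_⟩⟩
  · rintro _ rfl
    exact weightCoords.isAbelianDim _ ![23, 12, 16] ![10, 13] (by decide) (by decide) (by decide)
      (by decide) (by decide) (by decide) (by decide)
  · obtain ⟨e, o, he, ho, hge, hgo, hee, heo, hoo⟩ := h
    have hO := fun i => weightCoords.odd_mem_gr.1 (hgo i)
    have := two_mul_le_of_isotropic
      (weightCoords.linearIndependent_odd ho hgo ![9, 10, 14, 13] (by decide))
      (fun _ => -2) Fin.rev (by simp) Fin.rev_injective fun i j => by
        have h := odd_coord_one (o i) (o j)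
        simp (disch := decide) only [hoo, map_zero, Pi.zero_apply, hO] at h
        simp only [Fin.sum_univ_four, Fin.reduceRev, Matrix.cons_val]
        linear_combination -h
    change q ≤ 2
    omega

/-- Here `𝔤_{-1}` is abelian. -/
theorem dims_one_one_zero_zero :
    superDim (superalgebra.gr (cartan fun i => ((![1, 1, 0, 0] : Fin 4 → ℤ) i : ℂ)) (-1)) =
      (6, 4) ∧
    superalgebra.maxIntegralDims (cartan fun i => ((![1, 1, 0, 0] : Fin 4 → ℤ) i : ℂ)) =
      {(6, 4)} := by
  refine ⟨(weightCoords.superDim_gr _).trans (by decide),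
    maxIntegralDims_eq isCenterless (by simp) ?_ fun p q h => ⟨_, rfl, ?_⟩⟩
  · rintro _ rfl
    exact weightCoords.isAbelianDim _ ![1, 12, 13, 15, 16, 23] ![10, 11, 12, 13] (by decide)
      (by decide) (by decide) (by decide) (by decide) (by decide) (by decide)
  · obtain ⟨e, o, he, ho, hge, hgo, hee, heo, hoo⟩ := h
    exact ⟨weightCoords.le_of_linearIndependent_even he hge ![1, 12, 13, 15, 16, 23] (by decide),
      weightCoords.le_of_linearIndependent_odd ho hgo ![10, 11, 12, 13] (by decide)⟩

/-- Both the even weights `-ε₁ + ε₂`, `-ε₁ + ε₃`, `-ε₂`, `-ε₃` and the odd weights `½ (±δ - ε₁ + ε₂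
- ε₃)`, `½ (±δ - ε₁ - ε₂ + ε₃)` are paired by the root `-ε₁`. -/
theorem dims_zero_two_one_one :
    superDim (superalgebra.gr (cartan fun i => ((![0, 2, 1, 1] : Fin 4 → ℤ) i : ℂ)) (-1)) =
      (4, 4) ∧
    superalgebra.maxIntegralDims (cartan fun i => ((![0, 2, 1, 1] : Fin 4 → ℤ) i : ℂ)) =
      {(2, 2)} := by
  refine ⟨(weightCoords.superDim_gr _).trans (by decide),
    maxIntegralDims_eq isCenterless (by simp) ?_ fun p q h => ⟨_, rfl, ?_⟩⟩
  · rintro _ rfl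
    exact weightCoords.isAbelianDim _ ![22, 16] ![3, 11] (by decide) (by decide) (by decide)
      (by decide) (by decide) (by decide) (by decide)
  · obtain ⟨e, o, he, ho, hge, hgo, hee, heo, hoo⟩ := h
    have hE := fun i => weightCoords.even_mem_gr.1 (hge i)
    have hO := fun i => weightCoords.odd_mem_gr.1 (hgo i)
    have hp := two_mul_le_of_isotropic
      (weightCoords.linearIndependent_even he hge ![13, 21, 16, 22] (by decide))
      ![1, 1, -1, -1] Fin.rev (by simp [Fin.forall_fin_succ]) Fin.rev_injective fun i j => by
        have h := lie_coord_twenty_three (e i) (e j)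
        simp (disch := decide) only [hee, map_zero, Pi.zero_apply, hE] at h
        simp only [Fin.sum_univ_four, Fin.reduceRev, Matrix.cons_val]
        linear_combination -h
    have hq := two_mul_le_of_isotropic
      (weightCoords.linearIndependent_odd ho hgo ![2, 3, 10, 11] (by decide))
      ![1, -1, -1, 1] Fin.rev (by simp [Fin.forall_fin_succ]) Fin.rev_injective fun i j => by
        have h := odd_coord_twenty_three (o i) (o j)
        simp (disch := decide) only [hoo, map_zero, Pi.zero_apply, hO] at h
        simp only [Fin.sum_univ_four, Fin.reduceRev, Matrix.cons_val]
        linear_combination -(3 / 2) * h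
    exact ⟨by change p ≤ 2; omega, by change q ≤ 2; omega⟩

/-- The odd weights `½ (±δ - ε₁ - ε₂ ± ε₃)` are paired by the root `-ε₁ - ε₂`. -/
theorem dims_zero_one_one_zero :
    superDim (superalgebra.gr (cartan fun i => ((![0, 1, 1, 0] : Fin 4 → ℤ) i : ℂ)) (-1)) =
      (6, 4) ∧
    superalgebra.maxIntegralDims (cartan fun i => ((![0, 1, 1, 0] : Fin 4 → ℤ) i : ℂ)) =
      {(3, 2)} := by
  refine ⟨(weightCoords.superDim_gr _).trans (by decide), maxIntegralDims_eq isCenterless (by simp)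
    ?_ fun p q h => ⟨_, rfl, even_le_three h (by decide), ?_⟩⟩
  · rintro _ rfl
    exact weightCoords.isAbelianDim _ ![23, 12, 16] ![4, 12] (by decide) (by decide) (by decide)
      (by decide) (by decide) (by decide) (by decide)
  · obtain ⟨e, o, he, ho, hge, hgo, hee, heo, hoo⟩ := h
    have hO := fun i => weightCoords.odd_mem_gr.1 (hgo i)
    have := two_mul_le_of_isotropic
      (weightCoords.linearIndependent_odd ho hgo ![3, 4, 11, 12] (by decide))
      ![1, -1, -1, 1] Fin.rev (by simp [Fin.forall_fin_succ]) Fin.rev_injective fun i j => by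
        have h := odd_coord_fifteen (o i) (o j)
        simp (disch := decide) only [hoo, map_zero, Pi.zero_apply, hO] at h
        simp only [Fin.sum_univ_four, Fin.reduceRev, Matrix.cons_val]
        linear_combination -(3 / 4) * h
    change q ≤ 2
    omega

/-- Here `𝔤_{-1} = ℂ² ⊗ ℂ³` is odd, with the weights `½ (±δ + ε_i - ε_j - ε_k)`; its bracket is the
cross product of `ℂ³` tensored with the alternating form of `ℂ²`. -/
theorem dims_zero_two_two_two :
    superDim (superalgebra.gr (cartan fun i => ((![0, 2, 2, 2] : Fin 4 → ℤ) i : ℂ)) (-1)) =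
      (0, 6) ∧
    superalgebra.maxIntegralDims (cartan fun i => ((![0, 2, 2, 2] : Fin 4 → ℤ) i : ℂ)) =
      {(0, 3)} := by
  refine ⟨(weightCoords.superDim_gr _).trans (by decide),
    maxIntegralDims_eq isCenterless (by simp) ?_ fun p q h => ⟨_, rfl, ?_⟩⟩
  · rintro _ rfl
    exact weightCoords.isAbelianDim _ ![] ![1, 2, 3] (by decide) (by decide) (by decide)
      (by decide) (by decide) (by decide) (by decide)
  · obtain ⟨e, o, he, ho, hge, hgo, hee, heo, hoo⟩ := h
    have hO := fun i => weightCoords.odd_mem_gr.1 (hgo i)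
    refine ⟨weightCoords.le_of_linearIndependent_even he hge ![] (by decide), ?_⟩
    refine le_three_of_cross_add_cross_eq_zero
      (a := fun i => ![weightCoords.LO (o i) 1, weightCoords.LO (o i) 2, weightCoords.LO (o i) 3])
      (b := fun i => ![weightCoords.LO (o i) 9, weightCoords.LO (o i) 10,
        weightCoords.LO (o i) 11]) ?_ fun i j => ?_
    · let T : (Fin 3 → ℂ) × (Fin 3 → ℂ) →ₗ[ℂ] (Fin 6 → ℂ) :=
        { toFun := fun v => ![v.1 0, v.1 1, v.1 2, v.2 0, v.2 1, v.2 2]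
          map_add' := fun v w => by ext k; fin_cases k <;> rfl
          map_smul' := fun c v => by ext k; fin_cases k <;> rfl }
      refine LinearIndependent.of_comp T ?_
      convert weightCoords.linearIndependent_odd ho hgo ![1, 2, 3, 9, 10, 11] (by decide) using 1
      refine funext fun i => funext fun k => ?_
      fin_cases k <;> rfl
    · have h1 := odd_coord_twenty_one (o i) (o j)
      have h2 := odd_coord_twenty_two (o i) (o j)
      have h3 := odd_coord_twenty_three (o i) (o j)
      simp (disch := decide) only [hoo, map_zero, Pi.zero_apply, hO] at h1 h2 h3
      refine funext fun k => ?_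
      fin_cases k <;> simp only [cross_apply, Matrix.cons_val, Fin.zero_eta, Fin.mk_one,
        Fin.reduceFinMk, Pi.zero_apply, Pi.add_apply]
      · linear_combination -(3 / 2) * h3
      · linear_combination (3 / 2) * h2
      · linear_combination -(3 / 2) * h1

/-- The case that the even part of `𝔤_{-1}` has the weights `-δ`, `-ε₁`, `-ε₂` and `-ε₃`. By
`cross_even_eq_zero` the components of weights `-ε_i` of the members of an abelian family are
proportional. -/
theorem even_le_two {e : Fin p → SL2 × spin7} (he : LinearIndependent ℂ e)
    (hge : ∀ i, ((e i, 0) : (SL2 × spin7) × (Fin 2 → Spinor)) ∈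
      superalgebra.gr (cartan fun i => (x i : ℂ)) (-1))
    (hx : ∀ k, weightCoords.degE x k = -2 → ∃ j, ![1, 21, 22, 23] j = k)
    (hee : ∀ i i', ⁅e i, e i'⁆ = 0) : p ≤ 2 := by
  have hE := fun i => weightCoords.even_eq_zero (hge i) hx
  have hle := weightCoords.linearIndependent_even he hge ![1, 21, 22, 23] hx
  by_cases h0 : ∀ i, (fun j => weightCoords.LE (e i) ((![21, 22, 23] : Fin 3 → Fin 24) j)) = 0
  · refine (le_of_eq_sum_smul hle (fun i _ => weightCoords.LE (e i) 1)
      (fun _ : Fin 1 => ![1, 0, 0, 0]) fun i => ?_).trans one_le_two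
    rw [Fin.sum_univ_one]
    refine funext fun k => Fin.cases (by simp) (fun k => ?_) k
    rw [Pi.smul_apply]
    have h1 : (![1, 0, 0, 0] : Fin 4 → ℂ) k.succ = 0 := by fin_cases k <;> rfl
    rw [h1, smul_zero]
    exact congrFun (h0 i) k
  · push Not at h0
    obtain ⟨i₀, hi₀⟩ := h0
    choose c hc using fun i => exists_eq_smul_of_cross_eq_zero hi₀
      (cross_even_eq_zero (hE i₀) (hE i) (hee i₀ i))
    refine le_of_eq_sum_smul hle (fun i => ![weightCoords.LE (e i) 1, c i])
      ![![1, 0, 0, 0], ![0, weightCoords.LE (e i₀) 21, weightCoords.LE (e i₀) 22,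
        weightCoords.LE (e i₀) 23]] fun i => ?_
    rw [Fin.sum_univ_two]
    have h0 := congrFun (hc i) 0
    have h1 := congrFun (hc i) 1
    have h2 := congrFun (hc i) 2
    simp only [Pi.smul_apply, smul_eq_mul, Matrix.cons_val] at h0 h1 h2
    refine funext fun k => ?_
    fin_cases k <;> simp [h0, h1, h2]

/-- Here `𝔤_{-1}` has the weights `-δ`, `-ε_i` and `½ (δ - ε₁ - ε₂ - ε₃)`, `½ (-δ + ε_i - ε_j -
ε_k)`. The bound depends on whether an odd vector has a component of the first odd weight. -/
theorem dims_one_one_one_one :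
    superDim (superalgebra.gr (cartan fun i => ((![1, 1, 1, 1] : Fin 4 → ℤ) i : ℂ)) (-1)) =
      (4, 4) ∧
    superalgebra.maxIntegralDims (cartan fun i => ((![1, 1, 1, 1] : Fin 4 → ℤ) i : ℂ)) =
      {(1, 3), (2, 2)} := by
  refine ⟨(weightCoords.superDim_gr _).trans (by decide),
    maxIntegralDims_eq isCenterless (by simp [IsAntichain, Set.Pairwise]) ?_ fun p q h => ?_⟩
  · rintro _ (rfl | rfl)
    · exact weightCoords.isAbelianDim _ ![1] ![9, 10, 11] (by decide) (by decide) (by decide)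
        (by decide) (by decide) (by decide) (by decide)
    · exact weightCoords.isAbelianDim _ ![1, 23] ![10, 11] (by decide) (by decide) (by decide)
        (by decide) (by decide) (by decide) (by decide)
  obtain ⟨e, o, he, ho, hge, hgo, hee, heo, hoo⟩ := h
  have hE := fun i => weightCoords.even_mem_gr.1 (hge i)
  have hO := fun i => weightCoords.odd_mem_gr.1 (hgo i)
  have hp : p ≤ 2 := even_le_two he hge (by decide) hee
  by_cases hh : ∀ j, weightCoords.LO (o j) 4 = 0
  · -- all odd vectors lie in the span of the weight vectors of weight `½ (-δ + ε_i - ε_j - ε_k)`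
    have hlo : LinearIndependent ℂ fun i j => weightCoords.LO (o i) (![9, 10, 11] j) := by
      refine WeightCoords.linearIndependent_coord weightCoords.LO ho _ fun i k hk => ?_
      by_cases hk4 : 4 = k
      · rw [← hk4]; exact hh i
      · exact weightCoords.odd_eq_zero (hgo i) (f := ![4, 9, 10, 11]) (by decide) k
          fun j => Fin.cases hk4 hk j
    have hq : q ≤ 3 := by simpa using hlo.fintype_card_le_finrank
    rcases Nat.lt_or_ge p 2 with hp1 | hp2
    · exact ⟨(1, 3), by simp, Nat.le_of_lt_succ hp1, hq⟩
    refine ⟨(2, 2), by simp, hp, ?_⟩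
    -- some even vector has a nonzero component of weight `-ε_k`, as the family has two members
    obtain ⟨i₀, hi₀⟩ : ∃ i, ![weightCoords.LE (e i) 23, -weightCoords.LE (e i) 22,
        weightCoords.LE (e i) 21] ≠ 0 := by
      by_contra! h0
      have hle := weightCoords.linearIndependent_even he hge ![1, 21, 22, 23] (by decide)
      have : p ≤ 1 := by
        refine le_of_eq_sum_smul hle (fun i _ => weightCoords.LE (e i) 1)
          (fun _ : Fin 1 => ![1, 0, 0, 0]) fun i => ?_
        have h1 := congrFun (h0 i) 0
        have h2 := congrFun (h0 i) 1
        have h3 := congrFun (h0 i) 2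
        simp only [Matrix.cons_val, Pi.zero_apply, neg_eq_zero] at h1 h2 h3
        refine funext fun k => ?_
        fin_cases k <;> simp [h1, h2, h3]
      omega
    have hli : LinearIndependent ℂ fun _ : Fin 1 => ![weightCoords.LE (e i₀) 23,
        -weightCoords.LE (e i₀) 22, weightCoords.LE (e i₀) 21] :=
      LinearIndependent.of_subsingleton 0 hi₀
    have := add_le_of_dotProduct_eq_zero hli hlo fun _ j => by
      have h := act_coord_twelve (e i₀) (o j)
      simp (disch := decide) only [heo, map_zero, Pi.zero_apply, hE, hO, hh] at h
      simp only [dotProduct, Fin.sum_univ_three, Matrix.cons_val]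
      linear_combination -h
    change q ≤ 2
    omega
  · -- an odd vector with a component of weight `½ (δ - ε₁ - ε₂ - ε₃)` is this weight vector, and
    -- all other odd vectors are multiples of it
    push Not at hh
    obtain ⟨j₀, hj₀⟩ := hh
    refine ⟨(2, 2), by simp, hp, le_trans ?_ one_le_two⟩
    have hb : ∀ i j, weightCoords.LO (o i) 4 * weightCoords.LO (o j) 9 +
          weightCoords.LO (o i) 9 * weightCoords.LO (o j) 4 = 0 ∧
        weightCoords.LO (o i) 4 * weightCoords.LO (o j) 10 +
          weightCoords.LO (o i) 10 * weightCoords.LO (o j) 4 = 0 ∧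
        weightCoords.LO (o i) 4 * weightCoords.LO (o j) 11 +
          weightCoords.LO (o i) 11 * weightCoords.LO (o j) 4 = 0 := by
      intro i j
      have h1 := odd_coord_nine (o i) (o j)
      have h2 := odd_coord_twelve (o i) (o j)
      have h3 := odd_coord_fifteen (o i) (o j)
      simp (disch := decide) only [hoo, map_zero, Pi.zero_apply, hO] at h1 h2 h3
      exact ⟨by linear_combination (3 / 4) * h1, by linear_combination (3 / 4) * h2,
        by linear_combination (3 / 4) * h3⟩
    have hz : ∀ a : Fin q → ℂ, (∀ i j, weightCoords.LO (o i) 4 * a j +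
        a i * weightCoords.LO (o j) 4 = 0) → ∀ i, a i = 0 := by
      intro a ha i
      have h1 : a j₀ = 0 := by
        have := ha j₀ j₀
        have h2 : weightCoords.LO (o j₀) 4 * a j₀ = 0 := by linear_combination this / 2
        exact (mul_eq_zero.1 h2).resolve_left hj₀
      have h3 := ha j₀ i
      rw [h1, zero_mul, add_zero] at h3
      exact (mul_eq_zero.1 h3).resolve_left hj₀
    have h1 := hz _ fun i j => (hb i j).1
    have h2 := hz _ fun i j => (hb i j).2.1
    have h3 := hz _ fun i j => (hb i j).2.2
    refine le_of_eq_sum_smul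
      (weightCoords.linearIndependent_odd ho hgo ![4, 9, 10, 11] (by decide))
      (fun i _ => weightCoords.LO (o i) 4) (fun _ : Fin 1 => ![1, 0, 0, 0]) fun i => ?_
    refine funext fun k => ?_
    fin_cases k <;> simp [h1, h2, h3]

/-- The coordinates `x` of the grading elements `Z = cartan x`. -/
def gradingVector : Diagram → Fin 4 → Fin 4 → ℤ
  | .I => ![![2, 0, 0, 0], ![3, 1, 1, 1], ![2, 1, 1, 0], ![1, 1, 0, 0]]
  | .II => ![![1, 1, 1, 1], ![3, 1, 1, 1], ![2, 1, 1, 0], ![1, 1, 0, 0]]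
  | .III => ![![1, 1, 0, 0], ![2, 1, 1, 0], ![0, 1, 1, 0], ![1, 1, 1, 1]]
  | .IV => ![![1, 1, 0, 0], ![1, 1, 1, 1], ![0, 2, 1, 1], ![0, 1, 1, 0]]
  | .V => ![![1, 1, 0, 0], ![0, 2, 0, 0], ![0, 2, 1, 1], ![0, 1, 1, 0]]
  | .VI => ![![1, 1, 1, 1], ![0, 2, 2, 2], ![0, 2, 1, 1], ![0, 1, 1, 0]]

theorem isGrading_gradingVector (Ξ : Diagram) (i : Fin 4) :
    IsGrading Ξ i fun k => (gradingVector Ξ i k : ℂ) := by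
  refine funext fun k => ?_
  cases Ξ <;> fin_cases i <;> fin_cases k <;> simp [simpleRoot, gradingVector] <;> norm_num

theorem superDim_and_maxIntegralDims (Ξ : Diagram) (i : Fin 4) (x : Fin 4 → ℂ)
    (hx : IsGrading Ξ i x) :
    superDim (superalgebra.gr (cartan x) (-1)) = dimTable Ξ i ∧
      superalgebra.maxIntegralDims (cartan x) = maxDimTable Ξ i := by
  obtain rfl := (existsUnique_isGrading Ξ i).unique hx (isGrading_gradingVector Ξ i)
  cases Ξ <;> fin_cases i
  exacts [dims_two_zero_zero_zero, dims_three_one_one_one, dims_two_one_one_zero,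
    dims_one_one_zero_zero,
    dims_one_one_one_one, dims_three_one_one_one, dims_two_one_one_zero,
    dims_one_one_zero_zero,
    dims_one_one_zero_zero, dims_two_one_one_zero, dims_zero_one_one_zero,
    dims_one_one_one_one,
    dims_one_one_zero_zero, dims_one_one_one_one, dims_zero_two_one_one,
    dims_zero_one_one_zero,
    dims_one_one_zero_zero, dims_zero_two_zero_zero, dims_zero_two_one_one,
    dims_zero_one_one_zero,
    dims_one_one_one_one, dims_zero_two_two_two, dims_zero_two_one_one,
    dims_zero_one_one_zero]

end F4

end

theorem mainTheorem7 :
    (∀ (Ξ : G3.Diagram) (i : Fin 3) (x : Fin 3 → ℂ), G3.IsGrading Ξ i x →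
      LieSuperalgebra.superDim (G3.superalgebra.gr (G3.cartan x) (-1)) = G3.dimTable Ξ i ∧
      G3.superalgebra.maxIntegralDims (G3.cartan x) = G3.maxDimTable Ξ i) ∧
    (∀ (Ξ : F4.Diagram) (i : Fin 4) (x : Fin 4 → ℂ), F4.IsGrading Ξ i x →
      LieSuperalgebra.superDim (F4.superalgebra.gr (F4.cartan x) (-1)) = F4.dimTable Ξ i ∧
      F4.superalgebra.maxIntegralDims (F4.cartan x) = F4.maxDimTable Ξ i) :=
  ⟨G3.superDim_and_maxIntegralDims, F4.superDim_and_maxIntegralDims⟩
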